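/- Let $G\subset\mathbb R_{\ge 0}$ be an additive submonoid such that $G\cap[0,E]$ is finite for every $E$, let $(\overline V,D,\circ)$ be a ($\mathbb Z$-graded, not necessarily unital) differential graded algebra over $\mathbb C$, and let $V=\overline V\hat\otimes\Lambda_G$, where $\Lambda_G$ is the ring of formal series $\sum_{\beta\in G}a_\beta T^{\beta}$, $a_\beta\in\mathbb C$. Let $\mathsf{Coder}(\mathbb BV)$ be the graded Lie algebra of continuous $\Lambda_G$-linear coderivations of the tensor coalgebra $\mathbb T(V[1])$; such a coderivation is the same as a family of multilinear maps $\phi_{k,\beta}:\overline V[1]^{k}\to\overline V[1]$ ($k\ge 0$, $\beta\in G$). Let $Q_0\in\mathsf{Coder}(\mathbb BV)$ be the coderivation with components $D$ and $(x,y)\mapsto(-1)^{|x|}x\circ y$ (with $|x|$ the degree in $\overline V$), and write $\phi\circ\psi=\sum\phi(\mathrm{id}^i\otimes\psi\otimes\mathrm{id}^k)$ with Koszul signs and $[\phi,\psi]=\phi\circ\psi-(-1)^{|\phi||\psi|}\psi\circ\phi$. Let $\Delta^2$ have coordinates $t_1,t_2\ge 0$, $t_1+t_2\le 1$ ($t_0=1-t_1-t_2$).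 A $2$-pseudo-isotopy is an element $$\alpha=m+h_1\,dt_1+h_2\,dt_2+g\,dt_1\wedge dt_2$$ of total degree one of $\mathsf{Coder}(\mathbb BV)\hat\otimes\Omega^*(\Delta^2)$, where $\Omega^*(\Delta^2)$ denotes the smooth complex forms which near each vertex are constant functions (each $m_{k,\beta}(x_1,\dots,x_k)$, and likewise for $h_1,h_2,g$, lies in $\overline V\otimes C^\infty(\Delta^2)$), such that $\alpha$ is positive (all components of energy $\beta=0$ vanish) and satisfies the Maurer–Cartan equation $d\alpha=[Q_0,\alpha]+\frac12[\alpha,\alpha]$ with the sign convention in which it reads, for $b=Q_0+m$, $$b\circ b=0,\qquad \partial_1 m=-[b,h_1],\quad \partial_2 m=-[b,h_2],\qquad \partial_1h_2-\partial_2h_1=[h_1,h_2]+[b,g].$$ Let $\delta_0,\delta_1,\delta_2$ be the values of $m$ at the vertices $0=(0,0)$, $1=(1,0)$, $2=(0,1)$ (so $Q_0+\delta_i$ are $G$-gapped filtered $A_\infty$ structures on $V$), and let $\partial_i\alpha$ be the pull-back of $\alpha$ to the face opposite to the vertex $i$, parametrised affinely by $t\in[0,1]$ in the order of the vertices. For a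 pseudo-isotopy $\gamma=m^t+h^t\,dt$ over $[0,1]$ define $$F[\gamma]_{k,\beta}=\sum_{(T,\lambda)}\int_{\mathcal M(T)}\rho(T,\lambda,\tau)\,d\tau,$$ where $(T,\lambda)$ runs over the rooted ribbon trees with $k$ leaves whose interior vertices $v$ are decorated by $\lambda(v)\in G$ with $\sum_v\lambda(v)=\beta$, such that vertices with $\lambda(v)=0$ have valency at least $3$; $\mathcal M(T)$ is the set of maps $\tau$ from the interior vertices to $[0,1]$ which do not decrease towards the root, with Lebesgue measure; and $\rho(T,\lambda,\tau)$ is the operadic composition along $T$ of the maps $h^{\tau(v)}_{\mathrm{val}(v)-1,\lambda(v)}$. Two $G$-gapped filtered $A_\infty$ homomorphisms $f_0,f_1:A\to B$ are called homotopic (Fukaya–Oh–Ohta–Ono) if there are a model $\mathfrak B$ of $[0,1]\times B$ and an $A_\infty$ homomorphism $H:A\to\mathfrak B$ with $\mathrm{Eval}_0\circ H=f_0$ and $\mathrm{Eval}_1\circ H=f_1$. Here a model of $[0,1]\times B$ is a $G$-gapped filtered $A_\infty$ algebra $\mathfrak B$ with $A_\infty$ homomorphisms $\mathrm{Incl}:B\to\mathfrak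 B$ and $\mathrm{Eval}_0,\mathrm{Eval}_1:\mathfrak B\to B$ which have only components of arity one, such that $\mathrm{Eval}_i\circ\mathrm{Incl}=\mathrm{id}$, the energy-zero linear parts of $\mathrm{Incl},\mathrm{Eval}_0,\mathrm{Eval}_1$ are cochain homotopy equivalences, and $\mathrm{Eval}_0\oplus\mathrm{Eval}_1$ is surjective (in energy zero). **Theorem.** For every $2$-pseudo-isotopy $\alpha$, $F[\partial_2\alpha]:(V,Q_0+\delta_0)\to(V,Q_0+\delta_1)$, $F[\partial_0\alpha]:(V,Q_0+\delta_1)\to(V,Q_0+\delta_2)$ and $F[\partial_1\alpha]:(V,Q_0+\delta_0)\to(V,Q_0+\delta_2)$ are $G$-gapped filtered $A_\infty$ homomorphisms, and $F[\partial_1\alpha]$ is homotopic to the composite $F[\partial_0\alpha]\circ F[\partial_2\alpha]$. -/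

import Mathlib

open scoped NNReal ContDiff

universe u

noncomputable section

namespace AInf

/-! ### Families of multilinear maps indexed by arity and energy

All graded spaces are written with their unshifted grading `𝒜 : ℤ → Submodule ℂ A`; an element of
`𝒜 d` has degree `d - 1` in the shifted space `A[1]`. -/

/-- A family `f = (f k β)`, where `f k β : A[1]^k → B[1]` is the coefficient of `T^β`. For `B = A`,
these are the Taylor coefficients of a continuous `Λ_G`-linear coderivation of the tensor coalgebra
of `A[1] ⊗̂ Λ_G`; for general `B`, those of a continuous coalgebra map (with `f 0 0 = 0`).
Since `G` is discrete, no convergence condition on the `f k β` is needed. -/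
abbrev Fam (G : AddSubmonoid ℝ≥0) (A B : Type*) [AddCommGroup A] [Module ℂ A]
    [AddCommGroup B] [Module ℂ B] :=
  (k : ℕ) → G → MultilinearMap ℂ (fun _ : Fin k => A) B

section Graded

variable {A B : Type*} [AddCommGroup A] [Module ℂ A] [AddCommGroup B] [Module ℂ B]

/-- `f : A[1]^k → B[1]` is homogeneous of degree `e` (with respect to the shifted gradings). -/
def HasDegree (𝒜 : ℤ → Submodule ℂ A) (ℬ : ℤ → Submodule ℂ B) (e : ℤ) {k : ℕ}
    (f : MultilinearMap ℂ (fun _ : Fin k => A) B) : Prop :=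
  ∀ (d : Fin k → ℤ) (x : Fin k → A), (∀ a, x a ∈ 𝒜 (d a)) → f x ∈ ℬ (∑ a, (d a - 1) + e + 1)

/-- The Koszul sign operator of `A[1]`: multiplication by `(-1)^(d-1)` on `𝒜 d`. -/
def koszul (𝒜 : ℤ → Submodule ℂ A) [DirectSum.Decomposition 𝒜] : A →ₗ[ℂ] A :=
  (DirectSum.toModule ℂ ℤ A fun d => ((d - 1).negOnePow : ℤ) • (𝒜 d).subtype) ∘ₗ
    (DirectSum.decomposeLinearEquiv 𝒜).toLinearMap

variable {G : AddSubmonoid ℝ≥0}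

/-- `(f ∘ g) (x₁, …, x_N) = ∑ f (id^i ⊗ g ⊗ id^k) (x₁, …, x_N)` in energy `β`, the sum running over
`i + j + k = N` (`j` is the arity of `g`) and `β₁ + β₂ = β`. The operator `s` is applied to the `i`
inputs on the left of `g`: by the Koszul rule, `s` has to be `koszul 𝒜` if `g` has odd degree and
the identity if `g` has even degree. The inputs are the first `N` terms of a sequence `x`. -/
def insertion (s : A →ₗ[ℂ] A) (f : Fam G A B) (g : Fam G A A) (N : ℕ) (β : G) (x : ℕ → A) : B :=
  ∑ p ∈ Finset.HasAntidiagonal.antidiagonal N, ∑ q ∈ Finset.HasAntidiagonal.antidiagonal p.2,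
    ∑ᶠ e : {e : G × G // e.1 + e.2 = β},
      f (p.1 + q.2 + 1) e.1.1 fun a =>
        if (a : ℕ) < p.1 then s (x a)
        else if (a : ℕ) = p.1 then g q.1 e.1.2 fun b => x (p.1 + b)
        else x (a - 1 + q.1)

end Graded

/-- An index of the sum `∑ F_{j,β₀} (E_{i₁,β₁} ⊗ ⋯ ⊗ E_{i_j,β_j})` over `j ≥ 0`,
`i₁ + ⋯ + i_j = N` and `β₀ + β₁ + ⋯ + β_j = β`. -/
structure BlockSplit (G : AddSubmonoid ℝ≥0) (N : ℕ) (β : G) where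
  /-- the number of blocks -/
  j : ℕ
  /-- the sizes of the blocks -/
  size : Fin j → ℕ
  /-- the energy of the outer map -/
  outer : G
  /-- the energies of the inner maps -/
  inner : Fin j → G
  size_sum : ∑ a, size a = N
  energy_sum : outer + ∑ a, inner a = β

section Hom

variable {G : AddSubmonoid ℝ≥0} {A B C : Type*} [AddCommGroup A] [Module ℂ A]
  [AddCommGroup B] [Module ℂ B] [AddCommGroup C] [Module ℂ C]

/-- `(F ∘ E)_{N,β} = ∑ F_{j,β₀} (E_{i₁,β₁} ⊗ ⋯ ⊗ E_{i_j,β_j})`, for `E` of degree zero with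
`E 0 0 = 0` (then the sum is finite if `G` is discrete). -/
def Fam.comp (F : Fam G B C) (E : Fam G A B) : Fam G A C := fun N β =>
  ∑ᶠ d : BlockSplit G N β,
    ((F d.j d.outer).compMultilinearMap fun a => E (d.size a) (d.inner a)).domDomCongr
      (finSigmaFinEquiv.trans (finCongr d.size_sum))

/-- The identity family: the identity in arity one and energy zero, and zero otherwise. -/
def Fam.id (G : AddSubmonoid ℝ≥0) (A : Type*) [AddCommGroup A] [Module ℂ A] : Fam G A A :=
  fun k β => by
    classical
    exact if h : k = 1 ∧ β = 0 then
      (MultilinearMap.ofSubsingleton ℂ A A (0 : Fin 1) LinearMap.id).domDomCongr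
        (finCongr h.1.symm)
    else 0

/-- The linear component of a family in energy zero. -/
def Fam.lin (F : Fam G A B) : A →ₗ[ℂ] B :=
  (MultilinearMap.ofSubsingleton ℂ A B (0 : Fin 1)).symm (F 1 0)

/-- `m` is the family of structure maps of a `G`-gapped filtered `A∞` algebra on `A ⊗̂ Λ_G`. -/
structure IsAInfAlgebra (𝒜 : ℤ → Submodule ℂ A) [DirectSum.Decomposition 𝒜]
    (m : Fam G A A) : Prop where
  degree : ∀ k β, HasDegree 𝒜 𝒜 1 (m k β)
  gapped : m 0 0 = 0
  relation : ∀ (N : ℕ) (β : G) (x : ℕ → A), insertion (koszul 𝒜) m m N β x = 0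

/-- `F` is a `G`-gapped filtered `A∞` homomorphism `(A, mA) → (B, mB)`. -/
structure IsAInfHom (𝒜 : ℤ → Submodule ℂ A) [DirectSum.Decomposition 𝒜] (mA : Fam G A A)
    (ℬ : ℤ → Submodule ℂ B) (mB : Fam G B B) (F : Fam G A B) : Prop where
  degree : ∀ k β, HasDegree 𝒜 ℬ 0 (F k β)
  gapped : F 0 0 = 0
  equation : ∀ (N : ℕ) (β : G) (x : ℕ → A),
    mB.comp F N β (fun a => x a) = insertion (koszul 𝒜) F mA N β x

/-- The linear map `f : (A, dA) → (B, dB)` is a cochain homotopy equivalence. -/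
def IsCochainHomotopyEquiv (𝒜 : ℤ → Submodule ℂ A) (dA : A →ₗ[ℂ] A)
    (ℬ : ℤ → Submodule ℂ B) (dB : B →ₗ[ℂ] B) (f : A →ₗ[ℂ] B) : Prop :=
  (∀ d, ∀ a ∈ 𝒜 d, f a ∈ ℬ d) ∧ f ∘ₗ dA = dB ∘ₗ f ∧
  ∃ (g : B →ₗ[ℂ] A) (K : A →ₗ[ℂ] A) (L : B →ₗ[ℂ] B),
    (∀ d, ∀ b ∈ ℬ d, g b ∈ 𝒜 d) ∧ g ∘ₗ dB = dA ∘ₗ g ∧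
    (∀ d, ∀ a ∈ 𝒜 d, K a ∈ 𝒜 (d - 1)) ∧ (∀ d, ∀ b ∈ ℬ d, L b ∈ ℬ (d - 1)) ∧
    g ∘ₗ f - LinearMap.id = dA ∘ₗ K + K ∘ₗ dA ∧
    f ∘ₗ g - LinearMap.id = dB ∘ₗ L + L ∘ₗ dB

end Hom

/-- A model of `[0,1] × (B, m)` in the sense of Fukaya-Oh-Ohta-Ono, for a `G`-gapped filtered
`A∞` algebra `(B, m)`: a `G`-gapped filtered `A∞` algebra with `A∞` homomorphisms `incl` from
`(B, m)` and `eval₀`, `eval₁` to `(B, m)` which have only components of arity one, such that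
`eval₀ ∘ incl = eval₁ ∘ incl = id`, such that the linear parts in energy zero are cochain homotopy
equivalences, and such that `eval₀ ⊕ eval₁` is surjective. -/
structure IntervalModel {G : AddSubmonoid ℝ≥0} {B : Type u} [AddCommGroup B] [Module ℂ B]
    (ℬ : ℤ → Submodule ℂ B) [DirectSum.Decomposition ℬ] (m : Fam G B B) where
  /-- the underlying vector space in energy zero -/
  carrier : Type u
  [addCommGroup : AddCommGroup carrier]
  [module : Module ℂ carrier]
  /-- the grading -/
  grading : ℤ → Submodule ℂ carrier
  [decomposition : DirectSum.Decomposition grading]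
  /-- the structure maps -/
  op : Fam G carrier carrier
  isAInfAlgebra : IsAInfAlgebra grading op
  /-- the inclusion of constants -/
  incl : Fam G B carrier
  /-- the evaluation at the end point `0` -/
  eval₀ : Fam G carrier B
  /-- the evaluation at the end point `1` -/
  eval₁ : Fam G carrier B
  incl_hom : IsAInfHom ℬ m grading op incl
  eval₀_hom : IsAInfHom grading op ℬ m eval₀
  eval₁_hom : IsAInfHom grading op ℬ m eval₁
  incl_linear : ∀ k, k ≠ 1 → ∀ β, incl k β = 0
  eval₀_linear : ∀ k, k ≠ 1 → ∀ β, eval₀ k β = 0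
  eval₁_linear : ∀ k, k ≠ 1 → ∀ β, eval₁ k β = 0
  eval₀_incl : eval₀.comp incl = Fam.id G B
  eval₁_incl : eval₁.comp incl = Fam.id G B
  incl_equiv : IsCochainHomotopyEquiv ℬ m.lin grading op.lin incl.lin
  eval₀_equiv : IsCochainHomotopyEquiv grading op.lin ℬ m.lin eval₀.lin
  eval₁_equiv : IsCochainHomotopyEquiv grading op.lin ℬ m.lin eval₁.lin
  eval_surjective : ∀ b b' : B, ∃ c : carrier, eval₀.lin c = b ∧ eval₁.lin c = b'

attribute [instance] IntervalModel.addCommGroup IntervalModel.module IntervalModel.decomposition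

/-- `F₀` and `F₁` are homotopic `G`-gapped filtered `A∞` homomorphisms `(A, mA) → (B, mB)`: there
are a model of `[0,1] × (B, mB)` and an `A∞` homomorphism `H` from `(A, mA)` to it such that
`eval₀ ∘ H = F₀` and `eval₁ ∘ H = F₁`. -/
def AreHomotopic {G : AddSubmonoid ℝ≥0} {A B : Type u} [AddCommGroup A] [Module ℂ A]
    [AddCommGroup B] [Module ℂ B]
    (𝒜 : ℤ → Submodule ℂ A) [DirectSum.Decomposition 𝒜] (mA : Fam G A A)
    (ℬ : ℤ → Submodule ℂ B) [DirectSum.Decomposition ℬ] (mB : Fam G B B)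
    (F₀ F₁ : Fam G A B) : Prop :=
  IsAInfHom 𝒜 mA ℬ mB F₀ ∧ IsAInfHom 𝒜 mA ℬ mB F₁ ∧
  ∃ (M : IntervalModel ℬ mB) (H : Fam G A M.carrier),
    IsAInfHom 𝒜 mA M.grading M.op H ∧ M.eval₀.comp H = F₀ ∧ M.eval₁.comp H = F₁

/-! ### The energy zero part -/

/-- `D` is the differential of a differential graded algebra structure on the graded algebra `𝒜`. -/
structure IsDGDifferential {A : Type*} [NonUnitalRing A] [Module ℂ A]
    (𝒜 : ℤ → Submodule ℂ A) (D : A →ₗ[ℂ] A) : Prop where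
  degree : ∀ d, ∀ a ∈ 𝒜 d, D a ∈ 𝒜 (d + 1)
  square : ∀ a, D (D a) = 0
  leibniz : ∀ d, ∀ a ∈ 𝒜 d, ∀ b, D (a * b) = D a * b + (d.negOnePow : ℤ) • (a * D b)

/-- The bilinear map `(a, b) ↦ (-1)^d a b` for `a ∈ 𝒜 d`. -/
def signedMul {A : Type*} [NonUnitalRing A] [Module ℂ A] [IsScalarTower ℂ A A]
    [SMulCommClass ℂ A A] (𝒜 : ℤ → Submodule ℂ A) [DirectSum.Decomposition 𝒜] :
    MultilinearMap ℂ (fun _ : Fin 2 => A) A where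
  toFun x := -(koszul 𝒜 (x 0) * x 1)
  map_update_add' x i a b := by
    fin_cases i <;> simp [add_mul, mul_add] <;> abel
  map_update_smul' x i c a := by
    fin_cases i <;> simp [smul_mul_assoc, mul_smul_comm]

/-- The coderivation `Q₀` of the bar construction of a differential graded algebra: its components
are `D` in arity one and `(a, b) ↦ (-1)^d a b` (`a ∈ 𝒜 d`) in arity two, both in energy zero. -/
def barDifferential (G : AddSubmonoid ℝ≥0) {A : Type*} [NonUnitalRing A] [Module ℂ A]
    [IsScalarTower ℂ A A] [SMulCommClass ℂ A A] (𝒜 : ℤ → Submodule ℂ A)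
    [DirectSum.Decomposition 𝒜] (D : A →ₗ[ℂ] A) : Fam G A A := fun k β => by
  classical
  exact if β = 0 then
      match k with
      | 1 => MultilinearMap.ofSubsingleton ℂ A A (0 : Fin 1) D
      | 2 => signedMul 𝒜
      | _ => 0
    else 0

/-! ### Pseudo-isotopies -/

/-- The standard `2`-simplex in the coordinates `(t₁, t₂)`, with `t₀ = 1 - t₁ - t₂`. -/
def triangle : Set (ℝ × ℝ) := {p | 0 ≤ p.1 ∧ 0 ≤ p.2 ∧ p.1 + p.2 ≤ 1}

/-- The vertices of the triangle. -/
def vertex : Fin 3 → ℝ × ℝ := ![(0, 0), (1, 0), (0, 1)]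

/-- `f : triangle → A` is an element of `C^∞(triangle) ⊗ A`: a finite sum of smooth scalar functions
times vectors. -/
def IsSmooth {A : Type*} [AddCommGroup A] [Module ℂ A] (f : ℝ × ℝ → A) : Prop :=
  ∃ (n : ℕ) (c : Fin n → ℝ × ℝ → ℂ) (w : Fin n → A),
    (∀ i, ContDiffOn ℝ ∞ (c i) triangle) ∧ ∀ p ∈ triangle, f p = ∑ i, c i p • w i

/-- The element `m + h₁ dt₁ + h₂ dt₂ + g dt₁ ∧ dt₂` of `Coder ⊗̂ Ω^*(Δ²)`, as a function of
`(t₁, t₂)` (only its values on the triangle matter). -/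
structure TriangleForm (G : AddSubmonoid ℝ≥0) (A : Type*) [AddCommGroup A] [Module ℂ A] where
  /-- the form degree zero part -/
  m : ℝ × ℝ → Fam G A A
  /-- the coefficient of `dt₁` -/
  h₁ : ℝ × ℝ → Fam G A A
  /-- the coefficient of `dt₂` -/
  h₂ : ℝ × ℝ → Fam G A A
  /-- the coefficient of `dt₁ ∧ dt₂` -/
  g : ℝ × ℝ → Fam G A A

/-- The element `m + h dt` of `Coder ⊗̂ Ω^*(Δ¹)`, as a function of `t ∈ [0,1]`. -/
structure IntervalForm (G : AddSubmonoid ℝ≥0) (A : Type*) [AddCommGroup A] [Module ℂ A] where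
  /-- the form degree zero part -/
  m : ℝ → Fam G A A
  /-- the coefficient of `dt` -/
  h : ℝ → Fam G A A

/-- The pull-back to the face opposite to the vertex `i`, which is parametrised by `t ∈ [0,1]`
preserving the order of the vertices. -/
def TriangleForm.face {G : AddSubmonoid ℝ≥0} {A : Type*} [AddCommGroup A] [Module ℂ A]
    (α : TriangleForm G A) : Fin 3 → IntervalForm G A :=
  ![{ m := fun t => α.m (1 - t, t), h := fun t => α.h₂ (1 - t, t) - α.h₁ (1 - t, t) },
    { m := fun t => α.m (0, t), h := fun t => α.h₂ (0, t) },
    { m := fun t => α.m (t, 0), h := fun t => α.h₁ (t, 0) }]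

/-- `α = m + h₁ dt₁ + h₂ dt₂ + g dt₁ ∧ dt₂` is a `2`-pseudo-isotopy: a positive Maurer-Cartan element
of `Coder ⊗̂ Ω^*(Δ²)`, where `Ω^*(Δ²)` are the smooth complex differential forms that are constant
(functions) near each vertex. With `b = Q₀ + m`, the Maurer-Cartan equation
`dα = [Q₀, α] + (1/2) [α, α]` has the four components

* `b ∘ b = 0`,
* `∂₁ m = - [b, h₁]` and `∂₂ m = - [b, h₂]`,
* `∂₁ h₂ - ∂₂ h₁ = [h₁, h₂] + [b, g]`,

where `[ , ]` is the graded commutator. All derivatives are tested against linear functionals. -/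
structure IsTwoPseudoIsotopy {G : AddSubmonoid ℝ≥0} {A : Type*} [NonUnitalRing A] [Module ℂ A]
    [IsScalarTower ℂ A A] [SMulCommClass ℂ A A] (𝒜 : ℤ → Submodule ℂ A)
    [DirectSum.Decomposition 𝒜] (D : A →ₗ[ℂ] A) (α : TriangleForm G A) : Prop where
  degree_m : ∀ p ∈ triangle, ∀ k β, HasDegree 𝒜 𝒜 1 (α.m p k β)
  degree_h₁ : ∀ p ∈ triangle, ∀ k β, HasDegree 𝒜 𝒜 0 (α.h₁ p k β)
  degree_h₂ : ∀ p ∈ triangle, ∀ k β, HasDegree 𝒜 𝒜 0 (α.h₂ p k β)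
  degree_g : ∀ p ∈ triangle, ∀ k β, HasDegree 𝒜 𝒜 (-1) (α.g p k β)
  positive : ∀ p ∈ triangle, ∀ k,
    α.m p k 0 = 0 ∧ α.h₁ p k 0 = 0 ∧ α.h₂ p k 0 = 0 ∧ α.g p k 0 = 0
  smooth : ∀ k β x, IsSmooth (fun p => α.m p k β x) ∧ IsSmooth (fun p => α.h₁ p k β x) ∧
    IsSmooth (fun p => α.h₂ p k β x) ∧ IsSmooth (fun p => α.g p k β x)
  constant_near_vertices : ∀ k β x, ∀ i : Fin 3, ∀ᶠ p in nhdsWithin (vertex i) triangle,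
    α.m p k β x = α.m (vertex i) k β x ∧ α.h₁ p k β x = 0 ∧ α.h₂ p k β x = 0 ∧ α.g p k β x = 0
  mc_zero : ∀ p ∈ triangle, ∀ (N : ℕ) (β : G) (x : ℕ → A),
    insertion (koszul 𝒜) (barDifferential G 𝒜 D + α.m p) (barDifferential G 𝒜 D + α.m p) N β x = 0
  mc_one : ∀ p ∈ triangle, ∀ (N : ℕ) (β : G) (x : ℕ → A) (l : Module.Dual ℂ A),
    fderivWithin ℝ (fun q => l (α.m q N β fun a => x a)) triangle p (1, 0) =
      -l (insertion LinearMap.id (barDifferential G 𝒜 D + α.m p) (α.h₁ p) N β x -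
        insertion (koszul 𝒜) (α.h₁ p) (barDifferential G 𝒜 D + α.m p) N β x)
  mc_two : ∀ p ∈ triangle, ∀ (N : ℕ) (β : G) (x : ℕ → A) (l : Module.Dual ℂ A),
    fderivWithin ℝ (fun q => l (α.m q N β fun a => x a)) triangle p (0, 1) =
      -l (insertion LinearMap.id (barDifferential G 𝒜 D + α.m p) (α.h₂ p) N β x -
        insertion (koszul 𝒜) (α.h₂ p) (barDifferential G 𝒜 D + α.m p) N β x)
  mc_one_two : ∀ p ∈ triangle, ∀ (N : ℕ) (β : G) (x : ℕ → A) (l : Module.Dual ℂ A),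
    fderivWithin ℝ (fun q => l (α.h₂ q N β fun a => x a)) triangle p (1, 0) -
      fderivWithin ℝ (fun q => l (α.h₁ q N β fun a => x a)) triangle p (0, 1) =
      l ((insertion LinearMap.id (α.h₁ p) (α.h₂ p) N β x -
          insertion LinearMap.id (α.h₂ p) (α.h₁ p) N β x) +
        (insertion (koszul 𝒜) (barDifferential G 𝒜 D + α.m p) (α.g p) N β x +
          insertion (koszul 𝒜) (α.g p) (barDifferential G 𝒜 D + α.m p) N β x))

/-! ### Decorated trees and the homomorphism of a pseudo-isotopy -/

/-- Rooted ribbon trees whose interior vertices are decorated by elements of `Γ`. The tree `leaf`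
has one leaf, joined to the root, and no interior vertex; in `node n β c` the root is joined to an
interior vertex of valency `n + 1` with decoration `β`, which carries the trees `c 0, …, c (n-1)`. -/
inductive DecTree (Γ : Type) : Type
  | leaf : DecTree Γ
  | node (n : ℕ) (β : Γ) (c : Fin n → DecTree Γ) : DecTree Γ

namespace DecTree

variable {Γ : Type}

/-- The number of leaves. -/
def leaves : DecTree Γ → ℕ
  | leaf => 1
  | node _ _ c => ∑ i, (c i).leaves

/-- The sum of all decorations. -/
def energy [AddCommMonoid Γ] : DecTree Γ → Γ
  | leaf => 0
  | node _ β c => β + ∑ i, (c i).energy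

/-- Every interior vertex decorated by `0` has valency at least three. -/
def Stable [AddCommMonoid Γ] : DecTree Γ → Prop
  | leaf => True
  | node n β c => (β = 0 → 3 ≤ n + 1) ∧ ∀ i, (c i).Stable

/-- The interior vertices. -/
def Vert : DecTree Γ → Type
  | leaf => Empty
  | node _ _ c => Option (Σ i, (c i).Vert)

instance fintypeVert : (T : DecTree Γ) → Fintype T.Vert
  | leaf => inferInstanceAs (Fintype Empty)
  | node n _ c =>
    haveI : ∀ i, Fintype (c i).Vert := fun i => fintypeVert (c i)
    inferInstanceAs (Fintype (Option (Σ i : Fin n, (c i).Vert)))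

/-- `v ≤ w` if `w` lies on the shortest path from `v` to the root. -/
def le : (T : DecTree Γ) → T.Vert → T.Vert → Prop
  | leaf => fun _ _ => True
  | node _ _ c => fun v w =>
    match v, w with
    | _, none => True
    | none, some _ => False
    | some ⟨i, v⟩, some ⟨j, w⟩ => ∃ h : i = j, le (c j) (h ▸ v) w

/-- The time orderings bounded by `t`: the non-decreasing maps to `[0, t]`. -/
def timeOrderings (T : DecTree Γ) (t : ℝ) : Set (T.Vert → ℝ) :=
  {τ | (∀ v, τ v ∈ Set.Icc 0 t) ∧ ∀ v w, T.le v w → τ v ≤ τ w}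

/-- The operadic composition along the tree, with the map `h^{τ(v)}_{val(v)-1, λ(v)}` at the
interior vertex `v`. -/
def operadic {G : AddSubmonoid ℝ≥0} {A : Type*} [AddCommGroup A] [Module ℂ A]
    (h : ℝ → Fam G A A) : (T : DecTree G) → (T.Vert → ℝ) →
      MultilinearMap ℂ (fun _ : Fin T.leaves => A) A
  | leaf => fun _ => MultilinearMap.ofSubsingleton ℂ A A (0 : Fin 1) LinearMap.id
  | node n β c => fun τ =>
    ((h (τ none) n β).compMultilinearMap fun i =>
      operadic h (c i) fun v => τ (some ⟨i, v⟩)).domDomCongr finSigmaFinEquiv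

end DecTree

open MeasureTheory in
/-- The integral of a family of multilinear maps with values in a vector space: the (unique)
multilinear map whose values are given by integration after applying a linear functional. -/
def integralMultilinear {X : Type*} [MeasurableSpace X] (μ : Measure X) {k : ℕ} {A : Type*}
    [AddCommGroup A] [Module ℂ A] (f : X → MultilinearMap ℂ (fun _ : Fin k => A) A) :
    MultilinearMap ℂ (fun _ : Fin k => A) A := by
  classical
  exact if H : ∃ I : MultilinearMap ℂ (fun _ : Fin k => A) A,
      ∀ (x : Fin k → A) (l : Module.Dual ℂ A),
        Integrable (fun τ => l (f τ x)) μ ∧ ∫ τ, l (f τ x) ∂μ = l (I x)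
    then H.choose else 0

open MeasureTheory in
/-- The homomorphism `F[γ]` of `γ = m + h dt`: its component of arity `k` and energy `β` is the sum
over the stable decorated trees with `k` leaves and total energy `β` of the integrals of the operadic
compositions over the space of time orderings bounded by `1`. -/
def IntervalForm.hom {G : AddSubmonoid ℝ≥0} {A : Type*} [AddCommGroup A] [Module ℂ A]
    (γ : IntervalForm G A) : Fam G A A := fun k β =>
  ∑ᶠ T : {T : DecTree G // T.Stable ∧ T.leaves = k ∧ T.energy = β},
    (integralMultilinear (volume.restrict (T.1.timeOrderings 1))
      (DecTree.operadic γ.h T.1)).domDomCongr (finCongr T.2.2.1)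

end AInf

end

/-! A pseudo-isotopy is a flat connection, and F is its parallel transport. In the bar coalgebra
`Bar G A`, spanned by words carrying an energy, families become coderivations and A∞ homomorphisms
become coalgebra maps that commute with the differentials. If ∂b = [u, b] along a path, the flow ∂Q
= uQ with Q = id at time 0 consists of coalgebra maps and intertwines the differentials at the two
ends, because in each case both sides of the identity solve the same linear equation
(`IsFlow.comul_eq`, `IsFlow.coder_comp`). Since u has no component of energy zero, it strictly
lowers a filtration by energy; hence Picard iteration stops and no convergence is needed
(`Lowers.exists_flow`, `Lowers.eq_zero`). The part of length one of the flow at time one is F: in a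
time-ordered tree the root vertex carries the latest time, so differentiating the sum of the tree
integrals in the upper time bound gives back the flow equation (`eq_sum_posTrees`).

For the homotopy, the triangle is swept out by the segments from the points of the edge 01 to the
vertex 2 (`squareMap`); the extreme segments are the faces opposite to 1 and 0. Let Q(1, s) be the
transport along the segment with parameter s and R(s) the transport along the edge from the vertex 0
to its starting point. Then W(s) = Q(1, s) R(s) joins F[∂₁α] to F[∂₀α] ∘ F[∂₂α]. The Maurer–Cartan
equation in form degree two yields ∂ₛQ = vQ − Qv₀ + bK + Kb₀, where K is driven by the coefficient
of the two-form (`IsSecondFlow.deriv_snd`). At the vertex 2 the velocity v vanishes, and the term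
with v₀ cancels against the derivative of R. What remains is ∂ₛW = bL + Lb with L = KR, a
coderivation along W (`IsTwoPseudoIsotopy.isCoalgHomotopy`).

Such a pair is the same as one A∞ homomorphism W + L ds into the A-valued smooth forms on the
interval. These forms are a model of [0,1] × A (`intervalModel`), and evaluation at the end points
returns W(0) and W(1) (`IsCoalgHomotopy.areHomotopic`).

Two devices are used throughout. Calculus in a vector space without topology is done with functions
that are finite sums of smooth scalars times vectors (`Sm`), derivatives being tested against
functionals (`HasD`). Degrees and Koszul signs are encoded by the operators `scale 𝒜 a`, with
`koszul 𝒜 = scale 𝒜 (-1)`, so that homogeneity becomes a commutation relation. -/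

open scoped NNReal ContDiff TensorProduct

noncomputable section

namespace AInf

open Finset hiding antidiagonal mem_antidiagonal

open Finset.HasAntidiagonal

/-! ### The tensor coalgebra with energies -/

section Bar

/-- The vector space spanned by the words `(x₁, …, x_n; β)`, multilinear in the letters. -/
def Bar (G : AddSubmonoid ℝ≥0) (A : Type*) [AddCommGroup A] [Module ℂ A] : Type _ :=
  G →₀ TensorAlgebra ℂ A

variable {G : AddSubmonoid ℝ≥0} {A B : Type*} [AddCommGroup A] [Module ℂ A]
  [AddCommGroup B] [Module ℂ B] {E : Type*} [AddCommGroup E] [Module ℂ E]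

instance : AddCommGroup (Bar G A) := inferInstanceAs (AddCommGroup (G →₀ TensorAlgebra ℂ A))

instance : Module ℂ (Bar G A) := inferInstanceAs (Module ℂ (G →₀ TensorAlgebra ℂ A))

namespace Bar

/-- The words of energy `β`. -/
def mk (β : G) : TensorAlgebra ℂ A →ₗ[ℂ] Bar G A :=
  (Finsupp.lsingle β : TensorAlgebra ℂ A →ₗ[ℂ] G →₀ TensorAlgebra ℂ A)

/-- The empty word of energy `β`. -/
def e (β : G) : Bar G A := mk β 1

/-- Left multiplication in each energy. -/
def mulLeftFinsupp : A →ₗ[ℂ] (G →₀ TensorAlgebra ℂ A) →ₗ[ℂ] (G →₀ TensorAlgebra ℂ A) :=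
  LinearMap.mk₂ ℂ
    (fun x c => Finsupp.mapRange.linearMap (LinearMap.mulLeft ℂ (TensorAlgebra.ι ℂ x)) c)
    (fun x y c => by ext; simp [add_mul])
    (fun a x c => by ext; simp)
    (fun x c d => map_add _ c d)
    (fun a x c => by simp)

/-- Adding a letter on the left. -/
def cons : A →ₗ[ℂ] Bar G A →ₗ[ℂ] Bar G A := mulLeftFinsupp

theorem cons_mk (x : A) (β : G) (t : TensorAlgebra ℂ A) :
    cons x (mk β t) = mk β (TensorAlgebra.ι ℂ x * t) := by
  change mulLeftFinsupp x (Finsupp.single β t) = Finsupp.single β _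
  simp [mulLeftFinsupp]

/-- The linear map determined by its values on empty words and its behaviour under `cons`. -/
def fold (base : G → E) (step : A →ₗ[ℂ] Module.End ℂ E) : Bar G A →ₗ[ℂ] E :=
  (Finsupp.lsum ℂ fun β =>
    (LinearMap.applyₗ (base β)).comp (TensorAlgebra.lift ℂ step).toLinearMap :
    (G →₀ TensorAlgebra ℂ A) →ₗ[ℂ] E)

theorem fold_mk (base : G → E) (step : A →ₗ[ℂ] Module.End ℂ E) (β : G)
    (t : TensorAlgebra ℂ A) : fold base step (mk β t) = TensorAlgebra.lift ℂ step t (base β) := by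
  change (Finsupp.lsum ℂ _ : (G →₀ TensorAlgebra ℂ A) →ₗ[ℂ] E) (Finsupp.single β t) = _
  rw [Finsupp.lsum_single]; rfl

@[simp]
theorem fold_e (base : G → E) (step : A →ₗ[ℂ] Module.End ℂ E) (β : G) :
    fold base step (e β) = base β := by
  rw [e, fold_mk]; simp

theorem induction_mk {P : Bar G A → Prop} (zero : P 0) (add : ∀ c d, P c → P d → P (c + d))
    (mk : ∀ β t, P (mk β t)) (c : Bar G A) : P c :=
  Finsupp.induction_linear (motive := P) c zero add mk

@[simp]
theorem fold_cons (base : G → E) (step : A →ₗ[ℂ] Module.End ℂ E) (x : A) (c : Bar G A) :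
    fold base step (cons x c) = step x (fold base step c) := by
  induction c using induction_mk with
  | zero => simp
  | add c d hc hd => simp only [map_add, hc, hd]
  | mk β t => rw [cons_mk, fold_mk, fold_mk]; simp

theorem induction {P : Bar G A → Prop} (zero : P 0) (add : ∀ c d, P c → P d → P (c + d))
    (smul : ∀ (a : ℂ) c, P c → P (a • c)) (empty : ∀ β, P (e β))
    (cons : ∀ x c, P c → P (cons x c)) (c : Bar G A) : P c := by
  let N : Submodule ℂ (Bar G A) :=
    { carrier := {c | P c}, zero_mem' := zero, add_mem' := fun hc hd => add _ _ hc hd,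
      smul_mem' := fun a _ hc => smul a _ hc }
  induction c using induction_mk with
  | zero => exact zero
  | add c d hc hd => exact add c d hc hd
  | mk β t =>
    -- The claim is stated for left multiplication by an arbitrary tensor, so that a product can be
    -- absorbed one factor at a time; `t = 1` gives the result.
    have key : ∀ s : TensorAlgebra ℂ A, ∀ t : TensorAlgebra ℂ A,
        P (mk β t) →
        P (mk β (s * t)) := by
      intro s
      induction s using TensorAlgebra.induction with
      | algebraMap r =>
        intro t ht
        have := smul r _ ht
        rwa [← Algebra.smul_def, map_smul]
      | ι x =>
        intro t ht
        have := cons x _ ht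
        rwa [cons_mk] at this
      | mul s s' hs hs' => intro t ht; rw [mul_assoc]; exact hs _ (hs' _ ht)
      | add s s' hs hs' =>
        intro t ht
        have := add _ _ (hs _ ht) (hs' _ ht)
        rwa [add_mul, map_add]
    simpa using key t 1 (empty β)

theorem hom_ext {f g : Bar G A →ₗ[ℂ] E} (empty : ∀ β, f (e β) = g (e β))
    (cons : ∀ x c, f c = g c → f (cons x c) = g (cons x c)) : f = g := by
  ext c
  induction c using induction with
  | zero => simp
  | add c d hc hd => simp [hc, hd]
  | smul a c hc => simp [hc]
  | empty β => exact empty β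
  | cons x c hc => exact cons x c hc

/-- The linear map determined by recursion on words, where the recursion step may use the rest of
the word. -/
def para (base : G → E) (step : A →ₗ[ℂ] Bar G A × E →ₗ[ℂ] E) : Bar G A →ₗ[ℂ] E :=
  LinearMap.snd ℂ (Bar G A) E ∘ₗ
    fold (fun β => (e β, base β))
      (LinearMap.mk₂ ℂ (fun x (p : Bar G A × E) => (cons x p.1, step x p))
        (by intros; simp) (by intros; simp) (by intros; simp) (by intros; simp))

variable (base : G → E) (step : A →ₗ[ℂ] Bar G A × E →ₗ[ℂ] E)

@[simp]
theorem para_e (β : G) : para base step (e β) = base β := by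
  simp [para]

@[simp]
theorem para_cons (x : A) (c : Bar G A) :
    para base step (cons x c) = step x (c, para base step c) := by
  -- The first component of the fold rebuilds the word that has been read.
  have key : LinearMap.fst ℂ (Bar G A) E ∘ₗ
    fold (fun β => (e β, base β))
      (LinearMap.mk₂ ℂ (fun x (p : Bar G A × E) => (cons x p.1, step x p))
        (by intros; simp) (by intros; simp) (by intros; simp) (by intros; simp)) =
      LinearMap.id := by
    apply hom_ext
    · intro β; simp
    · intro x c h
      simp only [LinearMap.comp_apply, LinearMap.fst_apply, LinearMap.id_apply] at h
      simp [h]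
  have key2 := LinearMap.congr_fun key c
  simp only [LinearMap.comp_apply, LinearMap.fst_apply, LinearMap.id_apply] at key2
  simp only [para, LinearMap.comp_apply, fold_cons, LinearMap.mk₂_apply, LinearMap.snd_apply]
  congr 1
  exact Prod.ext key2 rfl

/-- The part of word length zero. -/
def scalar : Bar G A →ₗ[ℂ] (G →₀ ℂ) := fold (fun β => Finsupp.single β 1) 0

@[simp]
theorem scalar_e (β : G) : scalar (e β : Bar G A) = Finsupp.single β 1 := fold_e _ _ _

@[simp]
theorem scalar_cons (x : A) (c : Bar G A) : scalar (cons x c) = 0 := by simp [scalar]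

/-- The part of word length one in energy zero. -/
def proj : Bar G A →ₗ[ℂ] A :=
  para 0 (LinearMap.mk₂ ℂ (fun x p => (scalar p.1 0 : ℂ) • x)
    (by intros; simp) (fun a x p => smul_comm _ _ _) (by intros; simp [add_smul])
    (by intros; simp [mul_smul]))

@[simp]
theorem proj_e (β : G) : proj (e β : Bar G A) = 0 := by simp [proj]

@[simp]
theorem proj_cons (x : A) (c : Bar G A) : proj (cons x c) = (scalar c 0 : ℂ) • x := by simp [proj]

open LinearMap in
theorem assoc_rTensor_lTensor (f : Bar G A →ₗ[ℂ] Bar G A ⊗[ℂ] Bar G A)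
    (g : Bar G A →ₗ[ℂ] Bar G A) (z : Bar G A ⊗[ℂ] Bar G A) :
    TensorProduct.assoc ℂ _ _ _ (f.rTensor (Bar G A) (g.lTensor (Bar G A) z)) =
      (g.lTensor (Bar G A)).lTensor (Bar G A)
        (TensorProduct.assoc ℂ _ _ _ (f.rTensor (Bar G A) z)) := by
  induction z with
  | zero => simp
  | add z w hz hw => simp only [map_add, hz, hw]
  | tmul c d =>
    simp only [lTensor_tmul, rTensor_tmul]
    generalize f c = y
    induction y with
    | zero => simp
    | add z w hz hw => simp only [TensorProduct.add_tmul, map_add, hz, hw]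
    | tmul c d => simp

open LinearMap in
theorem assoc_rTensor_cons (x : A) (z : (Bar G A ⊗[ℂ] Bar G A) ⊗[ℂ] Bar G A) :
    TensorProduct.assoc ℂ _ _ _ (((cons x).rTensor (Bar G A)).rTensor (Bar G A) z) =
      (cons x).rTensor (Bar G A ⊗[ℂ] Bar G A) (TensorProduct.assoc ℂ _ _ _ z) := by
  induction z with
  | zero => simp
  | add z w hz hw => simp only [map_add, hz, hw]
  | tmul y d =>
    induction y with
    | zero => simp
    | add z w hz hw => simp only [TensorProduct.add_tmul, map_add, hz, hw]
    | tmul c d => simp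

/-- The coaction `(w; β) ↦ ∑ (∅; β₁) ⊗ (w; β₂)` of the energies. -/
def coact [HasAntidiagonal G] : Bar G A →ₗ[ℂ] Bar G A ⊗[ℂ] Bar G A :=
  fold (fun β => ∑ q ∈ antidiagonal β, e q.1 ⊗ₜ[ℂ] e q.2)
    (LinearMap.mk₂ ℂ (fun x z => (cons x).lTensor (Bar G A) z)
      (by intros; simp [LinearMap.lTensor_add]) (by intros; simp [LinearMap.lTensor_smul])
      (by intros; simp) (by intros; simp))

variable [HasAntidiagonal G]

@[simp]
theorem coact_e (β : G) :
    coact (e β : Bar G A) = ∑ q ∈ antidiagonal β, e q.1 ⊗ₜ[ℂ] e q.2 := by simp [coact]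

@[simp]
theorem coact_cons (x : A) (c : Bar G A) :
    coact (cons x c) = (cons x).lTensor (Bar G A) (coact c) := by simp [coact]

/-- The deconcatenation coproduct. -/
def comul : Bar G A →ₗ[ℂ] Bar G A ⊗[ℂ] Bar G A :=
  para (fun β => coact (e β))
    (LinearMap.mk₂ ℂ (fun x p => coact (cons x p.1) + (cons x).rTensor (Bar G A) p.2)
      (by intros; simp [LinearMap.rTensor_add]; abel)
      (by intros; simp [LinearMap.rTensor_smul])
      (by intros; simp; abel) (by intros; simp))

@[simp]
theorem comul_e (β : G) : comul (e β : Bar G A) = coact (e β) := by simp only [comul, para_e]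

@[simp]
theorem comul_cons (x : A) (c : Bar G A) :
    comul (cons x c) = coact (cons x c) + (cons x).rTensor (Bar G A) (comul c) := by
  simp only [comul, para_cons, LinearMap.mk₂_apply]

/-- Both sides run over the decompositions of `β` into three energies; this is the coassociativity
of the energies. -/
theorem sum_antidiagonal_assoc {M : Type*} [AddCommMonoid M] (β : G) (f : G → G → G → M) :
    ∑ q ∈ antidiagonal β, ∑ r ∈ antidiagonal q.1, f r.1 r.2 q.2 =
      ∑ q ∈ antidiagonal β, ∑ r ∈ antidiagonal q.2, f q.1 r.1 r.2 := by
  rw [sum_sigma', sum_sigma']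
  refine sum_bij' (fun a _ => ⟨(a.2.1, a.2.2 + a.1.2), (a.2.2, a.1.2)⟩)
    (fun a _ => ⟨(a.1.1 + a.2.1, a.2.2), (a.1.1, a.2.1)⟩) ?_ ?_ ?_ ?_ ?_
  · rintro ⟨⟨a, b⟩, ⟨c, d⟩⟩ h
    simp only [mem_sigma, mem_antidiagonal] at h ⊢
    exact ⟨by rw [← add_assoc, h.2, h.1], trivial⟩
  · rintro ⟨⟨a, b⟩, ⟨c, d⟩⟩ h
    simp only [mem_sigma, mem_antidiagonal] at h ⊢
    exact ⟨by rw [add_assoc, h.2, h.1], trivial⟩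
  · rintro ⟨⟨a, b⟩, ⟨c, d⟩⟩ h
    simp only [mem_sigma, mem_antidiagonal] at h
    simp [h.2]
  · rintro ⟨⟨a, b⟩, ⟨c, d⟩⟩ h
    simp only [mem_sigma, mem_antidiagonal] at h
    simp [h.2]
  · rintro ⟨⟨a, b⟩, ⟨c, d⟩⟩ h
    rfl

open LinearMap in
theorem assoc_rTensor_coact_cons (x : A) (z : Bar G A ⊗[ℂ] Bar G A) :
    TensorProduct.assoc ℂ _ _ _ (coact.rTensor (Bar G A) ((cons x).rTensor (Bar G A) z)) =
      ((cons x).rTensor (Bar G A)).lTensor (Bar G A)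
        (TensorProduct.assoc ℂ _ _ _ (coact.rTensor (Bar G A) z)) := by
  induction z with
  | zero => simp
  | add z w hz hw => simp only [map_add, hz, hw]
  | tmul c d =>
    simp only [rTensor_tmul, coact_cons]
    generalize coact c = y
    induction y with
    | zero => simp
    | add z w hz hw => simp only [TensorProduct.add_tmul, map_add, hz, hw]
    | tmul c d => simp

theorem coact_coact (c : Bar G A) :
    TensorProduct.assoc ℂ _ _ _ (coact.rTensor (Bar G A) (coact c)) =
      coact.lTensor (Bar G A) (coact c) := by
  induction c using induction with
  | zero => simp
  | add c d hc hd => simp only [map_add, hc, hd]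
  | smul a c hc => simp only [map_smul, hc]
  | empty β =>
    simp only [coact_e, map_sum, LinearMap.rTensor_tmul, LinearMap.lTensor_tmul,
      TensorProduct.sum_tmul, TensorProduct.tmul_sum, TensorProduct.assoc_tmul]
    exact sum_antidiagonal_assoc β fun a b d => e a ⊗ₜ[ℂ] (e b ⊗ₜ[ℂ] e d)
  | cons x c hc =>
    rw [coact_cons, assoc_rTensor_lTensor, hc]
    generalize coact c = z
    induction z with
    | zero => simp
    | add z w hz hw => simp only [map_add, hz, hw]
    | tmul c d => simp

/-- The left factors of `coact` are empty words, and on these `comul` agrees with `coact`. -/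
theorem comul_coact (c : Bar G A) :
    TensorProduct.assoc ℂ _ _ _ (comul.rTensor (Bar G A) (coact c)) =
      coact.lTensor (Bar G A) (coact c) := by
  rw [← coact_coact]
  congr 1
  induction c using induction with
  | zero => simp
  | add c d hc hd => simp only [map_add, hc, hd]
  | smul a c hc => simp only [map_smul, hc]
  | empty β => simp
  | cons x c hc =>
    apply (TensorProduct.assoc ℂ _ _ _).injective
    rw [coact_cons, assoc_rTensor_lTensor, hc, assoc_rTensor_lTensor]

theorem coact_comul (c : Bar G A) :
    TensorProduct.assoc ℂ _ _ _ (coact.rTensor (Bar G A) (comul c)) =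
      comul.lTensor (Bar G A) (coact c) := by
  induction c using induction with
  | zero => simp
  | add c d hc hd => simp only [map_add, hc, hd]
  | smul a c hc => simp only [map_smul, hc]
  | empty β => rw [comul_e, coact_coact]; simp
  | cons x c hc =>
    rw [comul_cons, map_add, map_add, coact_coact, assoc_rTensor_coact_cons, hc, coact_cons]
    generalize coact c = z
    induction z with
    | zero => simp
    | add z w hz hw => simp only [map_add, ← hz, ← hw]; abel
    | tmul c d => simp [TensorProduct.tmul_add]

/-- Coassociativity. The terms are sorted by the factor that contains the first letter: the third
(`comul_coact`), the second (`coact_comul`) or the first (induction). -/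
theorem comul_comul (c : Bar G A) :
    TensorProduct.assoc ℂ _ _ _ (comul.rTensor (Bar G A) (comul c)) =
      comul.lTensor (Bar G A) (comul c) := by
  induction c using induction with
  | zero => simp
  | add c d hc hd => simp only [map_add, hc, hd]
  | smul a c hc => simp only [map_smul, hc]
  | empty β => rw [comul_e, comul_coact]; simp
  | cons x c hc =>
    have h : ∀ z : Bar G A ⊗[ℂ] Bar G A, comul.rTensor (Bar G A) ((cons x).rTensor (Bar G A) z) =
        coact.rTensor (Bar G A) ((cons x).rTensor (Bar G A) z) +
        ((cons x).rTensor (Bar G A)).rTensor (Bar G A) (comul.rTensor (Bar G A) z) := by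
      intro z
      induction z with
      | zero => simp
      | add z w hz hw => simp only [map_add, hz, hw]; abel
      | tmul c d => simp [TensorProduct.add_tmul]
    have h' : ∀ z : Bar G A ⊗[ℂ] Bar G A, comul.lTensor (Bar G A) ((cons x).rTensor (Bar G A) z) =
        (cons x).rTensor (Bar G A ⊗[ℂ] Bar G A) (comul.lTensor (Bar G A) z) := by
      intro z
      induction z with
      | zero => simp
      | add z w hz hw => simp only [map_add, hz, hw]
      | tmul c d => simp
    rw [comul_cons, map_add, map_add, comul_coact, h, map_add, assoc_rTensor_cons, hc, map_add, h',
      ← add_assoc, assoc_rTensor_coact_cons, coact_comul, coact_cons]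
    congr 1
    generalize coact c = z
    induction z with
    | zero => simp
    | add z w hz hw => simp only [map_add, ← hz, ← hw]; abel
    | tmul c d => simp [TensorProduct.tmul_add]

end Bar
end Bar

/-! ### Functoriality of the bar coalgebra and the coderivation extending a map -/

section Coderivations

variable {G : AddSubmonoid ℝ≥0} {A B : Type*} [AddCommGroup A] [Module ℂ A]
  [AddCommGroup B] [Module ℂ B] {E : Type*} [AddCommGroup E] [Module ℂ E]

namespace Bar

/-- The map of words induced by a linear map of letters. -/
def map (φ : A →ₗ[ℂ] B) : Bar G A →ₗ[ℂ] Bar G B := fold e (cons ∘ₗ φ)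

@[simp]
theorem map_e (φ : A →ₗ[ℂ] B) (β : G) : map φ (e β) = e β := fold_e _ _ _

@[simp]
theorem map_cons (φ : A →ₗ[ℂ] B) (x : A) (c : Bar G A) :
    map φ (cons x c) = cons (φ x) (map φ c) := fold_cons _ _ _ _

theorem map_id : map (G := G) (LinearMap.id : A →ₗ[ℂ] A) = LinearMap.id :=
  hom_ext (by simp) (by intro x c h; simp_all)

theorem map_comp {C : Type*} [AddCommGroup C] [Module ℂ C] (φ : B →ₗ[ℂ] C) (ψ : A →ₗ[ℂ] B) :
    map (G := G) (φ ∘ₗ ψ) = map φ ∘ₗ map ψ :=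
  hom_ext (by simp) (by intro x c h; simp_all)

theorem scalar_map (φ : A →ₗ[ℂ] B) : scalar (G := G) ∘ₗ map φ = scalar :=
  hom_ext (by simp) (by intro x c h; simp_all)

theorem proj_map (φ : A →ₗ[ℂ] B) : proj (G := G) ∘ₗ map φ = φ ∘ₗ proj :=
  hom_ext (by simp) (by
    intro x c h
    have := LinearMap.congr_fun (scalar_map (G := G) φ) c
    simp only [LinearMap.comp_apply] at this
    simp [this])

variable [HasAntidiagonal G]

/-- Only values on empty words matter, since these are the only left factors in `coact c`. -/
theorem map_coact_left {E' : Type*} [AddCommGroup E'] [Module ℂ E'] {f g : Bar G A →ₗ[ℂ] E}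
    (h : ∀ β, f (e β) = g (e β)) (k : Bar G A →ₗ[ℂ] E') (c : Bar G A) :
    TensorProduct.map f k (coact c) = TensorProduct.map g k (coact c) := by
  have : f.rTensor (Bar G A) (coact c) = g.rTensor (Bar G A) (coact c) := by
    induction c using induction with
    | zero => simp
    | add c d hc hd => simp only [_root_.map_add, hc, hd]
    | smul a c hc => simp only [_root_.map_smul, hc]
    | empty β => simp [h]
    | cons x c hc =>
      rw [coact_cons, ← LinearMap.comp_apply, LinearMap.rTensor_comp_lTensor,
        ← LinearMap.lTensor_comp_rTensor, LinearMap.comp_apply, hc, ← LinearMap.comp_apply,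
        LinearMap.lTensor_comp_rTensor, ← LinearMap.rTensor_comp_lTensor, LinearMap.comp_apply]
  rw [← LinearMap.lTensor_comp_rTensor, LinearMap.comp_apply, this,
    ← LinearMap.comp_apply, LinearMap.lTensor_comp_rTensor]

theorem coact_map (φ : A →ₗ[ℂ] B) (c : Bar G A) :
    coact (map φ c) = TensorProduct.map (map φ) (map φ) (coact c) := by
  induction c using induction with
  | zero => simp
  | add c d hc hd => simp only [_root_.map_add, hc, hd]
  | smul a c hc => simp only [_root_.map_smul, hc]
  | empty β => simp
  | cons x c hc =>
    rw [map_cons, coact_cons, hc, coact_cons]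
    generalize coact c = z
    induction z with
    | zero => simp
    | add z w hz hw => simp only [_root_.map_add, hz, hw]
    | tmul c d => simp

theorem comul_map (φ : A →ₗ[ℂ] B) (c : Bar G A) :
    comul (map φ c) = TensorProduct.map (map φ) (map φ) (comul c) := by
  induction c using induction with
  | zero => simp
  | add c d hc hd => simp only [_root_.map_add, hc, hd]
  | smul a c hc => simp only [_root_.map_smul, hc]
  | empty β => simp
  | cons x c hc =>
    rw [map_cons, comul_cons, hc, comul_cons, ← map_cons, coact_map, _root_.map_add]
    congr 1
    generalize comul c = z
    induction z with
    | zero => simp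
    | add z w hz hw => simp only [_root_.map_add, hz, hw]
    | tmul c d => simp

theorem sum_antidiagonal_comm {M : Type*} [AddCommMonoid M] (β : G) (f : G → G → G → M) :
    ∑ q ∈ antidiagonal β, ∑ r ∈ antidiagonal q.2, f q.1 r.1 r.2 =
      ∑ q ∈ antidiagonal β, ∑ r ∈ antidiagonal q.2, f r.1 q.1 r.2 := by
  rw [← sum_antidiagonal_assoc, ← sum_antidiagonal_assoc β fun a b c => f b a c]
  refine sum_congr rfl fun q _ => ?_
  refine sum_bij' (fun a _ => a.swap) (fun a _ => a.swap) ?_ ?_ ?_ ?_ ?_ <;>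
    simp +contextual [add_comm]

theorem leftComm_coact_coact (c : Bar G A) :
    TensorProduct.leftComm ℂ _ _ _ (coact.lTensor (Bar G A) (coact c)) =
      coact.lTensor (Bar G A) (coact c) := by
  induction c using induction with
  | zero => simp
  | add c d hc hd => simp only [_root_.map_add, hc, hd]
  | smul a c hc => simp only [_root_.map_smul, hc]
  | empty β =>
    simp only [coact_e, map_sum, LinearMap.lTensor_tmul, TensorProduct.tmul_sum,
      TensorProduct.leftComm_tmul]
    exact (sum_antidiagonal_comm β fun a b d => e a ⊗ₜ[ℂ] (e b ⊗ₜ[ℂ] e d)).symm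
  | cons x c hc =>
    have h1 : ∀ z : Bar G A ⊗[ℂ] Bar G A,
        coact.lTensor (Bar G A) ((cons x).lTensor (Bar G A) z) =
          ((cons x).lTensor (Bar G A)).lTensor (Bar G A) (coact.lTensor (Bar G A) z) := by
      intro z
      induction z with
      | zero => simp
      | add z w hz hw => simp only [_root_.map_add, hz, hw]
      | tmul c d => simp
    have h2 : ∀ z : Bar G A ⊗[ℂ] (Bar G A ⊗[ℂ] Bar G A),
        TensorProduct.leftComm ℂ _ _ _ (((cons x).lTensor (Bar G A)).lTensor (Bar G A) z) =
          ((cons x).lTensor (Bar G A)).lTensor (Bar G A) (TensorProduct.leftComm ℂ _ _ _ z) := by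
      intro z
      induction z with
      | zero => simp
      | add z w hz hw => simp only [_root_.map_add, hz, hw]
      | tmul c y =>
        induction y with
        | zero => simp
        | add z w hz hw => simp only [TensorProduct.tmul_add, _root_.map_add, hz, hw]
        | tmul d d' => simp
    rw [coact_cons, h1, h2, hc]

/-- The energies form a cocommutative coalgebra, so energy can be split off before or after a word
is cut. This is what moves an empty word past the letter produced by `head`. -/
theorem leftComm_coact_comul (c : Bar G A) :
    TensorProduct.leftComm ℂ _ _ _ (coact.lTensor (Bar G A) (comul c)) =
      comul.lTensor (Bar G A) (coact c) := by
  induction c using induction with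
  | zero => simp
  | add c d hc hd => simp only [_root_.map_add, hc, hd]
  | smul a c hc => simp only [_root_.map_smul, hc]
  | empty β => rw [comul_e, leftComm_coact_coact]; simp
  | cons x c hc =>
    have h : ∀ z : Bar G A ⊗[ℂ] Bar G A, TensorProduct.leftComm ℂ _ _ _
        (coact.lTensor (Bar G A) ((cons x).rTensor (Bar G A) z)) =
          ((cons x).rTensor (Bar G A)).lTensor (Bar G A)
            (TensorProduct.leftComm ℂ _ _ _ (coact.lTensor (Bar G A) z)) := by
      intro z
      induction z with
      | zero => simp
      | add z w hz hw => simp only [_root_.map_add, hz, hw]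
      | tmul c d =>
        simp only [LinearMap.lTensor_tmul, LinearMap.rTensor_tmul]
        generalize coact d = y
        induction y with
        | zero => simp
        | add z w hz hw => simp only [TensorProduct.tmul_add, _root_.map_add, hz, hw]
        | tmul d d' => simp
    rw [comul_cons, _root_.map_add, _root_.map_add, leftComm_coact_coact, h, hc, coact_cons]
    generalize coact c = z
    induction z with
    | zero => simp
    | add z w hz hw => simp only [_root_.map_add, ← hz, ← hw]; abel
    | tmul c d => simp [TensorProduct.tmul_add]

/-- `c ↦ ∑ (g c', ψ c'')`, where `∑ c' ⊗ c''` is the coproduct of `c`. -/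
def head (ψ : A →ₗ[ℂ] B) (g : Bar G A →ₗ[ℂ] B) : Bar G A →ₗ[ℂ] Bar G B :=
  TensorProduct.lift ((cons ∘ₗ g).compl₂ (map ψ)) ∘ₗ comul

/-- The extension of `g` to a coderivation along `φ` on the left and `ψ` on the right:
`(x₁, …, x_n) ↦ ∑ (φ x₁, …, φ x_i, g (…), ψ x_k, …, ψ x_n)`. -/
def ins (φ ψ : A →ₗ[ℂ] B) (g : Bar G A →ₗ[ℂ] B) : Bar G A →ₗ[ℂ] Bar G B :=
  para (fun β => head ψ g (e β))
    (LinearMap.mk₂ ℂ (fun x p => cons (φ x) p.2 + head ψ g (cons x p.1))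
      (by intros; simp; abel) (by intros; simp) (by intros; simp; abel) (by intros; simp))

variable (φ ψ : A →ₗ[ℂ] B) (g : Bar G A →ₗ[ℂ] B)

@[simp]
theorem ins_e (β : G) : ins φ ψ g (e β) = head ψ g (e β) := by simp only [ins, para_e]

theorem ins_cons (x : A) (c : Bar G A) :
    ins φ ψ g (cons x c) = cons (φ x) (ins φ ψ g c) + head ψ g (cons x c) := by
  simp only [ins, para_cons, LinearMap.mk₂_apply]

/-- A cut of the resulting word lies either in front of the new letter, which leaves an empty word
on the left, or behind it. -/
theorem comul_head (c : Bar G A) :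
    comul (head ψ g c) =
      coact (head ψ g c) + TensorProduct.map (head ψ g) (map ψ) (comul c) := by
  have h : ∀ z : Bar G A ⊗[ℂ] Bar G A,
      comul (TensorProduct.lift ((cons ∘ₗ g).compl₂ (map ψ)) z) =
        coact (TensorProduct.lift ((cons ∘ₗ g).compl₂ (map ψ)) z) +
        TensorProduct.map (TensorProduct.lift ((cons ∘ₗ g).compl₂ (map ψ))) (map ψ)
          ((TensorProduct.assoc ℂ _ _ _).symm (comul.lTensor (Bar G A) z)) := by
    intro z
    induction z with
    | zero => simp
    | add z w hz hw => simp only [_root_.map_add, hz, hw]; abel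
    | tmul c d =>
      simp only [TensorProduct.lift.tmul, LinearMap.compl₂_apply, LinearMap.comp_apply,
        comul_cons, comul_map, LinearMap.lTensor_tmul]
      congr 1
      generalize comul d = y
      induction y with
      | zero => simp
      | add z w hz hw => simp only [TensorProduct.tmul_add, _root_.map_add, hz, hw]
      | tmul d d' => simp
  rw [head, LinearMap.comp_apply, h, ← comul_comul, LinearEquiv.symm_apply_apply]
  congr 1
  generalize comul c = z
  induction z with
  | zero => simp
  | add z w hz hw => simp only [_root_.map_add, hz, hw]
  | tmul c d => simp

theorem coact_head (c : Bar G A) :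
    coact (head ψ g c) = TensorProduct.map (map φ) (head ψ g) (coact c) := by
  have h : ∀ z : Bar G A ⊗[ℂ] Bar G A,
      coact (TensorProduct.lift ((cons ∘ₗ g).compl₂ (map ψ)) z) =
        TensorProduct.map (map ψ) (TensorProduct.lift ((cons ∘ₗ g).compl₂ (map ψ)))
          (TensorProduct.leftComm ℂ _ _ _ (coact.lTensor (Bar G A) z)) := by
    intro z
    induction z with
    | zero => simp
    | add z w hz hw => simp only [_root_.map_add, hz, hw]
    | tmul c d =>
      simp only [TensorProduct.lift.tmul, LinearMap.compl₂_apply, LinearMap.comp_apply,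
        coact_cons, coact_map, LinearMap.lTensor_tmul]
      generalize coact d = y
      induction y with
      | zero => simp
      | add z w hz hw => simp only [TensorProduct.tmul_add, _root_.map_add, hz, hw]
      | tmul d d' => simp
  rw [map_coact_left (g := map ψ) (by simp), head, LinearMap.comp_apply, h, leftComm_coact_comul]
  generalize coact c = z
  induction z with
  | zero => simp
  | add z w hz hw => simp only [_root_.map_add, hz, hw]
  | tmul c d => simp

theorem coact_ins (c : Bar G A) :
    coact (ins φ ψ g c) = TensorProduct.map (map φ) (ins φ ψ g) (coact c) := by
  induction c using induction with
  | zero => simp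
  | add c d hc hd => simp only [_root_.map_add, hc, hd]
  | smul a c hc => simp only [_root_.map_smul, hc]
  | empty β => rw [ins_e, coact_head φ]; simp
  | cons x c hc =>
    rw [ins_cons, _root_.map_add, coact_cons, hc, coact_head φ, coact_cons]
    generalize coact c = z
    induction z with
    | zero => simp
    | add z w hz hw => simp only [_root_.map_add, ← hz, ← hw]; abel
    | tmul c d => simp [TensorProduct.tmul_add, ins_cons]

/-- The coderivation property: the new letter lies on the left or on the right of the cut, and the
other factor consists of letters transformed by `ψ` or by `φ` alone. -/
theorem comul_ins (c : Bar G A) :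
    comul (ins φ ψ g c) = TensorProduct.map (ins φ ψ g) (map ψ) (comul c) +
      TensorProduct.map (map φ) (ins φ ψ g) (comul c) := by
  induction c using induction with
  | zero => simp
  | add c d hc hd => simp only [_root_.map_add, hc, hd]; abel
  | smul a c hc => simp only [_root_.map_smul, hc, smul_add]
  | empty β =>
    rw [ins_e, comul_head, coact_head φ, add_comm]
    simp
  | cons x c hc =>
    rw [ins_cons, _root_.map_add, comul_head, coact_head φ, comul_cons, hc, coact_cons, coact_ins,
      comul_cons]
    simp only [_root_.map_add]
    rw [map_coact_left (f := ins φ ψ g) (g := head ψ g) (by simp), coact_cons]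
    have h1 : ∀ z : Bar G A ⊗[ℂ] Bar G A, TensorProduct.map (ins φ ψ g) (map ψ)
        ((cons x).rTensor (Bar G A) z) = (cons (φ x)).rTensor (Bar G B)
          (TensorProduct.map (ins φ ψ g) (map ψ) z) +
        TensorProduct.map (head ψ g) (map ψ) ((cons x).rTensor (Bar G A) z) := by
      intro z
      induction z with
      | zero => simp
      | add z w hz hw => simp only [_root_.map_add, hz, hw]; abel
      | tmul c d => simp [ins_cons, TensorProduct.add_tmul]
    have h2 : ∀ z : Bar G A ⊗[ℂ] Bar G A, TensorProduct.map (map φ) (ins φ ψ g)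
        ((cons x).rTensor (Bar G A) z) = (cons (φ x)).rTensor (Bar G B)
          (TensorProduct.map (map φ) (ins φ ψ g) z) := by
      intro z
      induction z with
      | zero => simp
      | add z w hz hw => simp only [_root_.map_add, hz, hw]
      | tmul c d => simp
    have h3 : ∀ z : Bar G A ⊗[ℂ] Bar G A, TensorProduct.map (map φ) (ins φ ψ g)
        ((cons x).lTensor (Bar G A) z) = (cons (φ x)).lTensor (Bar G B)
          (TensorProduct.map (map φ) (ins φ ψ g) z) +
        TensorProduct.map (map φ) (head ψ g) ((cons x).lTensor (Bar G A) z) := by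
      intro z
      induction z with
      | zero => simp
      | add z w hz hw => simp only [_root_.map_add, hz, hw]; abel
      | tmul c d => simp [ins_cons, TensorProduct.tmul_add]
    rw [h1, h2, h3]
    abel

end Bar
end Coderivations

/-! ### Coderivations are determined by their components of length one -/

section Corestriction

variable {G : AddSubmonoid ℝ≥0} {A B : Type*} [AddCommGroup A] [Module ℂ A]
  [AddCommGroup B] [Module ℂ B] {E : Type*} [AddCommGroup E] [Module ℂ E]

namespace Bar

/-- The coefficient of the empty word of energy zero. -/
def counit : Bar G A →ₗ[ℂ] ℂ := Finsupp.lapply 0 ∘ₗ scalar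

@[simp]
theorem counit_e_zero : counit (e 0 : Bar G A) = 1 := by simp [counit]

theorem counit_e {β : G} (h : β ≠ 0) : counit (e β : Bar G A) = 0 := by simp [counit, h]

@[simp]
theorem counit_cons (x : A) (c : Bar G A) : counit (cons x c) = 0 := by simp [counit]

/-- The linear combination of empty words with given coefficients. -/
def ofScalar : (G →₀ ℂ) →ₗ[ℂ] Bar G A := Finsupp.lsum ℂ fun β => LinearMap.toSpanSingleton ℂ _ (e β)

@[simp]
theorem ofScalar_single (β : G) : ofScalar (Finsupp.single β 1) = (e β : Bar G A) := by
  simp [ofScalar]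

variable [HasAntidiagonal G]

theorem counit_rTensor_coact (c : Bar G A) :
    TensorProduct.lid ℂ _ (counit.rTensor (Bar G A) (coact c)) = c := by
  induction c using induction with
  | zero => simp
  | add c d hc hd => simp only [_root_.map_add, hc, hd]
  | smul a c hc => simp only [_root_.map_smul, hc]
  | empty β =>
    simp only [coact_e, map_sum, LinearMap.rTensor_tmul, TensorProduct.lid_tmul]
    rw [sum_eq_single ((0, β) : G × G)]
    · simp
    · rintro ⟨a, b⟩ hab hne
      have : a ≠ 0 := by
        rintro rfl
        simp only [mem_antidiagonal, zero_add] at hab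
        exact hne (by rw [hab])
      simp [counit_e this]
    · intro h; exact absurd (by simp) h
  | cons x c hc =>
    conv_rhs => rw [← hc]
    rw [coact_cons]
    generalize coact c = z
    induction z with
    | zero => simp
    | add z w hz hw => simp only [_root_.map_add, hz, hw]
    | tmul c d => simp

theorem counit_rTensor_comul (c : Bar G A) :
    TensorProduct.lid ℂ _ (counit.rTensor (Bar G A) (comul c)) = c := by
  induction c using induction with
  | zero => simp
  | add c d hc hd => simp only [_root_.map_add, hc, hd]
  | smul a c hc => simp only [_root_.map_smul, hc]
  | empty β => rw [comul_e, counit_rTensor_coact]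
  | cons x c hc =>
    rw [comul_cons, _root_.map_add, _root_.map_add, counit_rTensor_coact]
    generalize comul c = z
    rw [add_eq_left]
    induction z with
    | zero => simp
    | add z w hz hw => simp only [_root_.map_add, hz, hw, add_zero]
    | tmul c d => simp

theorem counit_lTensor_comul (c : Bar G A) :
    TensorProduct.rid ℂ _ (counit.lTensor (Bar G A) (comul c)) = c := by
  induction c using induction with
  | zero => simp
  | add c d hc hd => simp only [_root_.map_add, hc, hd]
  | smul a c hc => simp only [_root_.map_smul, hc]
  | empty β =>
    simp only [comul_e, coact_e, map_sum, LinearMap.lTensor_tmul, TensorProduct.rid_tmul]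
    rw [sum_eq_single ((β, 0) : G × G)]
    · simp
    · rintro ⟨a, b⟩ hab hne
      have : b ≠ 0 := by
        rintro rfl
        simp only [mem_antidiagonal, add_zero] at hab
        exact hne (by rw [hab])
      simp [counit_e this]
    · intro h; exact absurd (by simp) h
  | cons x c hc =>
    have h1 : TensorProduct.rid ℂ _ (counit.lTensor (Bar G A) (coact (cons x c))) = 0 := by
      rw [coact_cons]
      generalize coact c = z
      induction z with
      | zero => simp
      | add z w hz hw => simp only [_root_.map_add, hz, hw, add_zero]
      | tmul c d => simp
    conv_rhs => rw [← hc]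
    rw [comul_cons, _root_.map_add, _root_.map_add, h1, zero_add]
    generalize comul c = z
    induction z with
    | zero => simp
    | add z w hz hw => simp only [_root_.map_add, hz, hw]
    | tmul c d => simp

theorem rTensor_proj_coact (c : Bar G A) : proj.rTensor (Bar G A) (coact c) = 0 := by
  have := map_coact_left (f := proj) (g := 0) (E := A) (by simp) LinearMap.id c
  simpa [LinearMap.rTensor] using this

@[simp]
theorem rTensor_proj_comul_e (β : G) : proj.rTensor (Bar G A) (comul (e β)) = 0 := by
  rw [comul_e, rTensor_proj_coact]

@[simp]
theorem rTensor_proj_comul_cons (x : A) (c : Bar G A) :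
    proj.rTensor (Bar G A) (comul (cons x c)) = x ⊗ₜ[ℂ] c := by
  rw [comul_cons, _root_.map_add, rTensor_proj_coact, zero_add]
  conv_rhs => rw [← counit_rTensor_comul c]
  generalize comul c = z
  induction z with
  | zero => simp
  | add z w hz hw => simp only [_root_.map_add, hz, hw, TensorProduct.tmul_add]
  | tmul c d => simp [counit, TensorProduct.smul_tmul]

/-- Reducing the left factor of the coproduct to a single letter splits off the first letter, so a
coproduct determines the element up to its part of length zero. -/
theorem eq_ofScalar_add (z : Bar G A) :
    z = ofScalar (scalar z) + TensorProduct.lift cons (proj.rTensor (Bar G A) (comul z)) := by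
  induction z using induction with
  | zero => simp
  | add c d hc hd =>
    nth_rewrite 1 [hc, hd]
    simp only [_root_.map_add]; abel
  | smul a c hc =>
    nth_rewrite 1 [hc]
    simp only [_root_.map_smul, smul_add]
  | empty β => simp only [rTensor_proj_comul_e]; simp
  | cons x c hc => rw [rTensor_proj_comul_cons]; simp

/-- The first letter of `Y c` can only come from `Y` itself, which is excluded by `hp`, or from the
first letter of `c`. Hence `Y (cons x c) = cons (φ x) (Y c)`, and `Y` vanishes by recursion on the
word. -/
theorem eq_zero_of_coderivation (φ : A →ₗ[ℂ] B) (ψ Y : Bar G A →ₗ[ℂ] Bar G B)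
    (hY : ∀ c, comul (Y c) =
      TensorProduct.map Y ψ (comul c) + TensorProduct.map (map φ) Y (comul c))
    (hs : ∀ c, scalar (Y c) = 0) (hp : ∀ c, proj (Y c) = 0) : Y = 0 := by
  have key : ∀ c, Y c = TensorProduct.lift (cons ∘ₗ φ)
      (Y.lTensor A (proj.rTensor (Bar G A) (comul c))) := by
    intro c
    rw [eq_ofScalar_add (Y c), hs, hY, _root_.map_zero, zero_add]
    generalize comul c = z
    induction z with
    | zero => simp
    | add z w hz hw => simp only [_root_.map_add] at hz hw ⊢; rw [← hz, ← hw]; abel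
    | tmul c d =>
      have := LinearMap.congr_fun (proj_map (G := G) φ) c
      simp only [LinearMap.comp_apply] at this
      simp [hp, this]
  apply hom_ext
  · intro β; rw [key, rTensor_proj_comul_e]; simp
  · intro x c hc; rw [key, rTensor_proj_comul_cons]; simp [hc]

theorem scalar_head (ψ : A →ₗ[ℂ] B) (g : Bar G A →ₗ[ℂ] B) (c : Bar G A) :
    scalar (head ψ g c) = 0 := by
  rw [head, LinearMap.comp_apply]
  generalize comul c = z
  induction z with
  | zero => simp
  | add z w hz hw => simp only [_root_.map_add, hz, hw, add_zero]
  | tmul c d => simp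

theorem proj_head (ψ : A →ₗ[ℂ] B) (g : Bar G A →ₗ[ℂ] B) (c : Bar G A) :
    proj (head ψ g c) = g c := by
  conv_rhs => rw [← counit_lTensor_comul c]
  rw [head, LinearMap.comp_apply]
  generalize comul c = z
  induction z with
  | zero => simp
  | add z w hz hw => simp only [_root_.map_add, hz, hw]
  | tmul c d =>
    have := LinearMap.congr_fun (scalar_map (G := G) ψ) d
    simp only [LinearMap.comp_apply] at this
    simp [counit, this]

variable (φ ψ : A →ₗ[ℂ] B) (g : Bar G A →ₗ[ℂ] B)

theorem scalar_ins (c : Bar G A) : scalar (ins φ ψ g c) = 0 := by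
  induction c using induction with
  | zero => simp
  | add c d hc hd => simp only [_root_.map_add, hc, hd, add_zero]
  | smul a c hc => simp only [_root_.map_smul, hc, smul_zero]
  | empty β => rw [ins_e, scalar_head]
  | cons x c hc => rw [ins_cons, _root_.map_add, scalar_head, scalar_cons, add_zero]

theorem proj_ins (c : Bar G A) : proj (ins φ ψ g c) = g c := by
  induction c using induction with
  | zero => simp
  | add c d hc hd => simp only [_root_.map_add, hc, hd]
  | smul a c hc => simp only [_root_.map_smul, hc]
  | empty β => rw [ins_e, proj_head]
  | cons x c hc => rw [ins_cons, _root_.map_add, proj_head, proj_cons, scalar_ins]; simp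

theorem eq_of_coderivation {ψ' Y Z : Bar G A →ₗ[ℂ] Bar G B}
    (hY : ∀ c, comul (Y c) =
      TensorProduct.map Y ψ' (comul c) + TensorProduct.map (map φ) Y (comul c))
    (hZ : ∀ c, comul (Z c) =
      TensorProduct.map Z ψ' (comul c) + TensorProduct.map (map φ) Z (comul c))
    (hs : ∀ c, scalar (Y c) = scalar (Z c)) (hp : ∀ c, proj (Y c) = proj (Z c)) : Y = Z := by
  rw [← sub_eq_zero]
  refine eq_zero_of_coderivation φ ψ' _ (fun c => ?_) (fun c => ?_) (fun c => ?_)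
  · rw [LinearMap.sub_apply, map_sub, hY, hZ]
    generalize comul c = z
    induction z with
    | zero => simp
    | add z w hz hw =>
      have := congr_arg₂ (· + ·) hz hw
      simp only [_root_.map_add]
      refine Eq.trans ?_ (this.trans ?_) <;> abel
    | tmul c d => simp [TensorProduct.sub_tmul, TensorProduct.tmul_sub]; abel
  · rw [LinearMap.sub_apply, map_sub, hs, sub_self]
  · rw [LinearMap.sub_apply, map_sub, hp, sub_self]

theorem head_add (g' : Bar G A →ₗ[ℂ] B) : head ψ (g + g') = head ψ g + head ψ g' := by
  ext c
  simp only [head, LinearMap.comp_apply, LinearMap.add_apply]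
  generalize comul c = z
  induction z with
  | zero => simp
  | add z w hz hw => simp only [_root_.map_add, hz, hw]; abel
  | tmul c d => simp

theorem head_smul (a : ℂ) : head ψ (a • g) = a • head ψ g := by
  ext c
  simp only [head, LinearMap.comp_apply, LinearMap.smul_apply]
  generalize comul c = z
  induction z with
  | zero => simp
  | add z w hz hw => simp only [_root_.map_add, hz, hw, smul_add]
  | tmul c d => simp

theorem ins_add (g' : Bar G A →ₗ[ℂ] B) : ins φ ψ (g + g') = ins φ ψ g + ins φ ψ g' := by
  apply hom_ext
  · intro β; simp [head_add]
  · intro x c h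
    rw [ins_cons, h, LinearMap.add_apply, LinearMap.add_apply, ins_cons, ins_cons, head_add,
      LinearMap.add_apply, _root_.map_add]
    abel

theorem ins_smul (a : ℂ) : ins φ ψ (a • g) = a • ins φ ψ g := by
  apply hom_ext
  · intro β; simp [head_smul]
  · intro x c h
    rw [ins_cons, h, LinearMap.smul_apply, LinearMap.smul_apply, ins_cons, head_smul,
      LinearMap.smul_apply, _root_.map_smul, smul_add]

/-- Naturality of the extension. It reduces statements about whole coderivations (degrees,
evaluation at a point, strict morphisms) to statements about their components. -/
theorem map_ins {A' B' : Type*} [AddCommGroup A'] [Module ℂ A'] [AddCommGroup B'] [Module ℂ B']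
    {φ' ψ' : A' →ₗ[ℂ] B'} {g' : Bar G A' →ₗ[ℂ] B'} (σ : A →ₗ[ℂ] A') (τ : B →ₗ[ℂ] B')
    (hφ : τ ∘ₗ φ = φ' ∘ₗ σ) (hψ : τ ∘ₗ ψ = ψ' ∘ₗ σ) (hg : τ ∘ₗ g = g' ∘ₗ map σ) :
    map τ ∘ₗ ins φ ψ g = ins φ' ψ' g' ∘ₗ map σ := by
  have hh : ∀ c, map τ (head ψ g c) = head ψ' g' (map σ c) := by
    intro c
    simp only [head, LinearMap.comp_apply, comul_map]
    generalize comul c = z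
    induction z with
    | zero => simp
    | add z w hz hw => simp only [_root_.map_add, hz, hw]
    | tmul c d =>
      have h1 := LinearMap.congr_fun hg c
      have h2 := LinearMap.congr_fun (map_comp (G := G) τ ψ) d
      rw [hψ, map_comp] at h2
      simp only [LinearMap.comp_apply] at h1 h2
      simp [h1, h2]
  apply hom_ext
  · intro β
    rw [LinearMap.comp_apply, ins_e, hh, LinearMap.comp_apply, map_e, ins_e]
  · intro x c hc
    have h1 := LinearMap.congr_fun hφ x
    simp only [LinearMap.comp_apply] at hc h1 ⊢
    rw [ins_cons, _root_.map_add, map_cons, hc, h1, hh, map_cons, ins_cons]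

end Bar
end Corestriction

/-! ### Words, the correspondence with families, and the energy filtration -/

section Words

variable {G : AddSubmonoid ℝ≥0} {A B : Type*} [AddCommGroup A] [Module ℂ A]
  [AddCommGroup B] [Module ℂ B] {E : Type*} [AddCommGroup E] [Module ℂ E]

/-- Inserting a vector into the first argument of all maps of a family. -/
def Fam.curry : A →ₗ[ℂ] Fam G A E →ₗ[ℂ] Fam G A E :=
  LinearMap.mk₂ ℂ (fun x f n β => (f (n + 1) β).curryLeft x)
    (by intros; ext; simp) (by intros; ext; simp) (by intros; ext; simp) (by intros; ext; simp)

theorem Fam.curry_apply (x : A) (f : Fam G A E) (n : ℕ) (β : G) (y : ℕ → A) :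
    (Fam.curry x f n β fun a => y a) = f (n + 1) β fun a => Nat.casesOn (a : ℕ) x y := by
  simp only [Fam.curry, LinearMap.mk₂_apply, MultilinearMap.curryLeft_apply]
  congr 1
  ext a
  refine Fin.cases ?_ (fun a => ?_) a <;> simp

theorem Fam.congr (f : Fam G A E) {n m : ℕ} (h : n = m) (β : G) {x y : ℕ → A}
    (hxy : ∀ a < n, x a = y a) : (f n β fun a => x a) = f m β fun a => y a := by
  subst h
  congr 1
  ext a
  exact hxy a a.2

theorem exists_extension {X : Type*} [Nonempty X] {n : ℕ} (x : Fin n → X) :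
    ∃ y : ℕ → X, x = fun a : Fin n => y a :=
  ⟨fun a => if h : a < n then x ⟨a, h⟩ else Classical.arbitrary X, by ext a; simp⟩

namespace Bar

/-- The word `(x 0, …, x (n - 1); β)`. -/
def word : ℕ → (ℕ → A) → G → Bar G A
  | 0, _, β => e β
  | n + 1, x, β => cons (x 0) (word n (fun a => x (a + 1)) β)

@[simp]
theorem word_zero (x : ℕ → A) (β : G) : word 0 x β = e β := rfl

theorem word_succ (n : ℕ) (x : ℕ → A) (β : G) :
    word (n + 1) x β = cons (x 0) (word n (fun a => x (a + 1)) β) := rfl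

theorem cons_word (x : A) (n : ℕ) (y : ℕ → A) (β : G) :
    cons x (word n y β) = word (n + 1) (fun a => Nat.casesOn a x y) β := rfl

/-- The span of the words whose energy lies in `S`. -/
def level (S : Set G) : Submodule ℂ (Bar G A) :=
  Submodule.span ℂ {c | ∃ n x, ∃ β ∈ S, c = word n x β}

theorem word_mem_level {S : Set G} {β : G} (h : β ∈ S) (n : ℕ) (x : ℕ → A) :
    word n x β ∈ level S := Submodule.subset_span ⟨n, x, β, h, rfl⟩

theorem level_mono {S T : Set G} (h : S ⊆ T) : level (A := A) S ≤ level T :=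
  Submodule.span_mono fun _ ⟨n, x, β, hβ, hc⟩ => ⟨n, x, β, h hβ, hc⟩

theorem cons_mem_level {S : Set G} (x : A) {c : Bar G A} (h : c ∈ level S) :
    cons x c ∈ level S := by
  induction h using Submodule.span_induction with
  | mem c hc =>
    obtain ⟨n, y, β, hβ, rfl⟩ := hc
    rw [cons_word]; exact word_mem_level hβ _ _
  | zero => simp
  | add c d _ _ hc hd => rw [_root_.map_add]; exact add_mem hc hd
  | smul a c _ hc => rw [_root_.map_smul]; exact Submodule.smul_mem _ _ hc

theorem level_univ : level (A := A) (Set.univ : Set G) = ⊤ := by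
  rw [eq_top_iff]
  rintro c -
  induction c using induction with
  | zero => exact zero_mem _
  | add c d hc hd => exact add_mem hc hd
  | smul a c hc => exact Submodule.smul_mem _ _ hc
  | empty β => exact word_mem_level (Set.mem_univ β) 0 0
  | cons x c hc => exact cons_mem_level x hc

theorem hom_ext_word {f g : Bar G A →ₗ[ℂ] E} (h : ∀ n x β, f (word n x β) = g (word n x β)) :
    f = g := by
  refine LinearMap.ext_on level_univ ?_
  rintro c ⟨n, x, β, -, rfl⟩
  exact h n x β

/-- The pairing of words with families. -/
def pairing : Bar G A →ₗ[ℂ] Fam G A E →ₗ[ℂ] E :=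
  fold (fun β => { toFun := fun f => f 0 β Fin.elim0, map_add' := by simp, map_smul' := by simp })
    (LinearMap.mk₂ ℂ (fun x k => k ∘ₗ Fam.curry x)
      (by intros; ext; simp) (by intros; ext; simp) (by intros; ext; simp) (by intros; ext; simp))

/-- The linear map on words given by a family. -/
def toLin (f : Fam G A E) : Bar G A →ₗ[ℂ] E := pairing.flip f

theorem toLin_add (f g : Fam G A E) : toLin (f + g) = toLin f + toLin g := by simp [toLin]

theorem toLin_smul (a : ℂ) (f : Fam G A E) : toLin (a • f) = a • toLin f := by simp [toLin]

@[simp]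
theorem toLin_e (f : Fam G A E) (β : G) : toLin f (e β) = f 0 β Fin.elim0 := by
  simp [toLin, pairing]

@[simp]
theorem toLin_cons (f : Fam G A E) (x : A) (c : Bar G A) :
    toLin f (cons x c) = toLin (Fam.curry x f) c := by
  simp [toLin, pairing]

theorem toLin_word (f : Fam G A E) (n : ℕ) (x : ℕ → A) (β : G) :
    toLin f (word n x β) = f n β fun a => x a := by
  induction n generalizing x f with
  | zero =>
    rw [word_zero, toLin_e]
    congr 1
    ext a; exact a.elim0
  | succ n ih =>
    rw [word_succ, toLin_cons, ih, Fam.curry_apply _ _ _ _ fun a => x (a + 1)]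
    congr 1
    ext a
    refine Fin.cases ?_ (fun a => ?_) a <;> simp

theorem mk_tprod (n : ℕ) (x : ℕ → A) (β : G) :
    mk β (TensorAlgebra.tprod ℂ A n fun a => x a) = word n x β := by
  induction n generalizing x with
  | zero => simp [TensorAlgebra.tprod_apply, e]
  | succ n ih =>
    rw [word_succ, ← ih, cons_mk]
    simp [TensorAlgebra.tprod_apply, List.ofFn_succ]

/-- The family given by a linear map on words. -/
def toFam (Y : Bar G A →ₗ[ℂ] E) : Fam G A E := fun n β =>
  Y.compMultilinearMap ((mk β).compMultilinearMap (TensorAlgebra.tprod ℂ A n))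

theorem toFam_apply (Y : Bar G A →ₗ[ℂ] E) (n : ℕ) (β : G) (x : ℕ → A) :
    (toFam Y n β fun a => x a) = Y (word n x β) := by
  rw [← mk_tprod]; rfl

@[simp]
theorem toLin_toFam (Y : Bar G A →ₗ[ℂ] E) : toLin (toFam Y) = Y :=
  hom_ext_word fun n x β => by rw [toLin_word, toFam_apply]


@[simp]
theorem map_word (φ : A →ₗ[ℂ] B) (n : ℕ) (x : ℕ → A) (β : G) :
    map φ (word n x β) = word n (fun a => φ (x a)) β := by
  induction n generalizing x with
  | zero => simp
  | succ n ih => rw [word_succ, map_cons, ih, word_succ]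

variable [HasAntidiagonal G]

theorem coact_word (n : ℕ) (x : ℕ → A) (β : G) :
    coact (word n x β) = ∑ q ∈ antidiagonal β, e q.1 ⊗ₜ[ℂ] word n x q.2 := by
  induction n generalizing x with
  | zero => simp
  | succ n ih => simp [word_succ, ih]

theorem comul_word (n : ℕ) (x : ℕ → A) (β : G) :
    comul (word n x β) = ∑ p ∈ antidiagonal n, ∑ q ∈ antidiagonal β,
      word p.1 x q.1 ⊗ₜ[ℂ] word p.2 (fun a => x (p.1 + a)) q.2 := by
  induction n generalizing x with
  | zero => simp
  | succ n ih =>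
    rw [Nat.antidiagonal_succ, sum_cons, sum_map, word_succ, comul_cons, ← word_succ, coact_word, ih]
    simp [word_succ, add_right_comm]

theorem sum_antidiagonal_swap {M : Type*} [AddCommMonoid M] (β : G) (f : G → G → M) :
    ∑ q ∈ antidiagonal β, f q.1 q.2 = ∑ q ∈ antidiagonal β, f q.2 q.1 := by
  refine sum_bij' (fun a _ => a.swap) (fun a _ => a.swap) ?_ ?_ ?_ ?_ ?_ <;>
    simp +contextual [add_comm]

theorem finsum_energy {M : Type*} [AddCommMonoid M] (β : G) (f : G × G → M) :
    ∑ᶠ q : {q : G × G // q.1 + q.2 = β}, f q.1 = ∑ q ∈ antidiagonal β, f q := by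
  rw [← finsum_mem_coe_finset, ← finsum_set_coe_eq_finsum_mem]
  refine finsum_eq_of_bijective (fun q => ⟨q.1, by simpa using q.2⟩) ?_ fun q => rfl
  exact ⟨fun a b h => Subtype.ext (by have := congrArg Subtype.val h; exact this),
    fun b => ⟨⟨b.1, mem_antidiagonal.1 b.2⟩, rfl⟩⟩

theorem head_word (ψ : A →ₗ[ℂ] B) (g : Bar G A →ₗ[ℂ] B) (n : ℕ) (x : ℕ → A) (β : G) :
    head ψ g (word n x β) = ∑ p ∈ antidiagonal n, ∑ q ∈ antidiagonal β,
      cons (g (word p.1 x q.1)) (word p.2 (fun a => ψ (x (p.1 + a))) q.2) := by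
  simp [head, comul_word, map_word]

theorem toLin_head_word (f : Fam G A B) (g : Fam G A A) (N : ℕ) (β : G) (x : ℕ → A) :
    toLin f (head LinearMap.id (toLin g) (word N x β)) =
      ∑ p ∈ antidiagonal N, ∑ q ∈ antidiagonal β, f (p.2 + 1) q.1 fun a =>
        if (a : ℕ) = 0 then g p.1 q.2 fun b => x b else x (a - 1 + p.1) := by
  rw [head_word, _root_.map_sum]
  refine sum_congr rfl fun p hp => ?_
  rw [_root_.map_sum]
  -- The energy of the block comes first in `head_word` but second in `insertion`.
  refine (sum_antidiagonal_swap β fun a b =>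
    toLin f (cons (toLin g (word p.1 x a)) (word p.2 (fun a => x (p.1 + a)) b))).trans ?_
  refine sum_congr rfl fun q hq => ?_
  rw [cons_word, toLin_word, toLin_word]
  congr 1
  ext a
  refine Fin.cases ?_ (fun a => ?_) a <;> simp [add_comm]

theorem insertion_eq (s : A →ₗ[ℂ] A) (f : Fam G A B) (g : Fam G A A) (N : ℕ) (β : G)
    (x : ℕ → A) : insertion s f g N β x =
      ∑ p ∈ antidiagonal N, ∑ q ∈ antidiagonal p.2, ∑ r ∈ antidiagonal β,
        f (p.1 + q.2 + 1) r.1 fun a =>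
          if (a : ℕ) < p.1 then s (x a)
          else if (a : ℕ) = p.1 then g q.1 r.2 fun b => x (p.1 + b)
          else x (a - 1 + q.1) := by
  refine sum_congr rfl fun p hp => sum_congr rfl fun q hq => ?_
  exact finsum_energy β fun e => f (p.1 + q.2 + 1) e.1 fun a =>
          if (a : ℕ) < p.1 then s (x a)
          else if (a : ℕ) = p.1 then g q.1 e.2 fun b => x (p.1 + b)
          else x (a - 1 + q.1)

/-- Induction on the word: either the block fed to `g` starts at the first letter, or the first
letter is passed over and picks up the sign operator `s`. -/
theorem toLin_ins_word (s : A →ₗ[ℂ] A) (f : Fam G A B) (g : Fam G A A) (N : ℕ) (β : G)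
    (x : ℕ → A) :
    toLin f (ins s LinearMap.id (toLin g) (word N x β)) = insertion s f g N β x := by
  rw [insertion_eq]
  induction N generalizing x f with
  | zero =>
    rw [word_zero, ins_e, ← word_zero x, toLin_head_word]
    simp
  | succ N ih =>
    rw [word_succ, ins_cons, ← word_succ, _root_.map_add, toLin_head_word, toLin_cons, ih]
    conv_rhs => rw [Nat.antidiagonal_succ, sum_cons, sum_map]
    rw [add_comm]
    congr 1
    · refine sum_congr rfl fun p hp => sum_congr rfl fun r hr => ?_
      refine Fam.congr f (by simp) _ (x := fun a => if a = 0 then g p.1 r.2 fun b => x b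
        else x (a - 1 + p.1)) (y := fun a => if a < 0 then s (x a) else if a = 0 then
          g p.1 r.2 fun b => x (0 + b) else x (a - 1 + p.1)) fun a ha => by simp
    · refine sum_congr rfl fun p hp => sum_congr rfl fun q hq => sum_congr rfl fun r hr => ?_
      rw [Fam.curry_apply _ _ _ _ fun a => if a < p.1 then s (x (a + 1)) else if a = p.1 then
        g q.1 r.2 fun b => x (p.1 + b + 1) else x (a - 1 + q.1 + 1)]
      refine Fam.congr f (by simp; omega) _ (y := fun a => if a < p.1 + 1 then s (x a) else
        if a = p.1 + 1 then g q.1 r.2 fun b => x (p.1 + 1 + b) else x (a - 1 + q.1)) fun a ha => ?_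
      cases a with
      | zero => simp
      | succ a =>
        simp only [add_lt_add_iff_right, add_left_inj, add_tsub_cancel_right]
        split_ifs with h1 h2
        · rfl
        · congr 1; ext b; congr 1; omega
        · congr 1; omega

/-- The number of ways to decompose an energy. -/
def energyRank (β : G) : ℕ := (antidiagonal β).card

/-- Adding `β₁` to the first summand embeds the decompositions of `β₂` into those of `β₁ + β₂`. The
image misses `(0, β₁ + β₂)`, because nonnegative reals with sum zero are zero. Thus `energyRank` is
a natural number on which inductions over the energy can run. -/
theorem energyRank_lt {β₁ β₂ : G} (h : β₁ ≠ 0) : energyRank β₂ < energyRank (β₁ + β₂) := by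
  have : ((antidiagonal β₂).image fun a => (β₁ + a.1, a.2)).card = (antidiagonal β₂).card :=
    card_image_of_injective _ fun a b hab => by
      simp only [Prod.mk.injEq, add_right_inj] at hab
      exact Prod.ext hab.1 hab.2
  rw [energyRank, ← this]
  refine card_lt_card ⟨fun a ha => ?_, fun hsub => ?_⟩
  · simp only [mem_image, mem_antidiagonal] at ha ⊢
    obtain ⟨b, hb, rfl⟩ := ha
    rw [add_assoc, hb]
  · have h0 : ((0 : G), β₁ + β₂) ∈ antidiagonal (β₁ + β₂) := by simp
    obtain ⟨b, -, hb⟩ := mem_image.1 (hsub h0)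
    simp only [Prod.mk.injEq] at hb
    apply h
    have h1 : (β₁ : ℝ≥0) + (b.1 : ℝ≥0) = 0 := congrArg Subtype.val hb.1
    exact Subtype.ext (add_eq_zero.1 h1).1

theorem energyRank_le {β : G} {q : G × G} (hq : q ∈ antidiagonal β) :
    energyRank q.2 ≤ energyRank β := by
  rw [mem_antidiagonal] at hq
  by_cases h : q.1 = 0
  · rw [← hq, h, zero_add]
  · rw [← hq]; exact (energyRank_lt h).le

theorem head_word_mem_level (ψ : A →ₗ[ℂ] B) (g : Bar G A →ₗ[ℂ] B)
    (hg : ∀ n x, g (word n x 0) = 0) (n : ℕ) (x : ℕ → A) (β : G) :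
    head ψ g (word n x β) ∈ level {β' | energyRank β' < energyRank β} := by
  rw [head_word]
  refine sum_mem fun p hp => sum_mem fun q hq => ?_
  by_cases h : q.1 = 0
  · rw [h, hg, _root_.map_zero]; exact zero_mem _
  · refine cons_mem_level _ (word_mem_level ?_ _ _)
    rw [← mem_antidiagonal.1 hq]
    exact energyRank_lt h

/-- As `g` vanishes in energy zero, each application of it uses up a nonzero energy. This is the
source of the nilpotence of the flows. -/
theorem ins_word_mem_level (φ ψ : A →ₗ[ℂ] B) (g : Bar G A →ₗ[ℂ] B)
    (hg : ∀ n x, g (word n x 0) = 0) (n : ℕ) (x : ℕ → A) (β : G) :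
    ins φ ψ g (word n x β) ∈ level {β' | energyRank β' < energyRank β} := by
  induction n generalizing x with
  | zero => rw [word_zero, ins_e, ← word_zero x]; exact head_word_mem_level ψ g hg _ _ _
  | succ n ih =>
    rw [word_succ, ins_cons, ← word_succ]
    exact add_mem (cons_mem_level _ (ih _)) (head_word_mem_level ψ g hg _ _ _)

theorem ins_mem_level (φ ψ : A →ₗ[ℂ] B) (g : Bar G A →ₗ[ℂ] B)
    (hg : ∀ n x, g (word n x 0) = 0) (r : ℕ) {c : Bar G A}
    (hc : c ∈ level {β | energyRank β < r + 1}) :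
    ins φ ψ g c ∈ level {β | energyRank β < r} := by
  induction hc using Submodule.span_induction with
  | mem c hc =>
    obtain ⟨n, y, β, hβ, rfl⟩ := hc
    refine level_mono (fun β' hβ' => ?_) (ins_word_mem_level φ ψ g hg n y β)
    simp only [Set.mem_ofPred_eq] at hβ hβ' ⊢
    omega
  | zero => simp
  | add c d _ _ hc hd => rw [_root_.map_add]; exact add_mem hc hd
  | smul a c _ hc => rw [_root_.map_smul]; exact Submodule.smul_mem _ _ hc

theorem exists_mem_level (c : Bar G A) : ∃ r, c ∈ level {β : G | energyRank β < r} := by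
  have h : c ∈ level (A := A) (Set.univ : Set G) := level_univ (A := A) (G := G) ▸ Submodule.mem_top
  induction h using Submodule.span_induction with
  | mem c hc =>
    obtain ⟨n, y, β, -, rfl⟩ := hc
    exact ⟨_, word_mem_level (Nat.lt_succ_self _) _ _⟩
  | zero => exact ⟨0, zero_mem _⟩
  | add c d _ _ hc hd =>
    obtain ⟨r, hr⟩ := hc
    obtain ⟨s, hs⟩ := hd
    refine ⟨max r s, add_mem (level_mono (fun β hβ => ?_) hr) (level_mono (fun β hβ => ?_) hs)⟩
    · exact lt_of_lt_of_le hβ (le_max_left r s)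
    · exact lt_of_lt_of_le hβ (le_max_right r s)
  | smul a c _ hc =>
    obtain ⟨r, hr⟩ := hc
    exact ⟨r, Submodule.smul_mem _ _ hr⟩

end Bar
end Words

/-! ### Composition of families as a finite sum over lists of blocks -/

section Composition

variable {G : AddSubmonoid ℝ≥0} {A B C : Type*} [AddCommGroup A] [Module ℂ A]
  [AddCommGroup B] [Module ℂ B] [AddCommGroup C] [Module ℂ C]

/-- The lists of blocks of total size `N` and total energy `β` in which no block is empty of energy
zero. -/
def blockLists (N : ℕ) (β : G) : Set (List (ℕ × G)) :=
  {l | (∀ b ∈ l, b ≠ 0) ∧ (l.map Prod.fst).sum = N ∧ (l.map Prod.snd).sum = β}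

theorem nil_mem_blockLists {N : ℕ} {β : G} : [] ∈ blockLists N β ↔ N = 0 ∧ β = 0 := by
  simp [blockLists, eq_comm]

theorem cons_mem_blockLists {N : ℕ} {β : G} {b : ℕ × G} {l : List (ℕ × G)} :
    b :: l ∈ blockLists N β ↔ b ≠ 0 ∧ ∃ M γ, b.1 + M = N ∧ b.2 + γ = β ∧ l ∈ blockLists M γ := by
  simp only [blockLists, Set.mem_ofPred_eq, List.mem_cons, forall_eq_or_imp, List.map_cons,
    List.sum_cons]
  constructor
  · rintro ⟨⟨h1, h2⟩, h3, h4⟩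
    exact ⟨h1, _, _, h3, h4, h2, rfl, rfl⟩
  · rintro ⟨h1, M, γ, h3, h4, h2, rfl, rfl⟩
    exact ⟨⟨h1, h2⟩, h3, h4⟩

/-- The contribution of a list of blocks to the composition of two families. -/
def evalBlocks (E : Fam G A B) : Fam G B C → List (ℕ × G) → (ℕ → A) → G → C
  | F, [], _, o => F 0 o Fin.elim0
  | F, b :: l, x, o =>
    evalBlocks E (Fam.curry (E b.1 b.2 fun a => x a) F) l (fun a => x (b.1 + a)) o

/-- The contribution of a list of blocks to the composition of a family with a coderivation. -/
def evalBlocksCoder (W' L W : Fam G A B) : Fam G B C → List (ℕ × G) → (ℕ → A) → G → C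
  | _, [], _, _ => 0
  | F, b :: l, x, o =>
    evalBlocksCoder W' L W (Fam.curry (W' b.1 b.2 fun a => x a) F) l (fun a => x (b.1 + a)) o +
      evalBlocks W (Fam.curry (L b.1 b.2 fun a => x a) F) l (fun a => x (b.1 + a)) o

theorem finSigmaFinEquiv_succ {n : ℕ} (size : Fin (n + 1) → ℕ) (a : Fin n)
    (i : Fin (size a.succ)) :
    (finSigmaFinEquiv ⟨a.succ, i⟩ : ℕ) =
      size 0 + (finSigmaFinEquiv (n := fun a : Fin n => size a.succ) ⟨a, i⟩ : ℕ) := by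
  rw [finSigmaFinEquiv_apply, finSigmaFinEquiv_apply, ← add_assoc]
  congr 1
  exact Fin.sum_univ_succ _

theorem finSigmaFinEquiv_zero {n : ℕ} (size : Fin (n + 1) → ℕ) (i : Fin (size 0)) :
    (finSigmaFinEquiv ⟨0, i⟩ : ℕ) = i := by
  rw [finSigmaFinEquiv_apply]; simp

theorem evalBlocks_ofFn (E : Fam G A B) (F : Fam G B C) {n : ℕ} (size : Fin n → ℕ)
    (inner : Fin n → G) (x : ℕ → A) (o : G) :
    evalBlocks E F (List.ofFn fun a => (size a, inner a)) x o =
      F n o fun a => E (size a) (inner a) fun i => x (finSigmaFinEquiv ⟨a, i⟩ : Fin _) := by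
  induction n generalizing F x with
  | zero =>
    simp only [List.ofFn_zero, evalBlocks]
    congr 1; ext a; exact a.elim0
  | succ n ih =>
    rw [List.ofFn_succ, evalBlocks, ih]
    simp only [Fam.curry, LinearMap.mk₂_apply, MultilinearMap.curryLeft_apply]
    congr 1
    ext a
    refine Fin.cases ?_ (fun a => ?_) a
    · simp [-finSigmaFinEquiv_apply, finSigmaFinEquiv_zero]
    · simp [-finSigmaFinEquiv_apply, finSigmaFinEquiv_succ]

/-- The splittings into blocks in which no block is empty of energy zero. -/
def BlockSplit.reduced (N : ℕ) (β : G) : Set (BlockSplit G N β) :=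
  {d | ∀ a, (d.size a, d.inner a) ≠ 0}

/-- The list of blocks of a splitting. -/
def BlockSplit.toList {N : ℕ} {β : G} (d : BlockSplit G N β) : List (ℕ × G) :=
  List.ofFn fun a => (d.size a, d.inner a)

theorem BlockSplit.toList_injective {N : ℕ} {β : G} {d d' : BlockSplit G N β}
    (h : d.toList = d'.toList) (ho : d.outer = d'.outer) : d = d' := by
  obtain ⟨j, size, outer, inner, h1, h2⟩ := d
  obtain ⟨j', size', outer', inner', h1', h2'⟩ := d'
  simp only [toList] at h ho
  obtain rfl : j = j' := by simpa using congrArg List.length h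
  have h3 := List.ofFn_injective h
  obtain rfl : size = size' := funext fun a => congrArg Prod.fst (congrFun h3 a)
  obtain rfl : inner = inner' := funext fun a => congrArg Prod.snd (congrFun h3 a)
  obtain rfl := ho
  rfl

theorem BlockSplit.exists_toList {N : ℕ} {β o : G} {l : List (ℕ × G)}
    (h1 : (l.map Prod.fst).sum = N) (h2 : o + (l.map Prod.snd).sum = β) :
    ∃ d : BlockSplit G N β, d.toList = l ∧ d.outer = o := by
  refine ⟨⟨l.length, fun a => (l.get a).1, o, fun a => (l.get a).2, ?_, ?_⟩, ?_, rfl⟩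
  · rw [← h1, ← List.sum_ofFn]; congr 1
    conv_rhs => rw [← List.ofFn_get l, List.map_ofFn]
    rfl
  · rw [← h2, ← List.sum_ofFn]; congr 2
    conv_rhs => rw [← List.ofFn_get l, List.map_ofFn]
    rfl
  · simp [toList]

variable [HasAntidiagonal G]

-- A block that is not empty of energy zero lowers the word length or the rank of the remaining
-- energy, so the recursion on their sum terminates.
open Classical in
theorem blockLists_finite (N : ℕ) (β : G) : (blockLists N β).Finite := by
  obtain ⟨r, hr⟩ : ∃ r, N + Bar.energyRank β < r := ⟨_, Nat.lt_succ_self _⟩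
  induction r generalizing N β with
  | zero => omega
  | succ r ih =>
    let S : Finset ((ℕ × ℕ) × G × G) :=
      (antidiagonal N ×ˢ antidiagonal β).filter fun p => (p.1.1, p.2.1) ≠ 0
    have hS : (⋃ p ∈ (S : Set ((ℕ × ℕ) × G × G)),
        List.cons (p.1.1, p.2.1) '' blockLists p.1.2 p.2.2).Finite := by
      refine Set.Finite.biUnion (finite_toSet _) ?_
      rintro ⟨⟨p1, p2⟩, ⟨q1, q2⟩⟩ hp
      simp only [S, coe_filter, mem_product, mem_antidiagonal, Set.mem_ofPred_eq] at hp
      refine (ih p2 q2 ?_).image _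
      obtain ⟨⟨hp, hq⟩, hne⟩ := hp
      by_cases h : q1 = 0
      · have hp1 : p1 ≠ 0 := by
          rintro rfl; exact hne (by rw [h]; rfl)
        have : Bar.energyRank q2 = Bar.energyRank β := by rw [← hq, h, zero_add]
        omega
      · have := Bar.energyRank_lt (β₂ := q2) h
        rw [hq] at this
        omega
    refine ((Set.finite_singleton []).union hS).subset ?_
    · rintro (_ | ⟨b, l⟩) hl
      · exact Or.inl rfl
      · obtain ⟨hb, M, γ, h1, h2, hl⟩ := cons_mem_blockLists.1 hl
        refine Or.inr (Set.mem_biUnion (x := ((b.1, M), (b.2, γ))) ?_ ⟨l, hl, rfl⟩)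
        simp only [S, coe_filter, mem_product, mem_antidiagonal, Set.mem_ofPred_eq]
        exact ⟨⟨h1, h2⟩, hb⟩

-- The sum is split according to the first block. This matches the recursion on words, in which the
-- coproduct splits off an initial subword.
open Classical in
theorem sum_blockLists {M : Type*} [AddCommMonoid M] (N : ℕ) (β : G) (f : List (ℕ × G) → M) :
    ∑ l ∈ (blockLists_finite N β).toFinset, f l =
      (if N = 0 ∧ β = 0 then f [] else 0) + ∑ p ∈ antidiagonal N, ∑ q ∈ antidiagonal β,
        if (p.1, q.1) = 0 then 0 else
          ∑ l ∈ (blockLists_finite p.2 q.2).toFinset, f ((p.1, q.1) :: l) := by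
  have h1 : ∀ p : ℕ × ℕ, ∀ q : G × G, (if (p.1, q.1) = 0 then 0 else
          ∑ l ∈ (blockLists_finite p.2 q.2).toFinset, f ((p.1, q.1) :: l)) =
      ∑ l ∈ (blockLists_finite p.2 q.2).toFinset,
        if (p.1, q.1) = 0 then 0 else f ((p.1, q.1) :: l) := by
    intro p q; split_ifs <;> simp
  simp only [h1]
  simp only [sum_sigma']
  rw [← sum_filter_add_sum_filter_not _ (fun l => l = [])]
  congr 1
  · split_ifs with h
    · rw [sum_eq_single []]
      · simp +contextual
      · intro hn
        exact absurd (by simpa [nil_mem_blockLists] using h) hn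
    · refine sum_eq_zero fun l hl => ?_
      simp only [mem_filter, Set.Finite.mem_toFinset] at hl
      obtain ⟨hl, rfl⟩ := hl
      exact absurd (nil_mem_blockLists.1 hl) h
  · refine Eq.trans ?_ (sum_filter_add_sum_filter_not _ (fun a => (a.1.1, a.2.1.1) = 0) _)
    refine Eq.trans ?_ (congrArg₂ (· + ·)
      (sum_eq_zero fun a ha => if_pos (mem_filter.1 ha).2).symm rfl)
    · rw [zero_add]
      symm
      refine sum_bij (fun a _ => (a.1.1, a.2.1.1) :: a.2.2) ?_ ?_ ?_ ?_
      · rintro ⟨⟨p1, p2⟩, ⟨q1, q2⟩, l⟩ ha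
        simp only [mem_filter, mem_sigma, mem_antidiagonal, Set.Finite.mem_toFinset] at ha ⊢
        exact ⟨cons_mem_blockLists.2 ⟨ha.2, p2, q2, ha.1.1, ha.1.2.1, ha.1.2.2⟩, by simp⟩
      · rintro ⟨⟨p1, p2⟩, ⟨q1, q2⟩, l⟩ ha ⟨⟨p1', p2'⟩, ⟨q1', q2'⟩, l'⟩ ha' h
        simp only [mem_filter, mem_sigma, mem_antidiagonal, Set.Finite.mem_toFinset] at ha ha'
        simp only [List.cons.injEq, Prod.mk.injEq] at h
        obtain ⟨⟨rfl, rfl⟩, rfl⟩ := h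
        obtain rfl : p2 = p2' := by omega
        obtain rfl : q2 = q2' := ha.1.2.2.2.2.symm.trans ha'.1.2.2.2.2
        rfl
      · rintro (_ | ⟨b, l⟩) hl
        · simp at hl
        · simp only [mem_filter, Set.Finite.mem_toFinset] at hl
          obtain ⟨hb, M, γ, h1, h2, hl⟩ := cons_mem_blockLists.1 hl.1
          refine ⟨⟨(b.1, M), (b.2, γ), l⟩, ?_, rfl⟩
          simp only [mem_filter, mem_sigma, mem_antidiagonal, Set.Finite.mem_toFinset]
          exact ⟨⟨h1, h2, hl⟩, hb⟩
      · rintro ⟨⟨p1, p2⟩, ⟨q1, q2⟩, l⟩ ha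
        simp only [mem_filter] at ha
        rw [if_neg ha.2]

theorem BlockSplit.reduced_finite (N : ℕ) (β : G) : (reduced N β).Finite := by
  have h : (⋃ q ∈ antidiagonal β, (fun l => (q.1, l)) '' blockLists N q.2).Finite :=
    Set.Finite.biUnion (finite_toSet _) fun q _ => (blockLists_finite N q.2).image _
  refine Set.Finite.of_finite_image (f := fun d => (d.outer, d.toList)) (h.subset ?_)
    fun d _ d' _ hd => toList_injective (congrArg Prod.snd hd) (congrArg Prod.fst hd)
  rintro _ ⟨d, hd, rfl⟩
  refine Set.mem_biUnion (x := (d.outer, ∑ a, d.inner a)) ?_ ⟨d.toList, ⟨?_, ?_, ?_⟩, rfl⟩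
  · simpa using d.energy_sum
  · simp only [toList, List.mem_ofFn]
    rintro b ⟨a, rfl⟩
    exact hd a
  · simp [toList, List.map_ofFn, List.sum_ofFn, d.size_sum]
  · simp [toList, List.map_ofFn, List.sum_ofFn]

theorem BlockSplit.sum_reduced {M : Type*} [AddCommMonoid M] (N : ℕ) (β : G)
    (f : List (ℕ × G) → G → M) :
    ∑ d ∈ (reduced_finite N β).toFinset, f d.toList d.outer =
      ∑ q ∈ antidiagonal β, ∑ l ∈ (blockLists_finite N q.2).toFinset, f l q.1 := by
  rw [sum_sigma']
  refine sum_bij (fun d _ => ⟨(d.outer, ∑ a, d.inner a), d.toList⟩) ?_ ?_ ?_ ?_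
  · intro d hd
    simp only [mem_sigma, mem_antidiagonal, Set.Finite.mem_toFinset]
    refine ⟨d.energy_sum, ?_, ?_, ?_⟩
    · simpa [toList, List.mem_ofFn, eq_comm, reduced] using hd
    · simp [toList, List.map_ofFn, List.sum_ofFn, d.size_sum]
    · simp [toList, List.map_ofFn, List.sum_ofFn]
  · intro d _ d' _ h
    simp only [Sigma.mk.injEq, Prod.mk.injEq, heq_eq_eq] at h
    exact toList_injective h.2 h.1.1
  · rintro ⟨⟨q1, q2⟩, l⟩ h
    simp only [mem_sigma, mem_antidiagonal, Set.Finite.mem_toFinset] at h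
    obtain ⟨hq, hl, h1, h2⟩ := h
    obtain ⟨d, rfl, rfl⟩ := exists_toList (o := q1) (β := β) h1 (by rw [h2, hq])
    refine ⟨d, ?_, ?_⟩
    · simpa [toList, List.mem_ofFn, eq_comm, reduced] using hl
    · rw [← h2]
      simp [toList, List.map_ofFn, List.sum_ofFn]
  · intro d hd; rfl

/-- Empty blocks of energy zero could be added without end; since `E 0 0 = 0` kills them, only the
finitely many reduced splittings contribute. -/
theorem Fam.comp_apply {E : Fam G A B} (hE : E 0 0 = 0) (F : Fam G B C) (N : ℕ) (β : G)
    (x : Fin N → A) :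
    F.comp E N β x = ∑ d ∈ (BlockSplit.reduced_finite N β).toFinset, F d.j d.outer fun a =>
      E (d.size a) (d.inner a) fun i => x (Fin.cast d.size_sum (finSigmaFinEquiv ⟨a, i⟩)) := by
  have h : Function.support (fun d : BlockSplit G N β =>
      ((F d.j d.outer).compMultilinearMap fun a => E (d.size a) (d.inner a)).domDomCongr
      (finSigmaFinEquiv.trans (finCongr d.size_sum))) ⊆
      (BlockSplit.reduced_finite N β).toFinset := by
    intro d hd
    rw [Set.Finite.coe_toFinset]
    intro a ha
    apply hd
    ext x
    simp only [Prod.mk_eq_zero] at ha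
    have hz : E (d.size a) (d.inner a) = 0 := by
      have : ∀ n (β : G), n = 0 → β = 0 → E n β = 0 := by
        rintro n β rfl rfl; exact hE
      exact this _ _ ha.1 ha.2
    simp only [MultilinearMap.domDomCongr_apply, MultilinearMap.compMultilinearMap_apply,
      _root_.zero_apply]
    exact (F d.j d.outer).map_coord_zero a (by rw [hz]; rfl)
  rw [Fam.comp, finsum_eq_sum_of_support_subset _ h, _root_.sum_apply]
  rfl

theorem Fam.comp_word {E : Fam G A B} (hE : E 0 0 = 0) (F : Fam G B C) (N : ℕ) (β : G)
    (x : ℕ → A) :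
    (F.comp E N β fun a => x a) = ∑ q ∈ antidiagonal β,
      ∑ l ∈ (blockLists_finite N q.2).toFinset, evalBlocks E F l x q.1 := by
  rw [Fam.comp_apply hE, ← BlockSplit.sum_reduced N β fun l o => evalBlocks E F l x o]
  refine sum_congr rfl fun d _ => ?_
  rw [BlockSplit.toList, evalBlocks_ofFn]
  rfl

end Composition

/-! ### Coalgebra maps and coderivations along them in terms of components -/

section CoalgebraMaps

variable {G : AddSubmonoid ℝ≥0} {A B C : Type*} [AddCommGroup A] [Module ℂ A]
  [AddCommGroup B] [Module ℂ B] [AddCommGroup C] [Module ℂ C]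

namespace Bar

theorem toLin_ofScalar_scalar_word (F : Fam G B C) (N : ℕ) (x : ℕ → A) (β : G) :
    toLin F (ofScalar (scalar (word N x β))) = if N = 0 then F 0 β Fin.elim0 else 0 := by
  cases N with
  | zero => simp
  | succ N => simp [word_succ]

theorem toLin_lift_cons (F : Fam G A B) (x : A) (c : Bar G A) :
    toLin F (TensorProduct.lift cons (x ⊗ₜ[ℂ] c)) = toLin (Fam.curry x F) c := by
  simp

theorem curry_zero_block {E : Fam G A B} (hE : E 0 0 = 0) {n : ℕ} {γ : G} (h : (n, γ) = 0)
    (x : ℕ → A) (F : Fam G B C) : Fam.curry (E n γ fun a => x a) F = 0 := by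
  simp only [Prod.mk_eq_zero] at h
  obtain ⟨rfl, rfl⟩ := h
  rw [hE, _root_.zero_apply, _root_.map_zero, LinearMap.zero_apply]

variable [HasAntidiagonal G]

/-- Maps of words compatible with the coproduct and with the empty words. -/
structure IsCoalgMap (f : Bar G A →ₗ[ℂ] Bar G B) : Prop where
  comul : ∀ c, comul (f c) = TensorProduct.map f f (comul c)
  scalar : ∀ c, scalar (f c) = scalar c

theorem isCoalgMap_map (φ : A →ₗ[ℂ] B) : IsCoalgMap (map (G := G) φ) where
  comul := comul_map φ
  scalar := LinearMap.congr_fun (scalar_map φ)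

theorem IsCoalgMap.comp {f : Bar G B →ₗ[ℂ] Bar G C} {g : Bar G A →ₗ[ℂ] Bar G B}
    (hf : IsCoalgMap f) (hg : IsCoalgMap g) : IsCoalgMap (f ∘ₗ g) where
  comul c := by
    rw [LinearMap.comp_apply, hf.comul, hg.comul, TensorProduct.map_comp, LinearMap.comp_apply]
  scalar c := by rw [LinearMap.comp_apply, hf.scalar, hg.scalar]

-- The first block is removed while the outer energy is left undivided until the end; this needs an
-- exchange of the order in which the two energies are split off.
open Classical in
theorem sum_blocks_eq {C : Type*} [AddCommGroup C] (N : ℕ) (β : G) (f : G → C)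
    (g : List (ℕ × G) → G → C)
    (h : ∀ o, g [] o = f o) :
    ∑ q ∈ antidiagonal β, ∑ l ∈ (blockLists_finite N q.2).toFinset, g l q.1 =
      (if N = 0 then f β else 0) + ∑ p ∈ antidiagonal N, ∑ q ∈ antidiagonal β,
        if (p.1, q.1) = 0 then 0 else ∑ r ∈ antidiagonal q.2,
          ∑ l ∈ (blockLists_finite p.2 r.2).toFinset, g ((p.1, q.1) :: l) r.1 := by
  have h1 : ∀ q ∈ antidiagonal β, ∑ l ∈ (blockLists_finite N q.2).toFinset, g l q.1 = _ :=
    fun q _ => sum_blockLists N q.2 _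
  rw [sum_congr rfl h1, sum_add_distrib]
  congr 1
  · by_cases hN : N = 0
    · simp only [hN, true_and, if_true, h]
      rw [sum_eq_single (β, 0)]
      · simp
      · rintro ⟨a, b⟩ hq hne
        rw [if_neg]
        rintro rfl
        simp only [mem_antidiagonal, add_zero] at hq
        exact hne (by rw [hq])
      · intro hq; exact absurd (by simp) hq
    · simp [hN]
  · rw [sum_comm]
    refine sum_congr rfl fun p _ => ?_
    have := sum_antidiagonal_comm β fun a b d => if (p.1, b) = 0 then 0 else
      ∑ l ∈ (blockLists_finite p.2 d).toFinset, g ((p.1, b) :: l) a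
    refine this.trans (sum_congr rfl fun q _ => ?_)
    split_ifs <;> simp

theorem measure_lt {N : ℕ} {β : G} {p : ℕ × ℕ} {q : G × G} (hp : p ∈ antidiagonal N)
    (hq : q ∈ antidiagonal β) (h : (p.1, q.1) ≠ 0) :
    p.2 + energyRank q.2 < N + energyRank β := by
  rw [mem_antidiagonal] at hp
  have h1 := energyRank_le hq
  by_cases h2 : q.1 = 0
  · have : p.1 ≠ 0 := fun h0 => h (by rw [h0, h2]; rfl)
    omega
  · have := energyRank_lt (β₂ := q.2) h2
    rw [mem_antidiagonal.1 hq] at this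
    omega

/-- The first letter of `f (word N x β)` is `E` applied to an initial block, and the rest is `f` of
the remaining word. Iterating this shows that a coalgebra map is determined by `E` and that
composition of families is composition of coalgebra maps. -/
theorem IsCoalgMap.toLin_word {f : Bar G A →ₗ[ℂ] Bar G B} (hf : IsCoalgMap f) {E : Fam G A B}
    (hE : ∀ c, proj (f c) = toLin E c) (hE0 : E 0 0 = 0) (F : Fam G B C) (N : ℕ) (β : G)
    (x : ℕ → A) : toLin F (f (word N x β)) = F.comp E N β fun a => x a := by
  rw [Fam.comp_word hE0]
  obtain ⟨r, hr⟩ : ∃ r, N + Bar.energyRank β < r := ⟨_, Nat.lt_succ_self _⟩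
  induction r generalizing N β x F with
  | zero => omega
  | succ r ih =>
    classical
    rw [sum_blocks_eq N β (fun o => F 0 o Fin.elim0) _ fun o => rfl, eq_ofScalar_add (f (word N x β)),
      hf.scalar, _root_.map_add, toLin_ofScalar_scalar_word, hf.comul, comul_word]
    congr 1
    simp only [_root_.map_sum, TensorProduct.map_tmul, LinearMap.rTensor_tmul, toLin_lift_cons, hE,
      Bar.toLin_word E]
    refine sum_congr rfl fun p hp => sum_congr rfl fun q hq => ?_
    -- The block that is empty of energy zero is the only one for which the induction measure does
    -- not drop, and it contributes nothing.
    split_ifs with h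
    · rw [curry_zero_block hE0 h]; simp [toLin]
    · rw [ih]
      · rfl
      · have := measure_lt hp hq h
        omega

/-- The same recursion for a coderivation along two coalgebra maps: one block receives `L`, the
blocks on its left `W'` and those on its right `W`. -/
theorem toLin_coderivation_word {f f' l : Bar G A →ₗ[ℂ] Bar G B} (hf : IsCoalgMap f)
    (hl : ∀ c, Bar.comul (l c) =
      TensorProduct.map l f (Bar.comul c) + TensorProduct.map f' l (Bar.comul c))
    (hls : ∀ c, Bar.scalar (l c) = 0) {W W' L : Fam G A B}
    (hW : ∀ c, proj (f c) = toLin W c) (hW' : ∀ c, proj (f' c) = toLin W' c)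
    (hL : ∀ c, proj (l c) = toLin L c) (hW0 : W 0 0 = 0) (hW0' : W' 0 0 = 0) (hL0 : L 0 0 = 0)
    (F : Fam G B C) (N : ℕ) (β : G) (x : ℕ → A) :
    toLin F (l (word N x β)) = ∑ q ∈ antidiagonal β,
      ∑ b ∈ (blockLists_finite N q.2).toFinset, evalBlocksCoder W' L W F b x q.1 := by
  obtain ⟨r, hr⟩ : ∃ r, N + Bar.energyRank β < r := ⟨_, Nat.lt_succ_self _⟩
  induction r generalizing N β x F with
  | zero => omega
  | succ r ih =>
    classical
    rw [sum_blocks_eq N β (fun o => 0) _ fun o => rfl, eq_ofScalar_add (l (word N x β)),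
      hls, _root_.map_zero, zero_add, hl, comul_word, ite_self, zero_add]
    simp only [_root_.map_sum, _root_.map_add, TensorProduct.map_tmul, LinearMap.rTensor_tmul,
      toLin_lift_cons, hL, hW', Bar.toLin_word]
    rw [← sum_add_distrib]
    refine sum_congr rfl fun p hp => ?_
    rw [← sum_add_distrib]
    refine sum_congr rfl fun q hq => ?_
    split_ifs with h
    · rw [curry_zero_block hW0' h, curry_zero_block hL0 h]; simp [toLin]
    · rw [ih, hf.toLin_word hW hW0,
        Fam.comp_word hW0 _ _ _ (fun a => x (p.1 + a)), add_comm, ← sum_add_distrib]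
      · refine sum_congr rfl fun r _ => ?_
        rw [← sum_add_distrib]
        rfl
      · have := measure_lt hp hq h
        omega

end Bar
end CoalgebraMaps

/-! ### Degrees as eigenvalues of scaling operators -/

section Scaling

variable {A B : Type*} [AddCommGroup A] [Module ℂ A] [AddCommGroup B] [Module ℂ B]

theorem multilinear_ext_of_span {S : Set A} (hS : Submodule.span ℂ S = ⊤) {k : ℕ}
    {f g : MultilinearMap ℂ (fun _ : Fin k => A) B} (h : ∀ x, (∀ i, x i ∈ S) → f x = g x) :
    f = g := by
  induction k with
  | zero => ext x; exact h x fun i => i.elim0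
  | succ k ih =>
    have key : f.curryLeft = g.curryLeft := by
      refine LinearMap.ext_on hS fun a ha => ih fun x hx => ?_
      simp only [MultilinearMap.curryLeft_apply]
      exact h _ fun i => Fin.cases (by simpa) (fun i => by simpa using hx i) i
    ext x
    have := DFunLike.congr_fun (LinearMap.congr_fun key (x 0)) (Fin.tail x)
    simpa using this

/-- Multiplication by `a^(d-1)` on `𝒜 d`. -/
def scale (𝒜 : ℤ → Submodule ℂ A) [DirectSum.Decomposition 𝒜] (a : ℂˣ) : A →ₗ[ℂ] A :=
  (DirectSum.toModule ℂ ℤ A fun d => ((a ^ (d - 1) : ℂˣ) : ℂ) • (𝒜 d).subtype) ∘ₗ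
    (DirectSum.decomposeLinearEquiv 𝒜).toLinearMap

variable (𝒜 : ℤ → Submodule ℂ A) [DirectSum.Decomposition 𝒜]
variable (ℬ : ℤ → Submodule ℂ B) [DirectSum.Decomposition ℬ]

theorem scale_of_mem (a : ℂˣ) {d : ℤ} {x : A} (hx : x ∈ 𝒜 d) :
    scale 𝒜 a x = ((a ^ (d - 1) : ℂˣ) : ℂ) • x := by
  lift x to 𝒜 d using hx
  rw [scale, LinearMap.comp_apply, LinearEquiv.coe_coe, DirectSum.decomposeLinearEquiv_apply_coe,
    DirectSum.toModule_lof]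
  rfl

theorem koszul_eq_scale : koszul 𝒜 = scale 𝒜 (-1) := by
  rw [koszul, scale]
  congr 2
  ext d x
  simp only [Int.negOnePow_def, LinearMap.smul_apply]
  rcases Int.even_or_odd (d - 1) with h | h
  · simp [h.neg_one_zpow]
  · simp [h.neg_one_zpow]

theorem hom_ext_homogeneous {f g : A →ₗ[ℂ] B} (h : ∀ d, ∀ x ∈ 𝒜 d, f x = g x) : f = g :=
  DirectSum.decompose_lhom_ext 𝒜 fun d => by ext ⟨x, hx⟩; exact h d x hx

theorem scale_mul (a b : ℂˣ) : scale 𝒜 (a * b) = scale 𝒜 a ∘ₗ scale 𝒜 b :=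
  hom_ext_homogeneous 𝒜 fun d x hx => by
    rw [LinearMap.comp_apply, scale_of_mem 𝒜 _ hx, scale_of_mem 𝒜 _ hx, map_smul,
      scale_of_mem 𝒜 _ hx, smul_smul, mul_zpow, mul_comm, Units.val_mul]

theorem scale_comm (a b : ℂˣ) : scale 𝒜 a ∘ₗ scale 𝒜 b = scale 𝒜 b ∘ₗ scale 𝒜 a := by
  rw [← scale_mul, mul_comm, scale_mul]

theorem scale_one : scale 𝒜 1 = LinearMap.id :=
  hom_ext_homogeneous 𝒜 fun d x hx => by simp [scale_of_mem 𝒜 _ hx]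

/-- The eigenvalues `2 ^ (d - 1)` are pairwise distinct, so scaling by two alone detects the degree.
-/
theorem mem_of_scale_two {d : ℤ} {x : A}
    (h : scale 𝒜 (Units.mk0 2 two_ne_zero) x = ((2 : ℂ) ^ (d - 1)) • x) : x ∈ 𝒜 d := by
  classical
  have h1 : ∀ y : A, ∀ i, (DirectSum.decompose 𝒜 (scale 𝒜 (Units.mk0 2 two_ne_zero) y) i : A) =
      ((2 : ℂ) ^ (i - 1)) • (DirectSum.decompose 𝒜 y i : A) := by
    intro y i
    induction y using DirectSum.Decomposition.inductionOn 𝒜 with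
    | zero => simp
    | add y z hy hz =>
      rw [map_add, DirectSum.decompose_add, DirectSum.decompose_add, DirectSum.add_apply,
        DirectSum.add_apply, Submodule.coe_add, Submodule.coe_add, hy, hz, smul_add]
    | homogeneous y =>
      rename_i j
      rw [scale_of_mem 𝒜 _ y.2, DirectSum.decompose_smul]
      by_cases hij : j = i
      · subst hij
        rw [DirectSum.smul_apply, Submodule.coe_smul, DirectSum.decompose_coe, DirectSum.of_eq_same]
        simp
      · have := DirectSum.decompose_of_mem_ne 𝒜 y.2 hij
        rw [DirectSum.smul_apply, Submodule.coe_smul, this, smul_zero, smul_zero]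
  have h2 : ∀ i, i ≠ d → (DirectSum.decompose 𝒜 x i : A) = 0 := by
    intro i hi
    have h3 := h1 x i
    rw [h, DirectSum.decompose_smul, DirectSum.smul_apply, Submodule.coe_smul, ← sub_eq_zero,
      ← sub_smul, smul_eq_zero, sub_eq_zero] at h3
    refine h3.resolve_left fun h4 => hi ?_
    -- Taking norms turns this into an equality of powers of the real number two, hence of
    -- exponents.
    have h6 := congr_arg norm h4
    simpa using h6.symm
  rw [← DirectSum.sum_support_decompose 𝒜 x]
  refine Submodule.sum_mem _ fun i _ => ?_
  by_cases hi : i = d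
  · subst hi; exact Subtype.property _
  · rw [h2 i hi]; exact zero_mem _

theorem span_homogeneous : Submodule.span ℂ {x | ∃ d, x ∈ 𝒜 d} = ⊤ := by
  rw [eq_top_iff]
  rintro x -
  induction x using DirectSum.Decomposition.inductionOn 𝒜 with
  | zero => exact zero_mem _
  | add y z hy hz => exact add_mem hy hz
  | homogeneous y => exact Submodule.subset_span ⟨_, y.2⟩

variable {G : AddSubmonoid ℝ≥0}

/-- With the converse `hasDegree_of_scale`, being homogeneous becomes a commutation relation, and
such relations are inherited by solutions of linear differential equations. -/
theorem scale_apply_of_hasDegree {e : ℤ} {k : ℕ} {f : MultilinearMap ℂ (fun _ : Fin k => A) B}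
    (h : HasDegree 𝒜 ℬ e f) (a : ℂˣ) (x : Fin k → A) :
    scale ℬ a (f x) = ((a ^ e : ℂˣ) : ℂ) • f fun i => scale 𝒜 a (x i) := by
  have key : (scale ℬ a).compMultilinearMap f =
      ((a ^ e : ℂˣ) : ℂ) • f.compLinearMap fun _ => scale 𝒜 a := by
    refine multilinear_ext_of_span (span_homogeneous 𝒜) fun x hx => ?_
    choose d hd using hx
    simp only [LinearMap.compMultilinearMap_apply, _root_.smul_apply,
      MultilinearMap.compLinearMap_apply, fun i => scale_of_mem 𝒜 a (hd i),
      MultilinearMap.map_smul_univ, scale_of_mem ℬ a (h d x hd), smul_smul]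
    congr 1
    rw [← Units.coe_prod, ← Units.val_mul, add_sub_cancel_right, zpow_add, mul_comm]
    congr 2
    exact map_sum (zmultiplesHom (Additive ℂˣ) (Additive.ofMul a)) (fun i => d i - 1) Finset.univ
  exact DFunLike.congr_fun key x

theorem hasDegree_of_scale {e : ℤ} {k : ℕ} {f : MultilinearMap ℂ (fun _ : Fin k => A) B}
    (h : ∀ x, scale ℬ (Units.mk0 2 two_ne_zero) (f x) =
      ((2 : ℂ) ^ e) • f fun i => scale 𝒜 (Units.mk0 2 two_ne_zero) (x i)) :
    HasDegree 𝒜 ℬ e f := by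
  intro d x hd
  refine mem_of_scale_two ℬ ?_
  rw [h]
  simp only [fun i => scale_of_mem 𝒜 (Units.mk0 2 two_ne_zero) (hd i),
    MultilinearMap.map_smul_univ, smul_smul]
  congr 1
  rw [← Units.coe_prod, add_sub_cancel_right, zpow_add₀ two_ne_zero, mul_comm]
  congr 1
  have := map_sum (zmultiplesHom (Additive ℂˣ) (Additive.ofMul (Units.mk0 (2 : ℂ) two_ne_zero)))
    (fun i => d i - 1) Finset.univ
  have h2 := congr_arg (fun z : Additive ℂˣ => ((Additive.toMul z : ℂˣ) : ℂ)) this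
  simp only [zmultiplesHom_apply, toMul_zsmul, toMul_sum, toMul_ofMul] at h2
  rw [← h2]; simp

namespace Bar

theorem scale_comp_toLin {e : ℤ} {F : Fam G A B} (h : ∀ k β, HasDegree 𝒜 ℬ e (F k β)) (a : ℂˣ) :
    scale ℬ a ∘ₗ toLin F = (((a ^ e : ℂˣ) : ℂ) • toLin F) ∘ₗ map (scale 𝒜 a) :=
  hom_ext_word fun n x β => by
    simp only [LinearMap.comp_apply, LinearMap.smul_apply, map_word, toLin_word]
    exact scale_apply_of_hasDegree 𝒜 ℬ (h n β) a _

theorem hasDegree_toFam {e : ℤ} {Y : Bar G A →ₗ[ℂ] B}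
    (h : scale ℬ (Units.mk0 2 two_ne_zero) ∘ₗ Y =
      (((2 : ℂ) ^ e) • Y) ∘ₗ map (scale 𝒜 (Units.mk0 2 two_ne_zero))) (k : ℕ) (β : G) :
    HasDegree 𝒜 ℬ e (toFam Y k β) := by
  refine hasDegree_of_scale 𝒜 ℬ fun x => ?_
  obtain ⟨y, rfl⟩ := exists_extension x
  have := LinearMap.congr_fun h (word k y β)
  simp only [LinearMap.comp_apply, LinearMap.smul_apply, map_word] at this
  rw [toFam_apply, this, ← toFam_apply]

theorem map_scale_comp_ins [HasAntidiagonal G] {e : ℤ} {F : Fam G A A}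
    (h : ∀ k β, HasDegree 𝒜 𝒜 e (F k β)) (a b : ℂˣ) :
    map (scale 𝒜 a) ∘ₗ ins (scale 𝒜 b) LinearMap.id (toLin F) =
      ((a ^ e : ℂˣ) : ℂ) • ins (scale 𝒜 b) LinearMap.id (toLin F) ∘ₗ map (scale 𝒜 a) := by
  rw [map_ins _ _ _ (scale 𝒜 a) (scale 𝒜 a) (scale_comm 𝒜 a b)
      ((LinearMap.comp_id _).trans (LinearMap.id_comp _).symm) (scale_comp_toLin 𝒜 𝒜 h a),
    ins_smul, LinearMap.smul_comp]

end Bar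
end Scaling

/-! ### A∞ homomorphisms from morphisms of differential coalgebras -/

section Homomorphisms

variable {G : AddSubmonoid ℝ≥0} {A B C : Type*} [AddCommGroup A] [Module ℂ A]
  [AddCommGroup B] [Module ℂ B] [AddCommGroup C] [Module ℂ C]

/-- The family with a linear map as its only component. -/
def ofLin (G : AddSubmonoid ℝ≥0) (φ : A →ₗ[ℂ] B) : Fam G A B := Bar.toFam (φ ∘ₗ Bar.proj)

theorem proj_word_of_ne {n : ℕ} (h : n ≠ 1) (x : ℕ → A) (β : G) :
    Bar.proj (Bar.word n x β) = 0 := by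
  match n, h with
  | 0, _ => simp
  | n + 2, _ => simp [Bar.word_succ]

theorem proj_word_one (x : ℕ → A) (β : G) :
    Bar.proj (Bar.word 1 x β) = (if β = 0 then (1 : ℂ) else 0) • x 0 := by
  simp [Bar.word_succ, Finsupp.single_apply]

theorem ofLin_of_ne (φ : A →ₗ[ℂ] B) {k : ℕ} (h : k ≠ 1) (β : G) : ofLin G φ k β = 0 := by
  ext x
  obtain ⟨y, rfl⟩ := exists_extension x
  rw [ofLin, Bar.toFam_apply, LinearMap.comp_apply, proj_word_of_ne h, map_zero]; rfl

theorem lin_apply (F : Fam G A B) (x : A) : F.lin x = F 1 0 fun _ => x := rfl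

theorem lin_ofLin (φ : A →ₗ[ℂ] B) : (ofLin G φ).lin = φ := by
  ext x
  rw [lin_apply]
  refine (Bar.toFam_apply (φ ∘ₗ Bar.proj) 1 0 fun _ => x).trans ?_
  rw [LinearMap.comp_apply, proj_word_one]; simp

theorem ofLin_id : ofLin G (LinearMap.id : A →ₗ[ℂ] A) = Fam.id G A := by
  funext k β
  ext x
  obtain ⟨y, rfl⟩ := exists_extension x
  rw [ofLin, Bar.toFam_apply, LinearMap.comp_apply, Fam.id]
  by_cases hk : k = 1
  · subst hk
    rw [proj_word_one]
    by_cases hβ : β = 0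
    · subst hβ; simp
    · simp [hβ]
  · rw [proj_word_of_ne hk]; simp [hk]

theorem toLin_ofLin (φ : A →ₗ[ℂ] B) : Bar.toLin (ofLin G φ) = φ ∘ₗ Bar.proj := by simp [ofLin]

theorem ofLin_eq (φ : A →ₗ[ℂ] B) : ofLin G φ = Bar.toFam (Bar.proj ∘ₗ Bar.map φ) := by
  rw [Bar.proj_map, ofLin]

variable [HasAntidiagonal G]

theorem Bar.IsCoalgMap.comp_eq {f : Bar G A →ₗ[ℂ] Bar G B} (hf : Bar.IsCoalgMap f)
    (hf0 : Bar.proj (f (Bar.e 0)) = 0) (F : Fam G B C) :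
    F.comp (Bar.toFam (Bar.proj ∘ₗ f)) = Bar.toFam (Bar.toLin F ∘ₗ f) := by
  funext N β
  ext x
  obtain ⟨y, rfl⟩ := exists_extension x
  rw [Bar.toFam_apply, LinearMap.comp_apply, hf.toLin_word (E := Bar.toFam (Bar.proj ∘ₗ f))]
  · intro c; simp
  · ext x
    obtain ⟨y, rfl⟩ := exists_extension x
    rw [Bar.toFam_apply]; simpa using hf0

variable (𝒜 : ℤ → Submodule ℂ A) [DirectSum.Decomposition 𝒜]
variable (ℬ : ℤ → Submodule ℂ B) [DirectSum.Decomposition ℬ]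

/-- The coderivation of odd degree given by a family. -/
def oddCoder (m : Fam G A A) : Bar G A →ₗ[ℂ] Bar G A :=
  Bar.ins (koszul 𝒜) LinearMap.id (Bar.toLin m)

/-- The coderivation of even degree given by a family. -/
def evenCoder (h : Fam G A A) : Bar G A →ₗ[ℂ] Bar G A :=
  Bar.ins LinearMap.id LinearMap.id (Bar.toLin h)

/-- Projecting `h` to length one gives the defining equation: on one side `comp_eq` recognises the
composition of families, on the other `toLin_ins_word` recognises the insertions. -/
theorem Bar.IsCoalgMap.isAInfHom {f : Bar G A →ₗ[ℂ] Bar G B} (hf : Bar.IsCoalgMap f)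
    (hf0 : Bar.proj (f (Bar.e 0)) = 0)
    (hd : Bar.map (scale ℬ (Units.mk0 2 two_ne_zero)) ∘ₗ f =
      f ∘ₗ Bar.map (scale 𝒜 (Units.mk0 2 two_ne_zero)))
    {mA : Fam G A A} {mB : Fam G B B} (h : oddCoder ℬ mB ∘ₗ f = f ∘ₗ oddCoder 𝒜 mA) :
    IsAInfHom 𝒜 mA ℬ mB (Bar.toFam (Bar.proj ∘ₗ f)) where
  degree := Bar.hasDegree_toFam 𝒜 ℬ (by
    rw [← LinearMap.comp_assoc, ← Bar.proj_map, LinearMap.comp_assoc, hd, zpow_zero, one_smul,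
      LinearMap.comp_assoc])
  gapped := by
    ext x
    obtain ⟨y, rfl⟩ := exists_extension x
    rw [Bar.toFam_apply]; simpa using hf0
  equation N β x := by
    rw [hf.comp_eq hf0, Bar.toFam_apply, ← Bar.toLin_ins_word, Bar.toLin_toFam,
      LinearMap.comp_apply, LinearMap.comp_apply, ← Bar.proj_ins (koszul ℬ) LinearMap.id]
    exact congr_arg Bar.proj (LinearMap.congr_fun h (Bar.word N x β))

/-- The linear map `φ` induces the coalgebra map `Bar.map φ`, and naturality of `ins` extends the
compatibility from the structure maps to the full differentials. -/
theorem isAInfHom_ofLin {φ : A →ₗ[ℂ] B} (hφ : ∀ d, ∀ x ∈ 𝒜 d, φ x ∈ ℬ d)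
    {mA : Fam G A A} {mB : Fam G B B}
    (h : Bar.toLin mB ∘ₗ Bar.map φ = φ ∘ₗ Bar.toLin mA) :
    IsAInfHom 𝒜 mA ℬ mB (ofLin G φ) := by
  have hs : ∀ a, scale ℬ a ∘ₗ φ = φ ∘ₗ scale 𝒜 a := fun a =>
    hom_ext_homogeneous 𝒜 fun d x hx => by
      rw [LinearMap.comp_apply, LinearMap.comp_apply, scale_of_mem 𝒜 a hx,
        scale_of_mem ℬ a (hφ d x hx), map_smul]
  rw [ofLin_eq]
  refine (Bar.isCoalgMap_map φ).isAInfHom 𝒜 ℬ (by simp) ?_ ?_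
  · rw [← Bar.map_comp, ← Bar.map_comp, hs]
  · rw [oddCoder, oddCoder, koszul_eq_scale, koszul_eq_scale]
    exact (Bar.map_ins _ _ _ φ φ (hs _).symm rfl h.symm).symm

theorem oddCoder_apply_word (m : Fam G A A) (F : Fam G A B) (N : ℕ) (x : ℕ → A) (β : G) :
    Bar.toLin F (oddCoder 𝒜 m (Bar.word N x β)) = insertion (koszul 𝒜) F m N β x :=
  Bar.toLin_ins_word _ _ _ _ _ _

theorem evenCoder_apply_word (m : Fam G A A) (F : Fam G A B) (N : ℕ) (x : ℕ → A) (β : G) :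
    Bar.toLin F (evenCoder m (Bar.word N x β)) = insertion LinearMap.id F m N β x :=
  Bar.toLin_ins_word _ _ _ _ _ _

end Homomorphisms

/-! ### Smooth calculus with values in vector spaces without topology -/

section Functions

open MeasureTheory

variable {P P' : Type*} {E F : Type*} [AddCommGroup E] [Module ℂ E] [AddCommGroup F] [Module ℂ F]

/-- The finite sums of functions in `𝒞` times vectors in `E`. -/
def finSums (𝒞 : Subalgebra ℂ (P → ℂ)) (E : Type*) [AddCommGroup E] [Module ℂ E] :
    Submodule ℂ (P → E) :=
  Submodule.span ℂ {f | ∃ c ∈ 𝒞, ∃ w, f = fun p => c p • w}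

section FinSums

variable {𝒞 : Subalgebra ℂ (P → ℂ)}

theorem smul_const_mem_finSums {c : P → ℂ} (hc : c ∈ 𝒞) (w : E) :
    (fun p => c p • w) ∈ finSums 𝒞 E := Submodule.subset_span ⟨c, hc, w, rfl⟩

theorem const_mem_finSums (w : E) : (fun _ => w) ∈ finSums 𝒞 E := by
  simpa using smul_const_mem_finSums (one_mem 𝒞) w

theorem smul_mem_finSums {c : P → ℂ} (hc : c ∈ 𝒞) {f : P → E} (hf : f ∈ finSums 𝒞 E) :
    (fun p => c p • f p) ∈ finSums 𝒞 E := by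
  induction hf using Submodule.span_induction with
  | mem f hf =>
    obtain ⟨d, hd, w, rfl⟩ := hf
    simpa [smul_smul] using smul_const_mem_finSums (mul_mem hc hd) w
  | zero => simpa using (const_mem_finSums 0 : _ ∈ finSums 𝒞 E)
  | add f g _ _ hf hg =>
    have := add_mem hf hg
    convert this using 1
    ext p; simp
  | smul a f _ hf =>
    have := Submodule.smul_mem _ a hf
    convert this using 1
    ext p; exact smul_comm _ _ _

theorem apply_mem_finSums {X : P → E →ₗ[ℂ] F} (hX : ∀ w, (fun p => X p w) ∈ finSums 𝒞 F)
    {f : P → E} (hf : f ∈ finSums 𝒞 E) : (fun p => X p (f p)) ∈ finSums 𝒞 F := by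
  induction hf using Submodule.span_induction with
  | mem f hf =>
    obtain ⟨c, hc, w, rfl⟩ := hf
    simpa using smul_mem_finSums hc (hX w)
  | zero => simpa using (const_mem_finSums 0 : _ ∈ finSums 𝒞 F)
  | add f g _ _ hf hg =>
    have := add_mem hf hg
    convert this using 1
    ext p; simp
  | smul a f _ hf =>
    have := Submodule.smul_mem _ a hf
    convert this using 1
    ext p; simp

theorem map_mem_finSums (φ : E →ₗ[ℂ] F) {f : P → E} (hf : f ∈ finSums 𝒞 E) :
    (fun p => φ (f p)) ∈ finSums 𝒞 F :=
  apply_mem_finSums (fun w => const_mem_finSums (φ w)) hf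

theorem multilinear_mem_finSums {k : ℕ} {M : P → MultilinearMap ℂ (fun _ : Fin k => E) F}
    (hM : ∀ x, (fun p => M p x) ∈ finSums 𝒞 F) {f : Fin k → P → E}
    (hf : ∀ i, f i ∈ finSums 𝒞 E) : (fun p => M p fun i => f i p) ∈ finSums 𝒞 F := by
  induction k with
  | zero =>
    convert hM Fin.elim0 using 3
  | succ k ih =>
    have := ih (M := fun p => (M p).curryLeft (f 0 p)) (fun x => ?_) fun i => hf i.succ
    · convert this using 2 with p
      rw [MultilinearMap.curryLeft_apply]
      congr 1
      ext i
      refine Fin.cases ?_ (fun i => ?_) i <;> simp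
    · refine apply_mem_finSums (X := fun p =>
        { toFun := fun a => (M p).curryLeft a x, map_add' := by simp, map_smul' := by simp })
        (fun w => ?_) (hf 0)
      exact hM (Fin.cons w x)

theorem comp_mem_finSums {𝒞' : Subalgebra ℂ (P' → ℂ)} {ψ : P' → P} (hψ : ∀ c ∈ 𝒞, c ∘ ψ ∈ 𝒞')
    {f : P → E} (hf : f ∈ finSums 𝒞 E) : f ∘ ψ ∈ finSums 𝒞' E := by
  induction hf using Submodule.span_induction with
  | mem f hf =>
    obtain ⟨c, hc, w, rfl⟩ := hf
    exact smul_const_mem_finSums (hψ c hc) w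
  | zero => exact zero_mem (finSums 𝒞' E)
  | add f g _ _ hf hg => exact add_mem hf hg
  | smul a f _ hf => exact Submodule.smul_mem _ a hf

theorem dual_mem_of_mem_finSums {f : P → E} (hf : f ∈ finSums 𝒞 E) (l : Module.Dual ℂ E) :
    (fun p => l (f p)) ∈ 𝒞 := by
  induction hf using Submodule.span_induction with
  | mem f hf =>
    obtain ⟨c, hc, w, rfl⟩ := hf
    have := 𝒞.smul_mem hc (l w)
    convert this using 1
    ext p; simp [mul_comm]
  | zero => simp only [Pi.zero_apply, map_zero]; exact zero_mem 𝒞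
  | add f g _ _ hf hg =>
    have := add_mem hf hg
    convert this using 1
    ext p; simp
  | smul a f _ hf =>
    have := 𝒞.smul_mem hf a
    convert this using 1
    ext p; simp

/-- A property of finite sums that holds for all products of functions and vectors. -/
theorem exists_finite_of_mem_finSums {f : P → E} (hf : f ∈ finSums 𝒞 E) :
    ∃ S : Finset E, ∀ p, f p ∈ Submodule.span ℂ (S : Set E) := by
  classical
  induction hf using Submodule.span_induction with
  | mem f hf =>
    obtain ⟨c, hc, w, rfl⟩ := hf
    exact ⟨{w}, fun p => Submodule.smul_mem _ _ (Submodule.subset_span (by simp))⟩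
  | zero => exact ⟨∅, fun p => zero_mem _⟩
  | add f g _ _ hf hg =>
    obtain ⟨S, hS⟩ := hf
    obtain ⟨T, hT⟩ := hg
    exact ⟨S ∪ T, fun p => add_mem (Submodule.span_mono (by simp) (hS p))
      (Submodule.span_mono (by simp) (hT p))⟩
  | smul a f _ hf =>
    obtain ⟨S, hS⟩ := hf
    exact ⟨S, fun p => Submodule.smul_mem _ _ (hS p)⟩

end FinSums

theorem eq_of_forall_dual {x y : E} (h : ∀ l : Module.Dual ℂ E, l x = l y) : x = y := by
  rw [← sub_eq_zero, ← Module.forall_dual_apply_eq_zero_iff ℂ]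
  intro l
  rw [map_sub, h, sub_self]

variable [NormedAddCommGroup P] [NormedSpace ℝ P] [NormedAddCommGroup P'] [NormedSpace ℝ P']

/-- The algebra of smooth functions. -/
def smoothFun (P : Type*) [NormedAddCommGroup P] [NormedSpace ℝ P] : Subalgebra ℂ (P → ℂ) where
  carrier := {c | ContDiff ℝ ∞ c}
  mul_mem' {c d} (hc : ContDiff ℝ ∞ c) (hd : ContDiff ℝ ∞ d) := show ContDiff ℝ ∞ _ from hc.mul hd
  add_mem' {c d} (hc : ContDiff ℝ ∞ c) (hd : ContDiff ℝ ∞ d) := show ContDiff ℝ ∞ _ from hc.add hd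
  algebraMap_mem' a := show ContDiff ℝ ∞ fun _ => a from contDiff_const

theorem mem_smoothFun {c : P → ℂ} : c ∈ smoothFun P ↔ ContDiff ℝ ∞ c := Iff.rfl

/-- The smooth functions with values in finite dimensional subspaces of `E`. -/
abbrev Sm (P : Type*) [NormedAddCommGroup P] [NormedSpace ℝ P] (E : Type*) [AddCommGroup E]
    [Module ℂ E] : Submodule ℂ (P → E) := finSums (smoothFun P) E

/-- The function `f` is smooth with directional derivative `f'` along `v`. -/
structure HasD (v : P) (f f' : P → E) : Prop where
  mem : f ∈ Sm P E
  mem' : f' ∈ Sm P E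
  deriv : ∀ (l : Module.Dual ℂ E) p, HasLineDerivAt ℝ (fun q => l (f q)) (l (f' p)) p v

namespace HasD

variable {v w : P} {f f' g g' : P → E}

theorem congr_deriv (hf : HasD v f f') (h : f' = g') : HasD v f g' := h ▸ hf

theorem unique (hf : HasD v f f') (hg : HasD v f g') : f' = g' := by
  ext p
  exact eq_of_forall_dual fun l => (hf.deriv l p).unique (hg.deriv l p)

theorem const (v : P) (w : E) : HasD v (fun _ => w) (fun _ => 0) where
  mem := const_mem_finSums w
  mem' := const_mem_finSums 0
  deriv l p := by
    rw [map_zero]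
    exact hasDerivAt_const _ _

theorem congr (hf : HasD v f f') (h : f = g) : HasD v g f' := h ▸ hf

theorem zero (v : P) : HasD v (0 : P → E) 0 := const v 0

theorem add (hf : HasD v f f') (hg : HasD v g g') : HasD v (f + g) (f' + g') where
  mem := add_mem hf.mem hg.mem
  mem' := add_mem hf.mem' hg.mem'
  deriv l p := by
    simp only [Pi.add_apply, map_add]
    exact HasDerivAt.add (hf.deriv l p) (hg.deriv l p)

theorem const_smul (a : ℂ) (hf : HasD v f f') : HasD v (a • f) (a • f') where
  mem := Submodule.smul_mem _ _ hf.mem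
  mem' := Submodule.smul_mem _ _ hf.mem'
  deriv l p := by
    simp only [Pi.smul_apply, map_smul]
    exact HasDerivAt.const_smul a (hf.deriv l p)

theorem neg (hf : HasD v f f') : HasD v (-f) (-f') := by
  simpa using hf.const_smul (-1)

theorem sub (hf : HasD v f f') (hg : HasD v g g') : HasD v (f - g) (f' - g') := by
  rw [sub_eq_add_neg, sub_eq_add_neg]; exact hf.add hg.neg

theorem map (φ : E →ₗ[ℂ] F) (hf : HasD v f f') :
    HasD v (fun p => φ (f p)) (fun p => φ (f' p)) where
  mem := map_mem_finSums φ hf.mem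
  mem' := map_mem_finSums φ hf.mem'
  deriv l p := hf.deriv (l ∘ₗ φ) p

theorem smul {c c' : P → ℂ} (hc : HasD v c c') (hf : HasD v f f') :
    HasD v (fun p => c p • f p) (fun p => c' p • f p + c p • f' p) where
  mem := smul_mem_finSums (dual_mem_of_mem_finSums hc.mem LinearMap.id) hf.mem
  mem' := add_mem (smul_mem_finSums (dual_mem_of_mem_finSums hc.mem' LinearMap.id) hf.mem)
    (smul_mem_finSums (dual_mem_of_mem_finSums hc.mem LinearMap.id) hf.mem')
  deriv l p := by
    simp only [map_add, map_smul]
    have := HasDerivAt.mul (hc.deriv LinearMap.id p) (hf.deriv l p)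
    simp only [zero_smul, add_zero, LinearMap.id_apply] at this
    exact this

theorem of_contDiff {c : P → ℂ} (hc : ContDiff ℝ ∞ c) (v : P) :
    HasD v c fun p => fderiv ℝ c p v := by
  have key : ∀ d : P → ℂ, ContDiff ℝ ∞ d → d ∈ Sm P ℂ := fun d hd => by
    simpa using smul_const_mem_finSums (mem_smoothFun.2 hd) (1 : ℂ)
  have h' : ContDiff ℝ ∞ fun p => fderiv ℝ c p v :=
    (hc.fderiv_right (m := ∞) (by simp)).clm_apply contDiff_const
  refine ⟨key c hc, key _ h', fun l p => ?_⟩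
  have hl : ∀ a, l a = a * l 1 := fun a => by
    rw [← smul_eq_mul a (l 1), ← map_smul, smul_eq_mul, mul_one]
  simp only [hl (c _), hl (fderiv ℝ c p v)]
  exact HasDerivAt.mul_const
    ((hc.differentiable (by simp) p).hasFDerivAt.hasLineDerivAt v) (l 1)

theorem exists_of_mem (v : P) (hf : f ∈ Sm P E) : ∃ f', HasD v f f' := by
  induction hf using Submodule.span_induction with
  | mem f hf =>
    obtain ⟨c, hc, w, rfl⟩ := hf
    exact ⟨_, (of_contDiff hc v).smul (const v w)⟩
  | zero => exact ⟨0, zero v⟩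
  | add f g _ _ hf hg => exact ⟨_, hf.choose_spec.add hg.choose_spec⟩
  | smul a f _ hf => exact ⟨_, hf.choose_spec.const_smul a⟩

/-- The operators are only known to be differentiable on each fixed vector. Since `f` is a finite
sum of terms `c • w`, the product rule reduces to scalar functions and no uniformity in `X` is
needed. -/
theorem apply {X X' : P → E →ₗ[ℂ] F} (hX : ∀ w, HasD v (fun p => X p w) (fun p => X' p w))
    (hf : HasD v f f') :
    HasD v (fun p => X p (f p)) (fun p => X' p (f p) + X p (f' p)) := by
  -- Derivatives are unique, so `f'` may be replaced by the derivative built along a decomposition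
  -- of `f`.
  suffices h : ∀ f ∈ Sm P E, ∃ f', HasD v f f' ∧
      HasD v (fun p => X p (f p)) (fun p => X' p (f p) + X p (f' p)) by
    obtain ⟨g', hg, hg'⟩ := h f hf.mem
    rwa [hf.unique hg]
  intro f hf
  induction hf using Submodule.span_induction with
  | mem f hf =>
    obtain ⟨c, hc, w, rfl⟩ := hf
    refine ⟨_, (of_contDiff hc v).smul (const v w), ?_⟩
    have := (of_contDiff hc v).smul (hX w)
    simp only [map_add, map_smul]
    refine this.congr_deriv (funext fun p => ?_)
    simp only [map_zero, smul_zero, add_zero]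
    rw [add_comm]
  | zero => exact ⟨0, zero v, by simpa using const v (0 : F)⟩
  | add f g _ _ hf hg =>
    obtain ⟨f', hf, hXf⟩ := hf
    obtain ⟨g', hg, hXg⟩ := hg
    refine ⟨_, hf.add hg, ?_⟩
    convert hXf.add hXg using 1
    · ext p; simp
    · ext p; simp only [Pi.add_apply, map_add]; abel
  | smul a f _ hf =>
    obtain ⟨f', hf, hXf⟩ := hf
    refine ⟨_, hf.const_smul a, ?_⟩
    convert hXf.const_smul a using 1
    · ext p; simp
    · ext p; simp

theorem tmul {f f' : P → E} {g g' : P → F} (hf : HasD v f f') (hg : HasD v g g') :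
    HasD v (fun p => f p ⊗ₜ[ℂ] g p) (fun p => f' p ⊗ₜ[ℂ] g p + f p ⊗ₜ[ℂ] g' p) :=
  apply (X := fun p => TensorProduct.mk ℂ E F (f p)) (X' := fun p => TensorProduct.mk ℂ E F (f' p))
    (fun w => hf.map ((TensorProduct.mk ℂ E F).flip w)) hg

/-- After applying a functional both sides are mixed second derivatives of one smooth scalar
function. -/
theorem symm {a b : P → E} (hf : HasD v f f') (hg : HasD w f g') (ha : HasD w f' a)
    (hb : HasD v g' b) : a = b := by
  ext p
  refine eq_of_forall_dual fun l => ?_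
  set c : P → ℂ := fun q => l (f q)
  have hc : ContDiff ℝ ∞ c := dual_mem_of_mem_finSums hf.mem l
  have hc' : Differentiable ℝ (fderiv ℝ c) :=
    (hc.fderiv_right (m := ∞) (by simp)).differentiable (by simp)
  have key : ∀ {v w : P} {f' a : P → E}, HasD v f f' → HasD w f' a →
      l (a p) = fderiv ℝ (fderiv ℝ c) p w v := by
    intro v w f' a h1 h2
    have h3 : (fun q => l (f' q)) = fun q => fderiv ℝ c q v := by
      ext q
      exact (h1.deriv l q).unique
        ((hc.differentiable (by simp) q).hasFDerivAt.hasLineDerivAt v)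
    have h4 := h2.deriv l p
    rw [h3] at h4
    have h5 := (((hc' p).hasFDerivAt).clm_apply (hasFDerivAt_const v p)).hasLineDerivAt w
    rw [h4.unique h5]
    simp
  rw [key hf ha, key hg hb]
  exact (hc.contDiffAt.isSymmSndFDerivAt (by
    simpa using (by exact_mod_cast le_top : ((2 : ℕ∞) : WithTop ℕ∞) ≤ ∞))) w v

theorem comp {v' : P'} {ψ : P' → P} (hψ : ContDiff ℝ ∞ ψ)
    (hv : ∀ p (t : ℝ), ψ (p + t • v') = ψ p + t • v) (hf : HasD v f f') :
    HasD v' (fun p => f (ψ p)) (fun p => f' (ψ p)) where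
  mem := comp_mem_finSums (fun _ hc => ContDiff.comp hc hψ) hf.mem
  mem' := comp_mem_finSums (fun _ hc => ContDiff.comp hc hψ) hf.mem'
  deriv l p := by
    have := hf.deriv l (ψ p)
    simp only [HasLineDerivAt, hv] at this ⊢
    exact this

end HasD

theorem smooth_cutoff {x : ℝ} (h : x ∈ Set.Icc (-1 : ℝ) 1) :
    Real.smoothTransition (2 - x ^ 2) = 1 :=
  Real.smoothTransition.one_of_one_le (by nlinarith [h.1, h.2])

/-- The integral is the value at 0 of the convolution of the indicator of [0,1] with a compactly
supported function, and convolutions depend smoothly on parameters. -/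
theorem contDiff_integral_segment {c : ℝ × ℝ → ℂ} (hc : ContDiff ℝ ∞ c) :
    ContDiff ℝ ∞ fun p : ℝ × ℝ => ∫ t in (0 : ℝ)..1, c (p.1 * t, p.2) := by
  set f : ℝ → ℝ := (Set.Icc 0 1).indicator 1
  -- The convolution at 0 evaluates `g p` at `-t`, which explains the sign. The cutoff is 1 for |x|
  -- ≤ 1 and 0 as soon as x² ≥ 2.
  set g : ℝ × ℝ → ℝ → ℂ := fun p x => Real.smoothTransition (2 - x ^ 2) • c (p.1 * -x, p.2)
  have hf : LocallyIntegrable f := by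
    refine Integrable.locallyIntegrable ((integrable_indicator_iff measurableSet_Icc).2 ?_)
    exact integrableOn_const (μ := volume) (C := (1 : ℝ)) (by simp) (by simp)
  have hg : ContDiff ℝ ∞ (Function.uncurry g) := by
    have h1 : ContDiff ℝ ∞ fun q : (ℝ × ℝ) × ℝ => Real.smoothTransition (2 - q.2 ^ 2) :=
      Real.smoothTransition.contDiff.comp (contDiff_const.sub (contDiff_snd.pow 2))
    have h2 : ContDiff ℝ ∞ fun q : (ℝ × ℝ) × ℝ => c (q.1.1 * -q.2, q.1.2) :=
      hc.comp (((contDiff_fst.comp contDiff_fst).mul contDiff_snd.neg).prodMk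
        (contDiff_snd.comp contDiff_fst))
    exact h1.smul h2
  have := contDiffOn_convolution_right_with_param (μ := volume) (f := f) (g := g) (s := Set.univ)
    (k := Set.Icc (-2) 2) (n := ⊤) (ContinuousLinearMap.lsmul ℝ ℝ) isOpen_univ isCompact_Icc
    (fun p x _ hx => by
      have : Real.smoothTransition (2 - x ^ 2) = 0 :=
        Real.smoothTransition.zero_of_nonpos (by
          rw [Set.mem_Icc, not_and_or] at hx
          rcases hx with hx | hx <;> nlinarith)
      simp [g, this]) hf hg.contDiffOn
  rw [Set.univ_prod_univ, contDiffOn_univ] at this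
  convert this.comp (contDiff_id.prodMk contDiff_const : ContDiff ℝ ∞ fun p : ℝ × ℝ => (p, (0 : ℝ)))
    using 1
  ext p
  simp only [Function.comp_apply, MeasureTheory.convolution, f, g]
  rw [intervalIntegral.integral_of_le zero_le_one, ← integral_Icc_eq_integral_Ioc,
    ← integral_indicator measurableSet_Icc]
  congr 1
  ext t
  by_cases ht : t ∈ Set.Icc (0 : ℝ) 1
  · have : -t ∈ Set.Icc (-1 : ℝ) 1 := ⟨by linarith [ht.2], by linarith [ht.1]⟩
    simp only [Set.indicator_of_mem ht, zero_sub, smooth_cutoff this]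
    simp
  · simp [Set.indicator_of_notMem ht]

theorem exists_smooth_antiderivative {c : ℝ × ℝ → ℂ} (hc : ContDiff ℝ ∞ c) :
    ∃ C : ℝ × ℝ → ℂ, ContDiff ℝ ∞ C ∧ (∀ p, HasLineDerivAt ℝ C (c p) p (1, 0)) ∧
      ∀ s, C (0, s) = 0 := by
  -- The integral of `c` from 0 to `p.1` is rescaled to a fixed interval, which makes its joint
  -- smoothness visible.
  refine ⟨fun p => (p.1 : ℂ) * ∫ t in (0 : ℝ)..1, c (p.1 * t, p.2), ?_, ?_, by simp⟩
  · exact (Complex.ofRealCLM.contDiff.comp contDiff_fst).mul (contDiff_integral_segment hc)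
  · rintro ⟨t, s⟩
    have h1 : ∀ x : ℝ, (x : ℂ) * ∫ y in (0 : ℝ)..1, c (x * y, s) = ∫ y in (0 : ℝ)..x, c (y, s) := by
      intro x
      have := intervalIntegral.smul_integral_comp_mul_left (a := 0) (b := 1) (fun y => c (y, s)) x
      simpa using this
    have h2 : Continuous fun y => c (y, s) := hc.continuous.comp (by fun_prop)
    have h3 := (intervalIntegral.integral_hasDerivAt_right (h2.intervalIntegrable 0 (t + 0 * 1))
      h2.stronglyMeasurable.stronglyMeasurableAtFilter h2.continuousAt)
    have h4 : HasDerivAt (fun x : ℝ => t + x * 1) 1 0 := by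
      simpa using (hasDerivAt_id (0 : ℝ)).const_add t
    have h5 := h3.scomp (0 : ℝ) h4
    simp only [HasLineDerivAt, Prod.smul_mk, Prod.mk_add_mk, smul_eq_mul, mul_zero, add_zero,
      h1]
    simp only [mul_one, one_smul, add_zero] at h5 ⊢
    exact h5

theorem exists_antiderivative {f : ℝ × ℝ → E} (hf : f ∈ Sm (ℝ × ℝ) E) :
    ∃ g, HasD (1, 0) g f ∧ ∀ s, g (0, s) = 0 := by
  induction hf using Submodule.span_induction with
  | mem f hf =>
    obtain ⟨c, hc, w, rfl⟩ := hf
    obtain ⟨C, hC, hC', hC0⟩ := exists_smooth_antiderivative hc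
    refine ⟨fun p => C p • w, ?_, fun s => by simp [hC0]⟩
    have h1 : (fun p => fderiv ℝ C p (1, 0)) = c := by
      ext p
      exact ((hC.differentiable (by simp) p).hasFDerivAt.hasLineDerivAt (1, 0)).unique (hC' p)
    refine ((HasD.of_contDiff hC (1, 0)).smul (HasD.const _ w)).congr_deriv ?_
    rw [← h1]; ext p; simp
  | zero => exact ⟨0, HasD.zero _, fun _ => rfl⟩
  | add f g _ _ hf hg =>
    exact ⟨_, hf.choose_spec.1.add hg.choose_spec.1, fun s => by
      simp [hf.choose_spec.2, hg.choose_spec.2]⟩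
  | smul a f _ hf =>
    exact ⟨_, hf.choose_spec.1.const_smul a, fun s => by simp [hf.choose_spec.2]⟩

end Functions

/-! ### Linear differential equations with locally nilpotent coefficients -/

section Flows

variable {E E' F : Type*} [AddCommGroup E] [Module ℂ E] [AddCommGroup E'] [Module ℂ E']
  [AddCommGroup F] [Module ℂ F]

theorem HasD.hasDerivAt {f f' : ℝ × ℝ → E} (h : HasD (1, 0) f f') (l : Module.Dual ℂ E) (t s : ℝ) :
    HasDerivAt (fun t => l (f (t, s))) (l (f' (t, s))) t := by
  have h1 := h.deriv l (t, s)
  simp only [HasLineDerivAt, Prod.smul_mk, Prod.mk_add_mk, smul_eq_mul, mul_one, mul_zero,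
    add_zero] at h1
  have h2 : HasDerivAt (fun x : ℝ => x - t) 1 t := (hasDerivAt_id t).sub_const t
  have h3 := HasDerivAt.scomp t (h := fun x : ℝ => x - t) (g₁ := fun x => l (f (t + x, s)))
    (by simpa using h1) h2
  rw [one_smul] at h3
  have h4 : ((fun x => l (f (t + x, s))) ∘ fun x => x - t) = fun t => l (f (t, s)) := by
    ext x; simp
  rwa [h4] at h3

/-- If `f p` were outside `L`, some functional would vanish on `L` but not at `f p`; along the line
through `p` its composite with `f` has derivative zero and starts at zero. -/
theorem HasD.mem_of_mem {f f' : ℝ × ℝ → E} (h : HasD (1, 0) f f') {L : Submodule ℂ E}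
    (h0 : ∀ s, f (0, s) ∈ L) (h' : ∀ p, f' p ∈ L) (p : ℝ × ℝ) : f p ∈ L := by
  obtain ⟨t, s⟩ := p
  by_contra hp
  obtain ⟨l, hl, hL⟩ := Submodule.exists_le_ker_of_notMem hp
  have h1 : ∀ t, HasDerivAt (fun t => l (f (t, s))) 0 t := fun t => by
    have := h.hasDerivAt l t s
    rwa [LinearMap.mem_ker.1 (hL (h' _))] at this
  have h2 := is_const_of_deriv_eq_zero (fun t => (h1 t).differentiableAt) (fun t => (h1 t).deriv) t 0
  exact hl (h2.trans (LinearMap.mem_ker.1 (hL (h0 s))))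

theorem HasD.eq_of_deriv_zero {f : ℝ × ℝ → E} (h : HasD (1, 0) f 0) (p : ℝ × ℝ) :
    f p = f (0, p.2) := by
  obtain ⟨t, s⟩ := p
  refine eq_of_forall_dual fun l => ?_
  have h1 : ∀ t, HasDerivAt (fun t => l (f (t, s))) 0 t := fun t => by
    simpa using h.hasDerivAt l t s
  exact is_const_of_deriv_eq_zero (fun t => (h1 t).differentiableAt) (fun t => (h1 t).deriv) t 0

theorem HasD.comp_zero_fst {f : ℝ × ℝ → E} (hf : f ∈ Sm (ℝ × ℝ) E) :
    HasD (1, 0) (fun p : ℝ × ℝ => f (0, p.2)) 0 := by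
  have hψ : ContDiff ℝ ∞ fun p : ℝ × ℝ => ((0 : ℝ), p.2) := contDiff_const.prodMk contDiff_snd
  refine ⟨comp_mem_finSums (fun _ hc => ContDiff.comp hc hψ) hf, zero_mem _, fun l p => ?_⟩
  simp only [HasLineDerivAt, Prod.snd_add, Prod.smul_snd, smul_zero, add_zero, Pi.zero_apply,
    map_zero]
  exact hasDerivAt_const _ _

/-- The operators `N p` lower the exhaustive filtration `L`. -/
structure Lowers (N : ℝ × ℝ → Module.End ℂ E) (L : ℕ → Submodule ℂ E) : Prop where
  zero : L 0 = ⊥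
  mono : Monotone L
  step : ∀ r p, ∀ x ∈ L (r + 1), N p x ∈ L r
  exhaust : ∀ x, ∃ r, x ∈ L r

namespace Lowers

variable {N : ℝ × ℝ → Module.End ℂ E} {L : ℕ → Submodule ℂ E}

theorem exists_level (hN : Lowers N L) {f : ℝ × ℝ → E} (hf : f ∈ Sm (ℝ × ℝ) E) :
    ∃ r, ∀ p, f p ∈ L r := by
  obtain ⟨S, hS⟩ := exists_finite_of_mem_finSums hf
  choose r hr using hN.exhaust
  refine ⟨S.sup r, fun p => ?_⟩
  refine Submodule.span_le.2 (fun x hx => ?_) (hS p)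
  exact hN.mono (le_sup hx) (hr x)

/-- A solution has values in some `L r`. Then its derivative lies one level lower, and so does the
solution, as it starts at zero; descent ends at `L 0 = ⊥`. -/
theorem eq_zero (hN : Lowers N L) {y : ℝ × ℝ → E} (hy : HasD (1, 0) y fun p => N p (y p))
    (h0 : ∀ s, y (0, s) = 0) (p : ℝ × ℝ) : y p = 0 := by
  obtain ⟨r, hr⟩ := hN.exists_level hy.mem
  induction r generalizing p with
  | zero => simpa [hN.zero] using hr p
  | succ r ih =>
    exact ih p (hy.mem_of_mem (fun s => by rw [h0]; exact zero_mem _) fun p => hN.step r p _ (hr p))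

/-- Picard iteration for the integral equation y = z + ∫ N y. Replacing the source `z` by ∫ N z
lowers its level, so finitely many steps suffice. -/
theorem exists_of_level (hN : Lowers N L) (hNs : ∀ w, (fun p => N p w) ∈ Sm (ℝ × ℝ) E) (r : ℕ)
    {z : ℝ × ℝ → E} (hz : z ∈ Sm (ℝ × ℝ) E) (hzL : ∀ p, z p ∈ L r) :
    ∃ y u, y = z + u ∧ HasD (1, 0) u (fun p => N p (y p)) ∧ ∀ s, u (0, s) = 0 := by
  induction r generalizing z with
  | zero =>
    have : z = 0 := funext fun p => by simpa [hN.zero] using hzL p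
    exact ⟨0, 0, by rw [this, add_zero], by simp only [Pi.zero_apply, map_zero]; exact HasD.zero _,
      fun _ => rfl⟩
  | succ r ih =>
    obtain ⟨z', hz', hz0⟩ := exists_antiderivative (apply_mem_finSums hNs hz)
    obtain ⟨y', u', hy', hu', hu0⟩ := ih hz'.mem (hz'.mem_of_mem
      (fun s => by rw [hz0]; exact zero_mem _) fun p => hN.step r p _ (hzL p))
    refine ⟨z + y', y', rfl, ?_, fun s => by rw [hy', Pi.add_apply, hz0, hu0, add_zero]⟩
    nth_rewrite 1 [hy']
    refine (hz'.add hu').congr_deriv (funext fun p => ?_)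
    simp

theorem exists_solution (hN : Lowers N L) (hNs : ∀ w, (fun p => N p w) ∈ Sm (ℝ × ℝ) E)
    {f : ℝ × ℝ → E} (hf : f ∈ Sm (ℝ × ℝ) E) (w : E) :
    ∃ y, HasD (1, 0) y (fun p => N p (y p) + f p) ∧ ∀ s, y (0, s) = w := by
  obtain ⟨g, hg, hg0⟩ := exists_antiderivative hf
  have hz := (HasD.const (1, 0) w).add hg
  obtain ⟨r, hr⟩ := hN.exists_level hz.mem
  obtain ⟨y, u, hy, hu, hu0⟩ := hN.exists_of_level hNs r hz.mem hr
  refine ⟨y, ?_, fun s => by rw [hy]; simp [hg0, hu0]⟩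
  nth_rewrite 1 [hy]
  refine (hz.add hu).congr_deriv (funext fun p => ?_)
  simp [add_comm]

/-- The equation is solved for each vector separately; uniqueness makes the solutions linear in the
vector. -/
theorem exists_flow (hN : Lowers N L) (hNs : ∀ w, (fun p => N p w) ∈ Sm (ℝ × ℝ) E)
    {R : ℝ × ℝ → E' →ₗ[ℂ] E} (hR : ∀ w, (fun p => R p w) ∈ Sm (ℝ × ℝ) E) (Z : E' →ₗ[ℂ] E) :
    ∃ K : ℝ × ℝ → E' →ₗ[ℂ] E,
      (∀ w, HasD (1, 0) (fun p => K p w) (fun p => N p (K p w) + R p w)) ∧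
        ∀ s, K (0, s) = Z := by
  choose y hy hy0 using fun w => hN.exists_solution hNs (hR w) (Z w)
  have hadd : ∀ w w', y (w + w') - (y w + y w') = 0 := fun w w' => by
    refine funext fun p => hN.eq_zero (((hy (w + w')).sub ((hy w).add (hy w'))).congr_deriv
      (funext fun p => ?_)) (fun s => ?_) p
    · simp only [Pi.sub_apply, Pi.add_apply, map_sub, map_add]; abel
    · simp [hy0]
  have hsmul : ∀ (a : ℂ) w, y (a • w) - a • y w = 0 := fun a w => by
    refine funext fun p => hN.eq_zero (((hy (a • w)).sub ((hy w).const_smul a)).congr_deriv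
      (funext fun p => ?_)) (fun s => ?_) p
    · simp only [Pi.sub_apply, Pi.smul_apply, map_sub, map_smul, smul_add]; abel
    · simp [hy0]
  refine ⟨fun p => { toFun := fun w => y w p, map_add' := fun w w' => ?_, map_smul' := fun a w => ?_ },
    hy, fun s => LinearMap.ext fun w => hy0 w s⟩
  · have := congr_fun (hadd w w') p
    simpa [sub_eq_zero] using this
  · have := congr_fun (hsmul a w) p
    simpa [sub_eq_zero] using this

theorem eq_of_hasD (hN : Lowers N L) {R : ℝ × ℝ → E} {y z : ℝ × ℝ → E}
    (hy : HasD (1, 0) y fun p => N p (y p) + R p) (hz : HasD (1, 0) z fun p => N p (z p) + R p)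
    (h0 : ∀ s, y (0, s) = z (0, s)) (p : ℝ × ℝ) : y p = z p := by
  rw [← sub_eq_zero]
  exact hN.eq_zero ((hy.sub hz).congr_deriv (funext fun p => by simp)) (fun s => by simp [h0]) p

/-- The filtration of a tensor product. -/
def tensorLevel (L : ℕ → Submodule ℂ E) (n : ℕ) : Submodule ℂ (E ⊗[ℂ] E) :=
  Submodule.span ℂ {z | ∃ i j, i + j ≤ n ∧ ∃ x ∈ L i, ∃ y ∈ L j, z = x ⊗ₜ[ℂ] y}

/-- The Leibniz operator acts on one factor at a time and so lowers the total filtration degree.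
Uniqueness for it is what shows that flows respect coproducts. -/
theorem tensor (hN : Lowers N L) :
    Lowers (fun p => TensorProduct.map (N p) LinearMap.id + TensorProduct.map LinearMap.id (N p))
      (tensorLevel L) where
  zero := by
    rw [tensorLevel, Submodule.span_eq_bot]
    rintro _ ⟨i, j, hij, x, hx, y, hy, rfl⟩
    obtain rfl : i = 0 := by omega
    rw [hN.zero, Submodule.mem_bot] at hx
    rw [hx, TensorProduct.zero_tmul]
  mono n m h := Submodule.span_mono fun z ⟨i, j, hij, hz⟩ => ⟨i, j, hij.trans h, hz⟩
  step r p z hz := by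
    induction hz using Submodule.span_induction with
    | mem z hz =>
      obtain ⟨i, j, hij, x, hx, y, hy, rfl⟩ := hz
      rw [LinearMap.add_apply, TensorProduct.map_tmul, TensorProduct.map_tmul]
      refine add_mem ?_ ?_
      · cases i with
        | zero =>
          rw [hN.zero, Submodule.mem_bot] at hx
          simp [hx]
        | succ i =>
          exact Submodule.subset_span ⟨i, j, by omega, _, hN.step i p x hx, y, hy, rfl⟩
      · cases j with
        | zero =>
          rw [hN.zero, Submodule.mem_bot] at hy
          simp [hy]
        | succ j =>
          exact Submodule.subset_span ⟨i, j, by omega, x, hx, _, hN.step j p y hy, rfl⟩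
    | zero => simp
    | add z w _ _ hz hw => rw [map_add]; exact add_mem hz hw
    | smul a z _ hz => rw [map_smul]; exact Submodule.smul_mem _ _ hz
  exhaust z := by
    induction z with
    | zero => exact ⟨0, zero_mem _⟩
    | add z w hz hw =>
      obtain ⟨r, hr⟩ := hz
      obtain ⟨r', hr'⟩ := hw
      have mono : Monotone (tensorLevel L) := fun n m h =>
        Submodule.span_mono fun z ⟨i, j, hij, hz⟩ => ⟨i, j, hij.trans h, hz⟩
      exact ⟨max r r', add_mem (mono (le_max_left _ _) hr) (mono (le_max_right _ _) hr')⟩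
    | tmul x y =>
      obtain ⟨i, hi⟩ := hN.exhaust x
      obtain ⟨j, hj⟩ := hN.exhaust y
      exact ⟨i + j, Submodule.subset_span ⟨i, j, le_rfl, x, hi, y, hj, rfl⟩⟩

end Lowers

end Flows

/-! ### Smooth families of coderivations and their commutators -/

section SmoothCoderivations

variable {P : Type*} [NormedAddCommGroup P] [NormedSpace ℝ P]
variable {G : AddSubmonoid ℝ≥0} {A B E F : Type*} [AddCommGroup A] [Module ℂ A]
  [AddCommGroup B] [Module ℂ B] [AddCommGroup E] [Module ℂ E] [AddCommGroup F] [Module ℂ F]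

/-- Derivatives are chosen vector by vector; their uniqueness makes the result a linear operator. -/
theorem HasD.exists_operator (v : P) {X : P → E →ₗ[ℂ] F} (hX : ∀ w, (fun p => X p w) ∈ Sm P F) :
    ∃ X' : P → E →ₗ[ℂ] F, ∀ w, HasD v (fun p => X p w) (fun p => X' p w) := by
  choose f hf using fun w => exists_of_mem v (hX w)
  refine ⟨fun p => ⟨⟨fun w => f w p, fun w w' => ?_⟩, fun a w => ?_⟩, hf⟩
  · have := (hf (w + w')).unique (((hf w).add (hf w')).congr (funext fun p => by simp))
    exact congr_fun this p
  · have := (hf (a • w)).unique (((hf w).const_smul a).congr (funext fun p => by simp))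
    exact congr_fun this p

theorem HasD.of_word {v : P} {X X' : P → Bar G A →ₗ[ℂ] E}
    (h : ∀ n x β, HasD v (fun p => X p (Bar.word n x β)) (fun p => X' p (Bar.word n x β)))
    (c : Bar G A) : HasD v (fun p => X p c) (fun p => X' p c) := by
  have hc : c ∈ Bar.level (A := A) (Set.univ : Set G) := by rw [Bar.level_univ]; trivial
  induction hc using Submodule.span_induction with
  | mem c hc =>
    obtain ⟨n, x, β, -, rfl⟩ := hc
    exact h n x β
  | zero => simpa using HasD.const v (0 : E)
  | add c d _ _ hc hd =>
    convert hc.add hd using 1 <;> ext p <;> simp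
  | smul a c _ hc =>
    convert hc.const_smul a using 1 <;> ext p <;> simp

theorem toLin_mem_finSums {P : Type*} {𝒞 : Subalgebra ℂ (P → ℂ)} {X : P → Fam G A E}
    (h : ∀ k β x, (fun p => X p k β x) ∈ finSums 𝒞 E) (c : Bar G A) :
    (fun p => Bar.toLin (X p) c) ∈ finSums 𝒞 E := by
  have hc : c ∈ Bar.level (A := A) (Set.univ : Set G) := by rw [Bar.level_univ]; trivial
  induction hc using Submodule.span_induction with
  | mem c hc =>
    obtain ⟨n, x, β, -, rfl⟩ := hc
    simpa only [Bar.toLin_word] using h n β fun a => x a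
  | zero => simpa using (const_mem_finSums 0 : _ ∈ finSums 𝒞 E)
  | add c d _ _ hc hd =>
    convert add_mem hc hd using 1
    ext p; simp
  | smul a c _ hc =>
    convert Submodule.smul_mem _ a hc using 1
    ext p; simp

variable [HasAntidiagonal G]

theorem HasD.head (ψ : A →ₗ[ℂ] B) {v : P} {X X' : P → Bar G A →ₗ[ℂ] B}
    (h : ∀ c, HasD v (fun p => X p c) (fun p => X' p c)) (c : Bar G A) :
    HasD v (fun p => Bar.head ψ (X p) c) (fun p => Bar.head ψ (X' p) c) := by
  simp only [Bar.head, LinearMap.comp_apply]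
  generalize Bar.comul c = z
  induction z with
  | zero => simpa using HasD.const v (0 : Bar G B)
  | add z w hz hw =>
    convert hz.add hw using 1 <;> ext p <;> simp
  | tmul c d =>
    exact (h c).map (Bar.cons.flip (Bar.map ψ d))

theorem HasD.ins (φ ψ : A →ₗ[ℂ] B) {v : P} {X X' : P → Bar G A →ₗ[ℂ] B}
    (h : ∀ c, HasD v (fun p => X p c) (fun p => X' p c)) (c : Bar G A) :
    HasD v (fun p => Bar.ins φ ψ (X p) c) (fun p => Bar.ins φ ψ (X' p) c) := by
  induction c using Bar.induction with
  | zero => simpa using HasD.const v (0 : Bar G B)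
  | add c d hc hd => convert hc.add hd using 1 <;> ext p <;> simp
  | smul a c hc => convert hc.const_smul a using 1 <;> ext p <;> simp
  | empty β =>
    simp only [Bar.ins_e]
    exact HasD.head ψ h _
  | cons x c hc =>
    simp only [Bar.ins_cons]
    exact (hc.map (Bar.cons (φ x))).add (HasD.head ψ h _)

theorem ins_mem_Sm (φ ψ : A →ₗ[ℂ] B) {X : P → Bar G A →ₗ[ℂ] B}
    (h : ∀ c, (fun p => X p c) ∈ Sm P B) (c : Bar G A) :
    (fun p => Bar.ins φ ψ (X p) c) ∈ Sm P (Bar G B) := by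
  obtain ⟨X', hX'⟩ := HasD.exists_operator (0 : P) h
  exact (HasD.ins φ ψ hX' c).mem

/-- The commutator is again a coderivation: in its coproduct the terms in which the two operators
act on different factors cancel by the sign rules `hF`, `hG` and `ε * ε = 1`. It is therefore
determined by its components. -/
theorem Bar.ins_commutator {σ τ : A →ₗ[ℂ] A} {f g : Bar G A →ₗ[ℂ] A} {ε : ℂ} (hε : ε * ε = 1)
    (hF : ins σ LinearMap.id f ∘ₗ map τ = ε • map τ ∘ₗ ins σ LinearMap.id f)
    (hG : ins τ LinearMap.id g ∘ₗ map σ = ε • map σ ∘ₗ ins τ LinearMap.id g)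
    (hστ : σ ∘ₗ τ = τ ∘ₗ σ) :
    ins (σ ∘ₗ τ) LinearMap.id (f ∘ₗ ins τ LinearMap.id g - ε • g ∘ₗ ins σ LinearMap.id f) =
      ins σ LinearMap.id f ∘ₗ ins τ LinearMap.id g -
        ε • ins τ LinearMap.id g ∘ₗ ins σ LinearMap.id f := by
  refine eq_of_coderivation (σ ∘ₗ τ) (ψ' := LinearMap.id) (fun c => ?_) (fun c => ?_) (fun c => ?_)
    (fun c => ?_)
  · rw [comul_ins, map_id]
  · have hs : map (G := G) τ ∘ₗ map σ = map σ ∘ₗ map τ := by rw [← map_comp, ← hστ, map_comp]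
    have hs' : map (G := G) (σ ∘ₗ τ) = map σ ∘ₗ map τ := map_comp _ _
    rw [LinearMap.sub_apply, LinearMap.smul_apply, LinearMap.comp_apply, LinearMap.comp_apply,
      _root_.map_sub, _root_.map_smul, comul_ins, comul_ins, comul_ins, comul_ins]
    simp only [map_id]
    generalize comul c = z
    set F := ins σ LinearMap.id f
    set K := ins τ LinearMap.id g
    induction z with
    | zero => simp
    | add z w hz hw =>
      have := congr_arg₂ (· + ·) hz hw
      simp only [_root_.map_add, smul_add] at this ⊢
      refine Eq.trans ?_ (this.trans ?_) <;> abel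
    | tmul c d =>
      have h1 := LinearMap.congr_fun hF c
      have h2 := LinearMap.congr_fun hG c
      have h3 := LinearMap.congr_fun hs c
      simp only [LinearMap.comp_apply, LinearMap.smul_apply] at h1 h2 h3
      simp only [_root_.map_add, TensorProduct.map_tmul, LinearMap.id_apply, hs',
        LinearMap.comp_apply, LinearMap.sub_apply, LinearMap.smul_apply, h1, h2, h3, smul_add,
        TensorProduct.sub_tmul, TensorProduct.tmul_sub, ← TensorProduct.smul_tmul',
        TensorProduct.tmul_smul, smul_smul, hε, one_smul]
      abel
  · simp [scalar_ins]
  · simp [proj_ins]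

end SmoothCoderivations

/-! ### The flow of a one-parameter isotopy -/

section BarFlows

variable {G : AddSubmonoid ℝ≥0} {A : Type*} [AddCommGroup A] [Module ℂ A]

theorem toLin_word_zero {F : Fam G A A} (h : ∀ k, F k 0 = 0) (n : ℕ) (x : ℕ → A) :
    Bar.toLin F (Bar.word n x 0) = 0 := by rw [Bar.toLin_word, h]; rfl

variable [HasAntidiagonal G]

namespace Bar

theorem energyRank_pos (β : G) : 0 < energyRank β :=
  card_pos.2 ⟨(0, β), by simp⟩

theorem level_eq_bot {r : ℕ} (hr : r ≤ 1) : level (A := A) {β : G | energyRank β < r} = ⊥ := by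
  rw [level, Submodule.span_eq_bot]
  rintro _ ⟨n, x, β, hβ, rfl⟩
  have := energyRank_pos β
  rw [Set.mem_ofPred_eq] at hβ
  omega

/-- Energy zero has rank one, its only decomposition being 0 + 0, and no energy has smaller rank. -/
theorem ins_e_zero {B : Type*} [AddCommGroup B] [Module ℂ B] (φ ψ : A →ₗ[ℂ] B)
    {g : Bar G A →ₗ[ℂ] B} (hg : ∀ n x, g (word n x 0) = 0) : ins φ ψ g (e 0) = 0 := by
  have h : (e 0 : Bar G A) ∈ level {β : G | energyRank β < 1 + 1} := by
    refine word_mem_level (β := (0 : G)) ?_ 0 0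
    have : energyRank (0 : G) = 1 := by
      rw [energyRank, card_eq_one]
      refine ⟨(0, 0), ?_⟩
      ext ⟨a, b⟩
      simp only [mem_antidiagonal, mem_singleton, Prod.mk.injEq]
      constructor
      · intro h
        have h1 : (a : ℝ≥0) + b = 0 := congr_arg Subtype.val h
        rw [add_eq_zero] at h1
        exact ⟨Subtype.ext h1.1, Subtype.ext h1.2⟩
      · rintro ⟨rfl, rfl⟩; simp
    rw [Set.mem_ofPred_eq, this]
    exact Nat.lt_succ_self 1
  have := ins_mem_level φ ψ g hg 1 h
  rwa [level_eq_bot le_rfl, Submodule.mem_bot] at this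

end Bar

theorem lowers_ins {X : ℝ × ℝ → Bar G A →ₗ[ℂ] A} (h : ∀ p n x, X p (Bar.word n x 0) = 0)
    (φ ψ : A →ₗ[ℂ] A) :
    Lowers (fun p => Bar.ins φ ψ (X p)) fun r => Bar.level {β | Bar.energyRank β < r} where
  zero := Bar.level_eq_bot zero_le_one
  mono _ _ h := Bar.level_mono fun _ hβ => lt_of_lt_of_le hβ h
  step r p _ hx := Bar.ins_mem_level φ ψ (X p) (h p) r hx
  exhaust := Bar.exists_mem_level

variable (𝒜 : ℤ → Submodule ℂ A) [DirectSum.Decomposition 𝒜]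

theorem evenCoder_map_scale {F : Fam G A A} (h : ∀ k β, HasDegree 𝒜 𝒜 0 (F k β)) (a : ℂˣ) :
    evenCoder F ∘ₗ Bar.map (scale 𝒜 a) = Bar.map (scale 𝒜 a) ∘ₗ evenCoder F := by
  have := Bar.map_scale_comp_ins 𝒜 h a 1
  rw [scale_one, zpow_zero, Units.val_one, one_smul] at this
  exact this.symm

theorem oddCoder_map_scale {F : Fam G A A} {d : ℤ} (h : ∀ k β, HasDegree 𝒜 𝒜 d (F k β)) (a : ℂˣ) :
    Bar.map (scale 𝒜 a) ∘ₗ oddCoder 𝒜 F = ((a ^ d : ℂˣ) : ℂ) • oddCoder 𝒜 F ∘ₗ Bar.map (scale 𝒜 a) := by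
  rw [oddCoder, koszul_eq_scale]
  exact Bar.map_scale_comp_ins 𝒜 h a (-1)

/-- Time dependent families `b` and `u` of degrees one and zero with `∂b = [u, b]`. -/
structure IsIsotopy (b u : ℝ × ℝ → Fam G A A) : Prop where
  degree_u : ∀ p k β, HasDegree 𝒜 𝒜 0 (u p k β)
  positive_u : ∀ p k, u p k 0 = 0
  smooth_u : ∀ c, (fun p => Bar.toLin (u p) c) ∈ Sm (ℝ × ℝ) A
  degree_b : ∀ p k β, HasDegree 𝒜 𝒜 1 (b p k β)
  deriv_b : ∀ c, HasD (1, 0) (fun p => Bar.toLin (b p) c) fun p =>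
    Bar.toLin (u p) (oddCoder 𝒜 (b p) c) - Bar.toLin (b p) (evenCoder (u p) c)

/-- The flow of the coderivations given by `u`. -/
structure IsFlow (u : ℝ × ℝ → Fam G A A) (Q : ℝ × ℝ → Module.End ℂ (Bar G A)) : Prop where
  deriv : ∀ c, HasD (1, 0) (fun p => Q p c) fun p => evenCoder (u p) (Q p c)
  init : ∀ s, Q (0, s) = LinearMap.id

variable {𝒜} {b u : ℝ × ℝ → Fam G A A} {Q : ℝ × ℝ → Module.End ℂ (Bar G A)}

namespace IsIsotopy

theorem lowers (h : IsIsotopy 𝒜 b u) :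
    Lowers (fun p => evenCoder (u p)) fun r => Bar.level {β | Bar.energyRank β < r} :=
  lowers_ins (fun p => toLin_word_zero (h.positive_u p)) _ _

theorem smooth_evenCoder (h : IsIsotopy 𝒜 b u) (c : Bar G A) :
    (fun p => evenCoder (u p) c) ∈ Sm (ℝ × ℝ) (Bar G A) := ins_mem_Sm _ _ h.smooth_u c

/-- The equation for the components of `b` extends to the coderivations, because the commutator of
the coderivations extends the commutator of the components. -/
theorem deriv_oddCoder (h : IsIsotopy 𝒜 b u) (c : Bar G A) :
    HasD (1, 0) (fun p => oddCoder 𝒜 (b p) c) fun p =>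
      evenCoder (u p) (oddCoder 𝒜 (b p) c) - oddCoder 𝒜 (b p) (evenCoder (u p) c) := by
  refine (HasD.ins (koszul 𝒜) LinearMap.id (X := fun p => Bar.toLin (b p)) (X' := fun p =>
    Bar.toLin (u p) ∘ₗ oddCoder 𝒜 (b p) - (1 : ℂ) • Bar.toLin (b p) ∘ₗ evenCoder (u p))
    (fun c => by simpa using h.deriv_b c) c).congr_deriv (funext fun p => ?_)
  have := LinearMap.congr_fun (Bar.ins_commutator (σ := LinearMap.id) (τ := koszul 𝒜)
    (f := Bar.toLin (u p)) (g := Bar.toLin (b p)) (ε := 1) (by simp)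
    (by rw [one_smul, koszul_eq_scale]; exact evenCoder_map_scale 𝒜 (h.degree_u p) _)
    (by rw [Bar.map_id, LinearMap.comp_id, one_smul, LinearMap.id_comp])
    (by rw [LinearMap.id_comp, LinearMap.comp_id])) c
  rw [LinearMap.id_comp] at this
  simp only [one_smul] at this ⊢
  exact this

theorem exists_flow (h : IsIsotopy 𝒜 b u) : ∃ Q, IsFlow u Q := by
  obtain ⟨Q, hQ, hQ0⟩ := h.lowers.exists_flow h.smooth_evenCoder (E' := Bar G A) (R := 0)
    (fun w => by simpa using (const_mem_finSums 0 : _ ∈ Sm (ℝ × ℝ) (Bar G A))) LinearMap.id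
  exact ⟨Q, fun c => by simpa using hQ c, hQ0⟩

end IsIsotopy

namespace IsFlow

theorem scalar_eq (hQ : IsFlow u Q) (p : ℝ × ℝ) (c : Bar G A) :
    Bar.scalar (Q p c) = Bar.scalar c := by
  have h := ((hQ.deriv c).map Bar.scalar).congr_deriv (g' := 0)
    (funext fun p => Bar.scalar_ins _ _ _ _)
  rw [h.eq_of_deriv_zero p, hQ.init]; rfl

theorem apply_e_zero (hQ : IsFlow u Q) (h : IsIsotopy 𝒜 b u) (p : ℝ × ℝ) :
    Q p (Bar.e 0) = Bar.e 0 := by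
  refine h.lowers.eq_of_hasD (R := 0) (by simpa using hQ.deriv (Bar.e 0))
    (z := fun _ => Bar.e 0) ((HasD.const _ _).congr_deriv ?_) (fun s => by simp [hQ.init]) p
  ext p
  rw [evenCoder, Bar.ins_e_zero _ _ (toLin_word_zero (h.positive_u p))]; simp

/-- As `u` acts by coderivations, both sides solve the Leibniz equation on the tensor square with
the same initial value. -/
theorem comul_eq (hQ : IsFlow u Q) (h : IsIsotopy 𝒜 b u) (p : ℝ × ℝ) (c : Bar G A) :
    Bar.comul (Q p c) = TensorProduct.map (Q p) (Q p) (Bar.comul c) := by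
  refine h.lowers.tensor.eq_of_hasD (R := 0) (y := fun p => Bar.comul (Q p c))
    (z := fun p => TensorProduct.map (Q p) (Q p) (Bar.comul c)) ?_ ?_ ?_ p
  · refine ((hQ.deriv c).map Bar.comul).congr_deriv (funext fun p => ?_)
    rw [evenCoder, Bar.comul_ins, Bar.map_id]
    simp
  · generalize Bar.comul c = z
    induction z with
    | zero => simpa using HasD.const (1, 0) (0 : Bar G A ⊗[ℂ] Bar G A)
    | add z w hz hw => convert hz.add hw using 1 <;> ext p <;> simp <;> abel
    | tmul c d =>
      simp only [TensorProduct.map_tmul]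
      refine ((hQ.deriv c).tmul (hQ.deriv d)).congr_deriv (funext fun p => ?_)
      simp
  · intro s
    simp [hQ.init]

theorem isCoalgMap (hQ : IsFlow u Q) (h : IsIsotopy 𝒜 b u) (p : ℝ × ℝ) :
    Bar.IsCoalgMap (Q p) := ⟨hQ.comul_eq h p, hQ.scalar_eq p⟩

theorem map_scale_comp (hQ : IsFlow u Q) (h : IsIsotopy 𝒜 b u) (a : ℂˣ) (p : ℝ × ℝ) :
    Bar.map (scale 𝒜 a) ∘ₗ Q p = Q p ∘ₗ Bar.map (scale 𝒜 a) := by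
  ext c
  refine h.lowers.eq_of_hasD (R := 0) (y := fun p => Bar.map (scale 𝒜 a) (Q p c))
    (z := fun p => Q p (Bar.map (scale 𝒜 a) c)) ?_
    (by simpa using hQ.deriv (Bar.map (scale 𝒜 a) c)) (fun s => by simp [hQ.init]) p
  refine ((hQ.deriv c).map _).congr_deriv (funext fun p => ?_)
  have := LinearMap.congr_fun (evenCoder_map_scale 𝒜 (h.degree_u p) a) (Q p c)
  simp only [LinearMap.comp_apply] at this
  simp [this]

/-- By ∂b = [u, b] the product `b Q` satisfies the flow equation, and so does `Q b₀`, where `b₀` is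
constant in time; they agree at time 0. -/
theorem coder_comp (hQ : IsFlow u Q) (h : IsIsotopy 𝒜 b u) (p : ℝ × ℝ) :
    oddCoder 𝒜 (b p) ∘ₗ Q p = Q p ∘ₗ oddCoder 𝒜 (b (0, p.2)) := by
  ext c
  refine h.lowers.eq_of_hasD (R := 0) (y := fun p => oddCoder 𝒜 (b p) (Q p c))
    (z := fun p => Q p (oddCoder 𝒜 (b (0, p.2)) c)) ?_ ?_ (fun s => by simp [hQ.init]) p
  · refine (HasD.apply (X' := fun p => evenCoder (u p) ∘ₗ oddCoder 𝒜 (b p) -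
      oddCoder 𝒜 (b p) ∘ₗ evenCoder (u p)) h.deriv_oddCoder (hQ.deriv c)).congr_deriv
        (funext fun p => ?_)
    simp
  · refine (HasD.apply (X' := fun p => evenCoder (u p) ∘ₗ Q p) hQ.deriv
      (HasD.comp_zero_fst (h.deriv_oddCoder c).mem)).congr_deriv (funext fun p => ?_)
    simp

end IsFlow
end BarFlows

/-! ### Variation of the flow in a two-parameter family -/

section Squares

variable {G : AddSubmonoid ℝ≥0} {A : Type*} [AddCommGroup A] [Module ℂ A] [HasAntidiagonal G]
variable (𝒜 : ℤ → Submodule ℂ A) [DirectSum.Decomposition 𝒜]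

/-- The components of a flat superconnection `b + u dt + v ds + w dt ∧ ds` over the plane. -/
structure IsFlatSquare (b u v w : ℝ × ℝ → Fam G A A) : Prop extends IsIsotopy 𝒜 b u where
  degree_w : ∀ p k β, HasDegree 𝒜 𝒜 (-1) (w p k β)
  positive_w : ∀ p k, w p k 0 = 0
  smooth_w : ∀ c, (fun p => Bar.toLin (w p) c) ∈ Sm (ℝ × ℝ) A
  smooth_v : ∀ c, (fun p => Bar.toLin (v p) c) ∈ Sm (ℝ × ℝ) A
  curvature : ∀ c f g, HasD (1, 0) (fun p => Bar.toLin (v p) c) f →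
    HasD (0, 1) (fun p => Bar.toLin (u p) c) g → ∀ p, f p - g p =
      (Bar.toLin (u p) (evenCoder (v p) c) - Bar.toLin (v p) (evenCoder (u p) c)) +
        (Bar.toLin (b p) (oddCoder 𝒜 (w p) c) + Bar.toLin (w p) (oddCoder 𝒜 (b p) c))

/-- The component `K` of the flow of a flat square along `w`. -/
structure IsSecondFlow (u w : ℝ × ℝ → Fam G A A) (Q K : ℝ × ℝ → Module.End ℂ (Bar G A)) :
    Prop where
  deriv : ∀ c, HasD (1, 0) (fun p => K p c) fun p =>
    evenCoder (u p) (K p c) - oddCoder 𝒜 (w p) (Q p c)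
  init : ∀ s, K (0, s) = 0

variable {𝒜} {b u v w : ℝ × ℝ → Fam G A A} {Q K : ℝ × ℝ → Module.End ℂ (Bar G A)}

namespace IsFlatSquare

theorem smooth_oddCoder_w (h : IsFlatSquare 𝒜 b u v w) (c : Bar G A) :
    (fun p => oddCoder 𝒜 (w p) c) ∈ Sm (ℝ × ℝ) (Bar G A) := ins_mem_Sm _ _ h.smooth_w c

theorem exists_secondFlow (h : IsFlatSquare 𝒜 b u v w) (hQ : IsFlow u Q) :
    ∃ K, IsSecondFlow 𝒜 u w Q K := by
  obtain ⟨K, hK, hK0⟩ := h.lowers.exists_flow h.smooth_evenCoder (E' := Bar G A)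
    (R := fun p => -(oddCoder 𝒜 (w p) ∘ₗ Q p)) (fun c => neg_mem
      (apply_mem_finSums h.smooth_oddCoder_w (hQ.deriv c).mem)) 0
  exact ⟨K, fun c => by simpa [sub_eq_add_neg] using hK c, hK0⟩

/-- The curvature identity is passed from components to coderivations by `Bar.ins_commutator`, with
`ε = 1` for the even pair `u`, `v` and `ε = -1` for the odd pair `b`, `w`. -/
theorem curvature_coder (h : IsFlatSquare 𝒜 b u v w) (c : Bar G A) {f g : ℝ × ℝ → Bar G A}
    (hf : HasD (1, 0) (fun p => evenCoder (v p) c) f)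
    (hg : HasD (0, 1) (fun p => evenCoder (u p) c) g) (p : ℝ × ℝ) : f p - g p =
      (evenCoder (u p) (evenCoder (v p) c) - evenCoder (v p) (evenCoder (u p) c)) +
        (oddCoder 𝒜 (b p) (oddCoder 𝒜 (w p) c) + oddCoder 𝒜 (w p) (oddCoder 𝒜 (b p) c)) := by
  obtain ⟨v', hv'⟩ := HasD.exists_operator (1, 0) h.smooth_v
  obtain ⟨u', hu'⟩ := HasD.exists_operator (0, 1) h.smooth_u
  rw [hf.unique (HasD.ins LinearMap.id LinearMap.id hv' c),
    hg.unique (HasD.ins LinearMap.id LinearMap.id hu' c)]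
  have h1 : v' p = u' p + ((Bar.toLin (u p) ∘ₗ evenCoder (v p) -
      (1 : ℂ) • Bar.toLin (v p) ∘ₗ evenCoder (u p)) + (Bar.toLin (b p) ∘ₗ oddCoder 𝒜 (w p) -
      (-1 : ℂ) • Bar.toLin (w p) ∘ₗ oddCoder 𝒜 (b p))) := by
    ext c
    have := h.curvature c _ _ (hv' c) (hu' c) p
    rw [sub_eq_iff_eq_add'] at this
    simpa using this
  have h2 := Bar.ins_commutator (σ := LinearMap.id) (τ := LinearMap.id)
    (f := Bar.toLin (u p)) (g := Bar.toLin (v p)) (ε := 1) (by simp)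
    (by rw [Bar.map_id, LinearMap.comp_id, one_smul, LinearMap.id_comp])
    (by rw [Bar.map_id, LinearMap.comp_id, one_smul, LinearMap.id_comp]) rfl
  -- The Koszul operator is an involution, so the anticommutator of two odd coderivations is
  -- extended without signs, as an even one.
  have hkk : koszul 𝒜 ∘ₗ koszul 𝒜 = LinearMap.id := by
    rw [koszul_eq_scale, ← scale_mul]; simp [scale_one]
  have hodd : ∀ {d : ℤ} {F : Fam G A A}, Odd d → (∀ k β, HasDegree 𝒜 𝒜 d (F k β)) →
      oddCoder 𝒜 F ∘ₗ Bar.map (koszul 𝒜) = (-1 : ℂ) • Bar.map (koszul 𝒜) ∘ₗ oddCoder 𝒜 F := by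
    intro d F hd hF
    have := oddCoder_map_scale 𝒜 hF (-1)
    rw [koszul_eq_scale, this, smul_smul]
    simp [hd.neg_one_zpow]
  have h3 := Bar.ins_commutator (σ := koszul 𝒜) (τ := koszul 𝒜)
    (f := Bar.toLin (b p)) (g := Bar.toLin (w p)) (ε := -1) (by simp)
    (hodd odd_one (h.degree_b p)) (hodd (by decide) (h.degree_w p)) rfl
  rw [hkk] at h3
  rw [LinearMap.id_comp] at h2
  beta_reduce
  rw [h1, Bar.ins_add, Bar.ins_add, LinearMap.add_apply, add_sub_cancel_left]
  simp only [evenCoder, oddCoder] at h2 h3 ⊢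
  rw [h2, h3]
  simp

end IsFlatSquare

namespace IsSecondFlow

theorem scalar_eq (hK : IsSecondFlow 𝒜 u w Q K) (p : ℝ × ℝ) (c : Bar G A) :
    Bar.scalar (K p c) = 0 := by
  have h := ((hK.deriv c).map Bar.scalar).congr_deriv (g' := 0) (funext fun p => by
    rw [_root_.map_sub, evenCoder, oddCoder, Bar.scalar_ins, Bar.scalar_ins]; simp)
  rw [h.eq_of_deriv_zero p, hK.init]; simp

theorem apply_e_zero (hK : IsSecondFlow 𝒜 u w Q K) (hQ : IsFlow u Q) (h : IsFlatSquare 𝒜 b u v w)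
    (p : ℝ × ℝ) : K p (Bar.e 0) = 0 := by
  refine h.lowers.eq_zero ((hK.deriv (Bar.e 0)).congr_deriv (funext fun p => ?_))
    (fun s => by simp [hK.init]) p
  rw [hQ.apply_e_zero h.toIsIsotopy, oddCoder,
    Bar.ins_e_zero _ _ (toLin_word_zero (h.positive_w p)), sub_zero]

theorem map_scale_comp (hK : IsSecondFlow 𝒜 u w Q K) (hQ : IsFlow u Q)
    (h : IsFlatSquare 𝒜 b u v w) (a : ℂˣ) (p : ℝ × ℝ) :
    Bar.map (scale 𝒜 a) ∘ₗ K p =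
      ((a ^ (-1 : ℤ) : ℂˣ) : ℂ) • K p ∘ₗ Bar.map (scale 𝒜 a) := by
  ext c
  refine h.lowers.eq_of_hasD
    (R := fun p => -(Bar.map (scale 𝒜 a) (oddCoder 𝒜 (w p) (Q p c))))
    (y := fun p => Bar.map (scale 𝒜 a) (K p c))
    (z := fun p => ((a ^ (-1 : ℤ) : ℂˣ) : ℂ) • K p (Bar.map (scale 𝒜 a) c)) ?_ ?_
    (fun s => by simp [hK.init]) p
  · refine ((hK.deriv c).map _).congr_deriv (funext fun p => ?_)
    have := LinearMap.congr_fun (evenCoder_map_scale 𝒜 (h.degree_u p) a) (K p c)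
    simp only [LinearMap.comp_apply] at this
    rw [this, _root_.map_sub, sub_eq_add_neg]
  · refine ((hK.deriv (Bar.map (scale 𝒜 a) c)).const_smul _).congr_deriv (funext fun p => ?_)
    have h1 := LinearMap.congr_fun (oddCoder_map_scale 𝒜 (h.degree_w p) a) (Q p c)
    have h2 := LinearMap.congr_fun (hQ.map_scale_comp h.toIsIsotopy a p) c
    simp only [LinearMap.comp_apply, LinearMap.smul_apply] at h1 h2
    rw [h1, h2]
    simp [sub_eq_add_neg]

/-- Both sides solve the Leibniz equation with the same inhomogeneous term, the coproduct of `-w Q`.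
As `w` has odd degree, a sign operator stands in front of `Q` when the new letter is in the right
factor. -/
theorem comul_eq (hK : IsSecondFlow 𝒜 u w Q K) (hQ : IsFlow u Q) (h : IsFlatSquare 𝒜 b u v w)
    (p : ℝ × ℝ) (c : Bar G A) : Bar.comul (K p c) =
      TensorProduct.map (K p) (Q p) (Bar.comul c) +
        TensorProduct.map (Bar.map (koszul 𝒜) ∘ₗ Q p) (K p) (Bar.comul c) := by
  refine h.lowers.tensor.eq_of_hasD (R := fun p => -Bar.comul (oddCoder 𝒜 (w p) (Q p c)))
    (y := fun p => Bar.comul (K p c))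
    (z := fun p => TensorProduct.map (K p) (Q p) (Bar.comul c) +
        TensorProduct.map (Bar.map (koszul 𝒜) ∘ₗ Q p) (K p) (Bar.comul c)) ?_ ?_ ?_ p
  · refine ((hK.deriv c).map Bar.comul).congr_deriv (funext fun p => ?_)
    rw [_root_.map_sub, evenCoder, Bar.comul_ins, Bar.map_id, sub_eq_add_neg, LinearMap.add_apply]
  · have hw : ∀ p, Bar.comul (oddCoder 𝒜 (w p) (Q p c)) =
        TensorProduct.map (oddCoder 𝒜 (w p) ∘ₗ Q p) (Q p) (Bar.comul c) +
          TensorProduct.map (Bar.map (koszul 𝒜) ∘ₗ Q p) (oddCoder 𝒜 (w p) ∘ₗ Q p)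
            (Bar.comul c) := by
      intro p
      have hmm : ∀ (f g : Module.End ℂ (Bar G A)) z,
          TensorProduct.map f g (TensorProduct.map (Q p) (Q p) z) =
          TensorProduct.map (f ∘ₗ Q p) (g ∘ₗ Q p) z := fun f g z => by
        rw [TensorProduct.map_comp]; rfl
      rw [oddCoder, Bar.comul_ins, hQ.comul_eq h.toIsIsotopy, Bar.map_id, hmm, hmm,
        LinearMap.id_comp]
    simp only [hw]
    generalize Bar.comul c = z
    induction z with
    | zero => simpa using HasD.const (1, 0) (0 : Bar G A ⊗[ℂ] Bar G A)
    | add z w hz hw =>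
      convert hz.add hw using 1
      · ext p; simp only [_root_.map_add, Pi.add_apply]; abel
      · ext p; simp only [_root_.map_add, Pi.add_apply, neg_add]; abel
    | tmul c d =>
      simp only [TensorProduct.map_tmul, LinearMap.comp_apply]
      refine (((hK.deriv c).tmul (hQ.deriv d)).add
        (((hQ.deriv c).map (Bar.map (koszul 𝒜))).tmul (hK.deriv d))).congr_deriv
        (funext fun p => ?_)
      have h1 := LinearMap.congr_fun (evenCoder_map_scale 𝒜 (h.degree_u p) (-1)) (Q p c)
      rw [← koszul_eq_scale] at h1
      simp only [LinearMap.comp_apply] at h1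
      simp only [Pi.add_apply, LinearMap.add_apply, _root_.map_add, TensorProduct.map_tmul,
        LinearMap.id_apply, ← h1, TensorProduct.sub_tmul, TensorProduct.tmul_sub]
      abel
  · intro s
    simp [hK.init]

/-- Both sides solve y' = u y + (∂ₛu) Q in the first variable. For the right side, ∂ₜv is replaced
using the curvature identity; the terms `b w Q` and `w b Q` this produces cancel against those from
the derivative of `K`, by way of `coder_comp`. -/
theorem deriv_snd (hK : IsSecondFlow 𝒜 u w Q K) (hQ : IsFlow u Q) (h : IsFlatSquare 𝒜 b u v w)
    (c : Bar G A) : HasD (0, 1) (fun p => Q p c) fun p =>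
      evenCoder (v p) (Q p c) - Q p (evenCoder (v (0, p.2)) c) +
        (oddCoder 𝒜 (b p) (K p c) + K p (oddCoder 𝒜 (b (0, p.2)) c)) := by
  have hUs := h.smooth_evenCoder
  have hVs : ∀ c, (fun p => evenCoder (v p) c) ∈ Sm (ℝ × ℝ) (Bar G A) :=
    fun c => ins_mem_Sm _ _ h.smooth_v c
  obtain ⟨U', hU'⟩ := HasD.exists_operator (0, 1) hUs
  obtain ⟨V', hV'⟩ := HasD.exists_operator (1, 0) hVs
  obtain ⟨f, hf⟩ := HasD.exists_of_mem (0, 1) (hQ.deriv c).mem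
  obtain ⟨g, hg⟩ := HasD.exists_of_mem (1, 0) hf.mem'
  -- Exchanging the mixed derivatives gives the equation satisfied by ∂ₛQ.
  have hg' := hg.congr_deriv ((hQ.deriv c).symm hf (HasD.apply hU' hf) hg).symm
  refine hf.congr_deriv (funext fun p => ?_)
  refine h.lowers.eq_of_hasD (R := fun p => U' p (Q p c)) (z := fun p =>
      evenCoder (v p) (Q p c) - Q p (evenCoder (v (0, p.2)) c) +
        (oddCoder 𝒜 (b p) (K p c) + K p (oddCoder 𝒜 (b (0, p.2)) c)))
      (hg'.congr_deriv (funext fun p => add_comm _ _)) ?_ (fun s => ?_) p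
  · have h1 := HasD.apply hV' (hQ.deriv c)
    have h2 := HasD.apply (X' := fun p => evenCoder (u p) ∘ₗ Q p) hQ.deriv
      (HasD.comp_zero_fst (hVs c))
    have h3 := HasD.apply (X' := fun p => evenCoder (u p) ∘ₗ oddCoder 𝒜 (b p) -
      oddCoder 𝒜 (b p) ∘ₗ evenCoder (u p)) h.deriv_oddCoder (hK.deriv c)
    have h4 := HasD.apply (X' := fun p => evenCoder (u p) ∘ₗ K p - oddCoder 𝒜 (w p) ∘ₗ Q p)
      hK.deriv (HasD.comp_zero_fst (h.deriv_oddCoder c).mem)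
    refine ((h1.sub h2).add (h3.add h4)).congr_deriv (funext fun p => ?_)
    have h5 := h.curvature_coder (Q p c) (hV' _) (hU' _) p
    have h6 := LinearMap.congr_fun (hQ.coder_comp h.toIsIsotopy p) c
    simp only [LinearMap.comp_apply] at h6
    rw [sub_eq_iff_eq_add] at h5
    simp only [Pi.add_apply, Pi.sub_apply, Pi.zero_apply, _root_.map_zero, LinearMap.sub_apply,
      LinearMap.comp_apply, add_zero, _root_.map_add, _root_.map_sub, ← h6, h5]
    abel
  -- At time 0 the flow is the identity for all `s` and `K` is zero, so both sides vanish.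
  · have h1 := (hf.comp (ψ := fun p : ℝ × ℝ => ((0 : ℝ), p.2)) (v' := (0, 1))
      (contDiff_const.prodMk contDiff_snd) (fun p t => by simp))
    simp only [hQ.init] at h1
    have h2 := congr_fun (h1.unique (HasD.const _ _)) (0, s)
    simp only at h2
    simp [h2, hQ.init, hK.init]

end IsSecondFlow
end Squares

/-! ### Elementary closure properties of degrees -/

section Degrees

variable {A B : Type*} [AddCommGroup A] [Module ℂ A] [AddCommGroup B] [Module ℂ B]
variable {𝒜 : ℤ → Submodule ℂ A} {ℬ : ℤ → Submodule ℂ B} {e : ℤ} {k : ℕ}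
  {f g : MultilinearMap ℂ (fun _ : Fin k => A) B}

theorem HasDegree.add (hf : HasDegree 𝒜 ℬ e f) (hg : HasDegree 𝒜 ℬ e g) :
    HasDegree 𝒜 ℬ e (f + g) := fun d x hx => add_mem (hf d x hx) (hg d x hx)

theorem HasDegree.smul (a : ℂ) (hf : HasDegree 𝒜 ℬ e f) : HasDegree 𝒜 ℬ e (a • f) :=
  fun d x hx => Submodule.smul_mem _ a (hf d x hx)

theorem HasDegree.zero : HasDegree 𝒜 ℬ e (0 : MultilinearMap ℂ (fun _ : Fin k => A) B) :=
  fun _ _ _ => zero_mem _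

theorem koszul_mem (𝒜 : ℤ → Submodule ℂ A) [DirectSum.Decomposition 𝒜] {d : ℤ} {x : A}
    (hx : x ∈ 𝒜 d) : koszul 𝒜 x ∈ 𝒜 d := by
  rw [koszul_eq_scale, scale_of_mem 𝒜 _ hx]
  exact Submodule.smul_mem _ _ hx

end Degrees

/-! ### Degree of the bar differential -/

section BarDifferential

variable {A : Type*} [NonUnitalRing A] [Module ℂ A] [IsScalarTower ℂ A A] [SMulCommClass ℂ A A]
  (𝒜 : ℤ → Submodule ℂ A) [DirectSum.Decomposition 𝒜] [SetLike.GradedMul 𝒜] {D : A →ₗ[ℂ] A}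

theorem hasDegree_barDifferential (G : AddSubmonoid ℝ≥0) (hD : IsDGDifferential 𝒜 D) (k : ℕ)
    (β : G) : HasDegree 𝒜 𝒜 1 (barDifferential G 𝒜 D k β) := by
  by_cases hβ : β = 0
  · match k with
    | 0 => simpa [barDifferential, hβ] using HasDegree.zero
    | 1 =>
      intro d x hx
      have := hD.degree _ _ (hx 0)
      simpa [barDifferential, hβ] using this
    | 2 =>
      intro d x hx
      have := neg_mem (SetLike.GradedMul.mul_mem (koszul_mem 𝒜 (hx 0)) (hx 1))
      have h2 : ∑ a, (d a - 1) + 1 + 1 = d 0 + d 1 := by rw [Fin.sum_univ_two]; ring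
      simp only [barDifferential, hβ, if_true, h2]
      exact this
    | k + 3 => simpa [barDifferential, hβ] using HasDegree.zero
  · simpa [barDifferential, hβ] using HasDegree.zero

end BarDifferential

/-! ### Pulling a pseudo-isotopy back to the plane -/

section Pullback

theorem IsSmooth.comp_mem {A : Type*} [AddCommGroup A] [Module ℂ A] {f : ℝ × ℝ → A}
    (hf : IsSmooth f) {Ψ : ℝ × ℝ → ℝ × ℝ} (hΨ : ContDiff ℝ ∞ Ψ) (hT : ∀ p, Ψ p ∈ triangle) :
    (fun p => f (Ψ p)) ∈ Sm (ℝ × ℝ) A := by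
  obtain ⟨n, c, w, hc, hf⟩ := hf
  have : (fun p => f (Ψ p)) = ∑ i, fun p => c i (Ψ p) • w i := by
    ext p; rw [hf _ (hT p), Finset.sum_apply]
  rw [this]
  exact Submodule.sum_mem _ fun i _ =>
    smul_const_mem_finSums (mem_smoothFun.2 ((hc i).comp_contDiff hΨ hT)) _

theorem IsSmooth.contDiffOn {A : Type*} [AddCommGroup A] [Module ℂ A] {f : ℝ × ℝ → A}
    (hf : IsSmooth f) (l : Module.Dual ℂ A) : ContDiffOn ℝ ∞ (fun p => l (f p)) triangle := by
  obtain ⟨n, c, w, hc, hf⟩ := hf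
  refine ContDiffOn.congr (f := fun p => ∑ i, c i p * l (w i))
    (ContDiffOn.sum fun i _ => (hc i).mul contDiffOn_const) fun p hp => ?_
  rw [hf p hp, map_sum]
  simp

/-- As `Ψ` maps the whole plane into the triangle, derivatives within the triangle compose to
genuine derivatives on the plane, and boundary points need no separate treatment. -/
theorem hasLineDerivAt_pullback {φ : ℝ × ℝ → ℂ} (hφ : ContDiffOn ℝ ∞ φ triangle)
    {Ψ : ℝ × ℝ → ℝ × ℝ} (hΨ : ContDiff ℝ ∞ Ψ) (hT : ∀ p, Ψ p ∈ triangle) (v p : ℝ × ℝ) :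
    HasLineDerivAt ℝ (fun q => φ (Ψ q))
      (((fderiv ℝ Ψ p v).1 : ℂ) * fderivWithin ℝ φ triangle (Ψ p) (1, 0) +
        ((fderiv ℝ Ψ p v).2 : ℂ) * fderivWithin ℝ φ triangle (Ψ p) (0, 1)) p v := by
  have h1 := ((hφ.differentiableOn (by simp)) (Ψ p) (hT p)).hasFDerivWithinAt
  have h2 := (hΨ.differentiable (by simp) p).hasFDerivAt
  have h3 := (h1.comp_hasFDerivAt p h2 (Filter.Eventually.of_forall hT)).hasLineDerivAt v
  have h5 : ((fderiv ℝ Ψ p v).1 : ℂ) * fderivWithin ℝ φ triangle (Ψ p) (1, 0) +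
      ((fderiv ℝ Ψ p v).2 : ℂ) * fderivWithin ℝ φ triangle (Ψ p) (0, 1) =
      (fderivWithin ℝ φ triangle (Ψ p) ∘L fderiv ℝ Ψ p) v := ?_
  · rw [h5]; exact h3
  have h4 : fderiv ℝ Ψ p v = (fderiv ℝ Ψ p v).1 • ((1 : ℝ), (0 : ℝ)) +
      (fderiv ℝ Ψ p v).2 • ((0 : ℝ), (1 : ℝ)) := by ext <;> simp
  rw [ContinuousLinearMap.comp_apply]
  conv_rhs => rw [h4, map_add, map_smul, map_smul]
  simp

variable {G : AddSubmonoid ℝ≥0} {A : Type*} [NonUnitalRing A] [Module ℂ A]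

/-- The contraction of the pull-back of the one-form `h₁ dt₁ + h₂ dt₂` along `Ψ` with `v`. -/
def TriangleForm.pullback (α : TriangleForm G A) (Ψ : ℝ × ℝ → ℝ × ℝ) (v p : ℝ × ℝ) : Fam G A A :=
  ((fderiv ℝ Ψ p v).1 : ℂ) • α.h₁ (Ψ p) + ((fderiv ℝ Ψ p v).2 : ℂ) • α.h₂ (Ψ p)

/-- A directional derivative depends only on the restriction of the map to a line. -/
theorem fderiv_congr {Ψ Φ : ℝ × ℝ → ℝ × ℝ} (hΨ : ContDiff ℝ ∞ Ψ) (hΦ : ContDiff ℝ ∞ Φ)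
    {p q v w : ℝ × ℝ} (h : ∀ t : ℝ, Ψ (p + t • v) = Φ (q + t • w)) :
    fderiv ℝ Ψ p v = fderiv ℝ Φ q w := by
  rw [← (hΨ.differentiable (by simp) p).lineDeriv_eq_fderiv,
    ← (hΦ.differentiable (by simp) q).lineDeriv_eq_fderiv, lineDeriv, lineDeriv]
  simp only [h]

theorem TriangleForm.pullback_congr (α : TriangleForm G A) {Ψ Φ : ℝ × ℝ → ℝ × ℝ}
    (hΨ : ContDiff ℝ ∞ Ψ) (hΦ : ContDiff ℝ ∞ Φ) {p q v w : ℝ × ℝ}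
    (h : ∀ t : ℝ, Ψ (p + t • v) = Φ (q + t • w)) :
    α.pullback Ψ v p = α.pullback Φ w q := by
  have h0 := h 0
  simp only [zero_smul, add_zero] at h0
  rw [pullback, pullback, fderiv_congr hΨ hΦ h, h0]

/-- The Jacobian determinant. -/
def jacobian (Ψ : ℝ × ℝ → ℝ × ℝ) (p : ℝ × ℝ) : ℂ :=
  ((fderiv ℝ Ψ p (1, 0)).1 : ℂ) * ((fderiv ℝ Ψ p (0, 1)).2 : ℂ) -
    ((fderiv ℝ Ψ p (1, 0)).2 : ℂ) * ((fderiv ℝ Ψ p (0, 1)).1 : ℂ)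

theorem HasD.fderiv_fst {Ψ : ℝ × ℝ → ℝ × ℝ} (hΨ : ContDiff ℝ ∞ Ψ) (v : ℝ × ℝ) :
    HasD v (fun p => ((Ψ p).1 : ℂ)) (fun p => ((fderiv ℝ Ψ p v).1 : ℂ)) := by
  have hc : ContDiff ℝ ∞ fun p => ((Ψ p).1 : ℂ) :=
    Complex.ofRealCLM.contDiff.comp (contDiff_fst.comp hΨ)
  refine (HasD.of_contDiff hc v).congr_deriv (funext fun p => ?_)
  have h := (Complex.ofRealCLM.hasFDerivAt (x := (Ψ p).1)).comp p
    ((hasFDerivAt_fst (p := Ψ p)).comp p (hΨ.differentiable (by simp) p).hasFDerivAt)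
  exact congr_arg (fun L => L v) h.fderiv

theorem HasD.fderiv_snd {Ψ : ℝ × ℝ → ℝ × ℝ} (hΨ : ContDiff ℝ ∞ Ψ) (v : ℝ × ℝ) :
    HasD v (fun p => ((Ψ p).2 : ℂ)) (fun p => ((fderiv ℝ Ψ p v).2 : ℂ)) := by
  have hc : ContDiff ℝ ∞ fun p => ((Ψ p).2 : ℂ) :=
    Complex.ofRealCLM.contDiff.comp (contDiff_snd.comp hΨ)
  refine (HasD.of_contDiff hc v).congr_deriv (funext fun p => ?_)
  have h := (Complex.ofRealCLM.hasFDerivAt (x := (Ψ p).2)).comp p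
    ((hasFDerivAt_snd (p := Ψ p)).comp p (hΨ.differentiable (by simp) p).hasFDerivAt)
  exact congr_arg (fun L => L v) h.fderiv

theorem HasD.exists_mixed {P E : Type*} [NormedAddCommGroup P] [NormedSpace ℝ P] [AddCommGroup E]
    [Module ℂ E] {v w : P} {f f' g' : P → E} (hf : HasD v f f')
    (hg : HasD w f g') : ∃ a, HasD w f' a ∧ HasD v g' a := by
  obtain ⟨a, ha⟩ := HasD.exists_of_mem w hf.mem'
  obtain ⟨b, hb⟩ := HasD.exists_of_mem v hg.mem'
  exact ⟨a, ha, hb.congr_deriv (hf.symm hg ha hb).symm⟩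

theorem HasD.exists_pullback {A : Type*} [AddCommGroup A] [Module ℂ A] {f : ℝ × ℝ → A}
    (hf : IsSmooth f) {Ψ : ℝ × ℝ → ℝ × ℝ} (hΨ : ContDiff ℝ ∞ Ψ) (hT : ∀ p, Ψ p ∈ triangle) (v : ℝ × ℝ) :
    ∃ f', HasD v (fun p => f (Ψ p)) f' ∧ ∀ (l : Module.Dual ℂ A) p, l (f' p) =
      ((fderiv ℝ Ψ p v).1 : ℂ) * fderivWithin ℝ (fun q => l (f q)) triangle (Ψ p) (1, 0) +
        ((fderiv ℝ Ψ p v).2 : ℂ) * fderivWithin ℝ (fun q => l (f q)) triangle (Ψ p) (0, 1) := by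
  obtain ⟨f', hf'⟩ := HasD.exists_of_mem v (hf.comp_mem hΨ hT)
  exact ⟨f', hf', fun l p => (hf'.deriv l p).unique
    (hasLineDerivAt_pullback (hf.contDiffOn l) hΨ hT v p)⟩

variable [HasAntidiagonal G] {𝒜 : ℤ → Submodule ℂ A} [DirectSum.Decomposition 𝒜]

theorem evenCoder_add (f g : Fam G A A) : evenCoder (f + g) = evenCoder f + evenCoder g := by
  rw [evenCoder, Bar.toLin_add, Bar.ins_add]; rfl

theorem evenCoder_smul (a : ℂ) (f : Fam G A A) : evenCoder (a • f) = a • evenCoder f := by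
  rw [evenCoder, Bar.toLin_smul, Bar.ins_smul]; rfl

theorem oddCoder_smul (a : ℂ) (f : Fam G A A) : oddCoder 𝒜 (a • f) = a • oddCoder 𝒜 f := by
  rw [oddCoder, Bar.toLin_smul, Bar.ins_smul]; rfl

variable [IsScalarTower ℂ A A] [SMulCommClass ℂ A A] [SetLike.GradedMul 𝒜] {D : A →ₗ[ℂ] A}

/-- The Maurer–Cartan equation is natural under pull-back. The bracket of the contracted one-forms
and the exterior derivative both acquire the Jacobian determinant as a factor, which is also the
factor of the two-form. -/
theorem IsTwoPseudoIsotopy.isFlatSquare (hD : IsDGDifferential 𝒜 D) {α : TriangleForm G A}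
    (hα : IsTwoPseudoIsotopy 𝒜 D α) {Ψ : ℝ × ℝ → ℝ × ℝ} (hΨ : ContDiff ℝ ∞ Ψ)
    (hT : ∀ p, Ψ p ∈ triangle) :
    IsFlatSquare 𝒜 (fun p => barDifferential G 𝒜 D + α.m (Ψ p)) (α.pullback Ψ (1, 0))
      (α.pullback Ψ (0, 1)) (fun p => jacobian Ψ p • α.g (Ψ p)) := by
  have hs : ∀ v c, (fun p => Bar.toLin (α.pullback Ψ v p) c) ∈ Sm (ℝ × ℝ) A := fun v c => by
    have h1 := smul_mem_finSums (dual_mem_of_mem_finSums (HasD.fderiv_fst hΨ v).mem' LinearMap.id)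
      (toLin_mem_finSums (fun k β x => (hα.smooth k β x).2.1.comp_mem hΨ hT) c)
    have h2 := smul_mem_finSums (dual_mem_of_mem_finSums (HasD.fderiv_snd hΨ v).mem' LinearMap.id)
      (toLin_mem_finSums (fun k β x => (hα.smooth k β x).2.2.1.comp_mem hΨ hT) c)
    have h3 := add_mem h1 h2
    simp only [LinearMap.id_apply] at h3
    simp only [TriangleForm.pullback, Bar.toLin_add, Bar.toLin_smul, LinearMap.add_apply,
      LinearMap.smul_apply]
    exact h3
  have hj : (fun p => jacobian Ψ p) ∈ smoothFun (ℝ × ℝ) :=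
    sub_mem (mul_mem (dual_mem_of_mem_finSums (HasD.fderiv_fst hΨ _).mem' LinearMap.id)
      (dual_mem_of_mem_finSums (HasD.fderiv_snd hΨ _).mem' LinearMap.id))
      (mul_mem (dual_mem_of_mem_finSums (HasD.fderiv_snd hΨ _).mem' LinearMap.id)
      (dual_mem_of_mem_finSums (HasD.fderiv_fst hΨ _).mem' LinearMap.id))
  refine ⟨⟨?_, ?_, hs _, ?_, ?_⟩, ?_, ?_, ?_, hs _, ?_⟩
  · exact fun p k β => ((hα.degree_h₁ _ (hT p) k β).smul _).add ((hα.degree_h₂ _ (hT p) k β).smul _)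
  · intro p k
    have := hα.positive _ (hT p) k
    simp [TriangleForm.pullback, this]
  · exact fun p k β => (hasDegree_barDifferential 𝒜 G hD k β).add (hα.degree_m _ (hT p) k β)
  · refine HasD.of_word (X := fun p => Bar.toLin (barDifferential G 𝒜 D + α.m (Ψ p)))
      (X' := fun p => Bar.toLin (α.pullback Ψ (1, 0) p) ∘ₗ
        oddCoder 𝒜 (barDifferential G 𝒜 D + α.m (Ψ p)) -
        Bar.toLin (barDifferential G 𝒜 D + α.m (Ψ p)) ∘ₗ
          evenCoder (α.pullback Ψ (1, 0) p)) fun n x β => ?_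
    obtain ⟨f', hf', hl⟩ := HasD.exists_pullback (hα.smooth n β fun a => x a).1 hΨ hT (1, 0)
    refine ((HasD.const (1, 0) (Bar.toLin (barDifferential G 𝒜 D) (Bar.word n x β))).add
      hf').congr (funext fun p => ?_) |>.congr_deriv (funext fun p => eq_of_forall_dual fun l => ?_)
    · simp [Bar.toLin_add, Bar.toLin_word]
    · have h1 := hα.mc_one _ (hT p) n β x l
      have h2 := hα.mc_two _ (hT p) n β x l
      rw [← evenCoder_apply_word, ← oddCoder_apply_word] at h1 h2
      simp only [Pi.add_apply, zero_add, hl, h1, h2, TriangleForm.pullback, evenCoder_add,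
        evenCoder_smul, Bar.toLin_add (_ • _), Bar.toLin_smul, LinearMap.sub_apply,
        LinearMap.comp_apply, LinearMap.add_apply, LinearMap.smul_apply, _root_.map_add,
        _root_.map_smul, _root_.map_sub, smul_eq_mul]
      ring
  · exact fun p k β => (hα.degree_g _ (hT p) k β).smul _
  · intro p k
    have := hα.positive _ (hT p) k
    simp [this]
  · intro c
    have h1 := smul_mem_finSums hj
      (toLin_mem_finSums (fun k β x => (hα.smooth k β x).2.2.2.comp_mem hΨ hT) c)
    simpa [Bar.toLin_smul] using h1
  · intro c f g hf hg p
    obtain ⟨v', hv'⟩ := HasD.exists_operator (1, 0) (hs (0, 1))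
    obtain ⟨u', hu'⟩ := HasD.exists_operator (0, 1) (hs (1, 0))
    rw [hf.unique (hv' c), hg.unique (hu' c)]
    clear hf hg
    set b := barDifferential G 𝒜 D + α.m (Ψ p)
    set u := α.pullback Ψ (1, 0) p with hu
    set v := α.pullback Ψ (0, 1) p with hv
    suffices v' p - u' p = (Bar.toLin u ∘ₗ evenCoder v - Bar.toLin v ∘ₗ evenCoder u) +
        (Bar.toLin b ∘ₗ oddCoder 𝒜 (jacobian Ψ p • α.g (Ψ p)) +
          Bar.toLin (jacobian Ψ p • α.g (Ψ p)) ∘ₗ oddCoder 𝒜 b) from LinearMap.congr_fun this c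
    refine Bar.hom_ext_word fun n x β => ?_
    -- The second derivatives of `Ψ` appear in both ∂ₜv and ∂ₛu; using the same `a₁`, `a₂` for both
    -- makes them drop out of the difference.
    obtain ⟨a₁, ha₁, ha₁'⟩ := HasD.exists_mixed (HasD.fderiv_fst hΨ (1, 0))
      (HasD.fderiv_fst hΨ (0, 1))
    obtain ⟨a₂, ha₂, ha₂'⟩ := HasD.exists_mixed (HasD.fderiv_snd hΨ (1, 0))
      (HasD.fderiv_snd hΨ (0, 1))
    have hs₁ := (hα.smooth n β fun a => x a).2.1
    have hs₂ := (hα.smooth n β fun a => x a).2.2.1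
    obtain ⟨p₁, hp₁, hl₁⟩ := HasD.exists_pullback hs₁ hΨ hT (1, 0)
    obtain ⟨q₁, hq₁, hm₁⟩ := HasD.exists_pullback hs₁ hΨ hT (0, 1)
    obtain ⟨p₂, hp₂, hl₂⟩ := HasD.exists_pullback hs₂ hΨ hT (1, 0)
    obtain ⟨q₂, hq₂, hm₂⟩ := HasD.exists_pullback hs₂ hΨ hT (0, 1)
    have hw : ∀ w, (fun p => Bar.toLin (α.pullback Ψ w p) (Bar.word n x β)) =
        (fun p => ((fderiv ℝ Ψ p w).1 : ℂ) • α.h₁ (Ψ p) n β fun a => x a) +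
          fun p => ((fderiv ℝ Ψ p w).2 : ℂ) • α.h₂ (Ψ p) n β fun a => x a := by
      intro w
      ext p
      simp [TriangleForm.pullback, Bar.toLin_add, Bar.toLin_word]
    have hv₁ := congr_fun ((((ha₁'.smul hp₁).add (ha₂'.smul hp₂)).congr (hw _).symm).unique
      (hv' (Bar.word n x β))) p
    have hu₁ := congr_fun ((((ha₁.smul hq₁).add (ha₂.smul hq₂)).congr (hw _).symm).unique
      (hu' (Bar.word n x β))) p
    refine eq_of_forall_dual fun l => ?_
    have h1 := hα.mc_one_two _ (hT p) n β x l
    rw [← evenCoder_apply_word, ← evenCoder_apply_word, ← oddCoder_apply_word,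
      ← oddCoder_apply_word, sub_eq_iff_eq_add] at h1
    rw [LinearMap.sub_apply, ← hv₁, ← hu₁]
    simp only [Pi.add_apply, _root_.map_sub, _root_.map_add, _root_.map_smul, hl₁, hl₂, hm₁, hm₂,
      h1, hu, hv, TriangleForm.pullback, evenCoder_add, evenCoder_smul, oddCoder_smul,
      Bar.toLin_add (_ • _), Bar.toLin_smul, LinearMap.sub_apply,
      LinearMap.comp_apply, LinearMap.add_apply, LinearMap.smul_apply, smul_eq_mul, jacobian]
    ring

end Pullback

/-! ### The sweep of the triangle by segments ending at the vertex 2 -/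

section SquareMaps

/-- A smooth map from the plane to the triangle which contracts the edge `t = 1` of the unit
square to the vertex `2`. -/
def squareMap (p : ℝ × ℝ) : ℝ × ℝ :=
  ((1 - Real.smoothTransition p.1) * Real.smoothTransition p.2, Real.smoothTransition p.1)

/-- A smooth parametrisation of the face opposite to the vertex `2`. -/
def edgeMap (p : ℝ × ℝ) : ℝ × ℝ := (Real.smoothTransition p.1, 0)

theorem contDiff_squareMap : ContDiff ℝ ∞ squareMap := by
  have h1 : ContDiff ℝ ∞ fun p : ℝ × ℝ => Real.smoothTransition p.1 :=
    Real.smoothTransition.contDiff.comp contDiff_fst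
  have h2 : ContDiff ℝ ∞ fun p : ℝ × ℝ => Real.smoothTransition p.2 :=
    Real.smoothTransition.contDiff.comp contDiff_snd
  exact ((contDiff_const.sub h1).mul h2).prodMk h1

theorem contDiff_edgeMap : ContDiff ℝ ∞ edgeMap :=
  (Real.smoothTransition.contDiff.comp contDiff_fst).prodMk contDiff_const

theorem squareMap_mem (p : ℝ × ℝ) : squareMap p ∈ triangle := by
  have h1 := Real.smoothTransition.nonneg p.1
  have h2 := Real.smoothTransition.le_one p.1
  have h3 := Real.smoothTransition.nonneg p.2
  have h4 := Real.smoothTransition.le_one p.2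
  refine ⟨mul_nonneg (by linarith) h3, h1, ?_⟩
  simp only [squareMap]
  nlinarith

theorem edgeMap_mem (p : ℝ × ℝ) : edgeMap p ∈ triangle := by
  have h1 := Real.smoothTransition.nonneg p.1
  have h2 := Real.smoothTransition.le_one p.1
  exact ⟨h1, le_rfl, by simpa [edgeMap] using h2⟩

variable {G : AddSubmonoid ℝ≥0} {A : Type*} [NonUnitalRing A] [Module ℂ A]

/-- The starting points of the segments run along the edge 01 with the parametrisation `edgeMap`, so
the velocity here is the one generating the flow along that edge. -/
theorem TriangleForm.pullback_squareMap_left (α : TriangleForm G A) (s : ℝ) :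
    α.pullback squareMap (0, 1) (0, s) = α.pullback edgeMap (1, 0) (s, 0) :=
  α.pullback_congr contDiff_squareMap contDiff_edgeMap fun t => by simp [squareMap, edgeMap]

/-- All segments end at the same vertex, so the velocity is zero there. -/
theorem TriangleForm.pullback_squareMap_right (α : TriangleForm G A) (s : ℝ) :
    α.pullback squareMap (0, 1) (1, s) = 0 := by
  have h := α.pullback_congr (p := (1, s)) (v := (0, 1)) (w := 0) (q := 0) contDiff_squareMap
    (Φ := fun _ => (0, 1)) contDiff_const (fun t => by simp [squareMap])
  rw [h]
  simp [pullback]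

end SquareMaps

/-! ### The homotopy between the two transports -/

section Homotopies

variable {G : AddSubmonoid ℝ≥0} {A : Type*} [HasAntidiagonal G]

/-- A homotopy `W s` of morphisms of coalgebras with differentials, generated by coderivations
`L s` along `W s`. -/
structure IsCoalgHomotopy [AddCommGroup A] [Module ℂ A] (𝒜 : ℤ → Submodule ℂ A)
    [DirectSum.Decomposition 𝒜] (m₀ m₁ : Fam G A A) (W L : ℝ → Module.End ℂ (Bar G A)) : Prop where
  isCoalgMap : ∀ s, Bar.IsCoalgMap (W s)
  apply_e_zero : ∀ s, W s (Bar.e 0) = Bar.e 0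
  map_scale : ∀ a s, Bar.map (scale 𝒜 a) ∘ₗ W s = W s ∘ₗ Bar.map (scale 𝒜 a)
  comm : ∀ s, oddCoder 𝒜 m₁ ∘ₗ W s = W s ∘ₗ oddCoder 𝒜 m₀
  comul_eq : ∀ s c, Bar.comul (L s c) = TensorProduct.map (L s) (W s) (Bar.comul c) +
    TensorProduct.map (Bar.map (koszul 𝒜) ∘ₗ W s) (L s) (Bar.comul c)
  scalar_eq : ∀ s c, Bar.scalar (L s c) = 0
  apply_e_zero' : ∀ s, L s (Bar.e 0) = 0
  map_scale' : ∀ a s, Bar.map (scale 𝒜 a) ∘ₗ L s =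
    ((a ^ (-1 : ℤ) : ℂˣ) : ℂ) • L s ∘ₗ Bar.map (scale 𝒜 a)
  smooth : ∀ c, (fun s => L s c) ∈ Sm ℝ (Bar G A)
  deriv : ∀ c, HasD (1 : ℝ) (fun s => W s c) fun s =>
    oddCoder 𝒜 m₁ (L s c) + L s (oddCoder 𝒜 m₀ c)

variable [NonUnitalRing A] [Module ℂ A] [IsScalarTower ℂ A A] [SMulCommClass ℂ A A]
  {𝒜 : ℤ → Submodule ℂ A} [DirectSum.Decomposition 𝒜] [SetLike.GradedMul 𝒜]
  {D : A →ₗ[ℂ] A}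

/-- Each `W s` is the transport along a broken path: along the edge from the vertex 0 to the point
`edgeMap (s, 0)`, then along the segment to the vertex 2. Its end points do not move, so its
variation comes from the two-form alone. -/
theorem IsTwoPseudoIsotopy.isCoalgHomotopy (hD : IsDGDifferential 𝒜 D) {α : TriangleForm G A}
    (hα : IsTwoPseudoIsotopy 𝒜 D α) {Q K R : ℝ × ℝ → Module.End ℂ (Bar G A)}
    (hQ : IsFlow (α.pullback squareMap (1, 0)) Q)
    (hK : IsSecondFlow 𝒜 (α.pullback squareMap (1, 0))
      (fun p => jacobian squareMap p • α.g (squareMap p)) Q K)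
    (hR : IsFlow (α.pullback edgeMap (1, 0)) R) :
    IsCoalgHomotopy 𝒜 (barDifferential G 𝒜 D + α.m (vertex 0))
      (barDifferential G 𝒜 D + α.m (vertex 2)) (fun s => Q (1, s) ∘ₗ R (s, 0))
      (fun s => K (1, s) ∘ₗ R (s, 0)) := by
  have h := hα.isFlatSquare hD contDiff_squareMap squareMap_mem
  have h' := (hα.isFlatSquare hD contDiff_edgeMap edgeMap_mem).toIsIsotopy
  have hv0 : vertex 0 = edgeMap (0, 0) := by simp [vertex, edgeMap]
  have hv2 : ∀ s, squareMap (1, s) = vertex 2 := by simp [vertex, squareMap]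
  have he : ∀ s, squareMap (0, s) = edgeMap (s, 0) := by simp [edgeMap, squareMap]
  have hRB : ∀ s c, oddCoder 𝒜 (barDifferential G 𝒜 D + α.m (squareMap (0, s))) (R (s, 0) c) =
      R (s, 0) (oddCoder 𝒜 (barDifferential G 𝒜 D + α.m (vertex 0)) c) := by
    intro s c
    rw [he, hv0]
    exact LinearMap.congr_fun (hR.coder_comp h' (s, 0)) c
  have hRs : ∀ c, HasD (1 : ℝ) (fun s : ℝ => R (s, 0) c)
      (fun s => evenCoder (α.pullback edgeMap (1, 0) (s, 0)) (R (s, 0) c)) := fun c =>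
    (hR.deriv c).comp (ψ := fun s : ℝ => (s, (0 : ℝ))) (contDiff_id.prodMk contDiff_const)
      (fun p t => by simp)
  have hψ : ContDiff ℝ ∞ fun s : ℝ => ((1 : ℝ), s) := contDiff_const.prodMk contDiff_id
  constructor
  · exact fun s => (hQ.isCoalgMap h.toIsIsotopy _).comp (hR.isCoalgMap h' _)
  · intro s
    rw [LinearMap.comp_apply, hR.apply_e_zero h', hQ.apply_e_zero h.toIsIsotopy]
  · intro a s
    rw [← LinearMap.comp_assoc, hQ.map_scale_comp h.toIsIsotopy, LinearMap.comp_assoc,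
      hR.map_scale_comp h', LinearMap.comp_assoc]
  · intro s
    ext c
    have := LinearMap.congr_fun (hQ.coder_comp h.toIsIsotopy (1, s)) (R (s, 0) c)
    simp only [LinearMap.comp_apply, hv2] at this ⊢
    rw [this, hRB]
  · intro s c
    have hmm : ∀ (f g : Module.End ℂ (Bar G A)) z,
        TensorProduct.map f g (TensorProduct.map (R (s, 0)) (R (s, 0)) z) =
          TensorProduct.map (f ∘ₗ R (s, 0)) (g ∘ₗ R (s, 0)) z := fun f g z => by
      rw [TensorProduct.map_comp]; rfl
    rw [LinearMap.comp_apply, hK.comul_eq hQ h, hR.comul_eq h', hmm, hmm, LinearMap.comp_assoc]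
  · intro s c
    rw [LinearMap.comp_apply, hK.scalar_eq]
  · intro s
    rw [LinearMap.comp_apply, hR.apply_e_zero h', hK.apply_e_zero hQ h]
  · intro a s
    rw [← LinearMap.comp_assoc, hK.map_scale_comp hQ h, LinearMap.smul_comp, LinearMap.comp_assoc,
      hR.map_scale_comp h', LinearMap.comp_assoc]
  · intro c
    exact apply_mem_finSums (X := fun s => K (1, s))
      (fun c => comp_mem_finSums (ψ := fun s : ℝ => ((1 : ℝ), s))
        (fun _ hc => ContDiff.comp hc hψ) (hK.deriv c).mem) (hRs c).mem
  · intro c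
    -- The boundary term at the vertex 2 has dropped out; the one on the edge remains and will
    -- cancel against the derivative of `R`.
    have hQs : ∀ c, HasD (1 : ℝ) (fun s => Q (1, s) c) fun s =>
        (oddCoder 𝒜 (barDifferential G 𝒜 D + α.m (vertex 2)) ∘ₗ K (1, s) +
          K (1, s) ∘ₗ oddCoder 𝒜 (barDifferential G 𝒜 D + α.m (squareMap (0, s))) -
          Q (1, s) ∘ₗ evenCoder (α.pullback edgeMap (1, 0) (s, 0))) c := fun c => by
      refine ((hK.deriv_snd hQ h c).comp (ψ := fun s : ℝ => ((1 : ℝ), s)) hψ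
        (v' := 1) (fun p t => by simp)).congr_deriv (funext fun s => ?_)
      have h0 : evenCoder (0 : Fam G A A) = 0 := by
        have := evenCoder_smul (0 : ℂ) (0 : Fam G A A)
        rwa [zero_smul, zero_smul] at this
      simp only [hv2, α.pullback_squareMap_left, α.pullback_squareMap_right, h0,
        LinearMap.zero_apply, LinearMap.add_apply, LinearMap.sub_apply, LinearMap.comp_apply]
      abel
    refine (HasD.apply (X' := fun s =>
      (oddCoder 𝒜 (barDifferential G 𝒜 D + α.m (vertex 2)) ∘ₗ K (1, s) +
          K (1, s) ∘ₗ oddCoder 𝒜 (barDifferential G 𝒜 D + α.m (squareMap (0, s))) -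
          Q (1, s) ∘ₗ evenCoder (α.pullback edgeMap (1, 0) (s, 0)))) hQs (hRs c)).congr_deriv
      (funext fun s => ?_)
    simp only [LinearMap.add_apply, LinearMap.sub_apply, LinearMap.comp_apply, hRB]
    abel

end Homotopies

/-! ### Smooth curves: differentiation, integration and pointwise operations -/

section Curves

variable {A B : Type*} [AddCommGroup A] [Module ℂ A] [AddCommGroup B] [Module ℂ B]

/-- The curve is translated to start at `r` and regarded as a function on the plane, where the
result is already known. -/
theorem HasD.mem_of_mem_line {f f' : ℝ → A} (h : HasD 1 f f') {L : Submodule ℂ A} {r : ℝ}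
    (h0 : f r ∈ L) (h' : ∀ s, f' s ∈ L) (s : ℝ) : f s ∈ L := by
  have h1 : HasD (1, 0) (fun p : ℝ × ℝ => f (p.1 + r)) fun p => f' (p.1 + r) :=
    h.comp (ψ := fun p : ℝ × ℝ => p.1 + r) (contDiff_fst.add contDiff_const)
      fun p t => by simp; ring
  have := h1.mem_of_mem (L := L) (fun s => by simpa using h0) (fun p => h' _) (s - r, 0)
  simpa using this

theorem HasD.eq_of_deriv_zero_line {f : ℝ → A} (h : HasD 1 f 0) (r s : ℝ) : f s = f r := by
  have h1 : HasD 1 (f - fun _ => f r) 0 := (h.sub (HasD.const 1 (f r))).congr_deriv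
    (funext fun s => by simp)
  have := h1.mem_of_mem_line (L := ⊥) (r := r) (by simp) (by simp) s
  simpa [sub_eq_zero] using this

variable (A) in
/-- The smooth curves in finite dimensional subspaces of `A`. -/
abbrev Curve : Type _ := Sm ℝ A

namespace Curve

/-- The curve obtained by applying a linear map. -/
def map (φ : A →ₗ[ℂ] B) : Curve A →ₗ[ℂ] Curve B where
  toFun f := ⟨fun r => φ (f.1 r), map_mem_finSums φ f.2⟩
  map_add' f g := by ext r; simp
  map_smul' a f := by ext r; simp

@[simp]
theorem map_apply (φ : A →ₗ[ℂ] B) (f : Curve A) (r : ℝ) : (map φ f).1 r = φ (f.1 r) := rfl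

variable (A) in
/-- The evaluation at a point. -/
def eval (r : ℝ) : Curve A →ₗ[ℂ] A where
  toFun f := f.1 r
  map_add' _ _ := rfl
  map_smul' _ _ := rfl

@[simp]
theorem eval_apply (r : ℝ) (f : Curve A) : eval A r f = f.1 r := rfl

theorem ext_eval {f g : Curve A} (h : ∀ r, eval A r f = eval A r g) : f = g :=
  Subtype.ext (funext h)

variable (A) in
/-- The constant curves. -/
def const : A →ₗ[ℂ] Curve A where
  toFun a := ⟨fun _ => a, const_mem_finSums a⟩
  map_add' _ _ := rfl
  map_smul' _ _ := rfl

@[simp]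
theorem const_apply (a : A) (r : ℝ) : (const A a).1 r = a := rfl

variable (A) in
theorem exists_deriv : ∃ d : Curve A →ₗ[ℂ] Curve A, ∀ f, HasD 1 f.1 (d f).1 := by
  choose d hd using fun f : Curve A => HasD.exists_of_mem (1 : ℝ) f.2
  refine ⟨⟨⟨fun f => ⟨d f, (hd f).mem'⟩, fun f g => ?_⟩, fun a f => ?_⟩, hd⟩
  · exact Subtype.ext ((hd (f + g)).unique ((hd f).add (hd g)))
  · exact Subtype.ext ((hd (a • f)).unique ((hd f).const_smul a))

variable (A) in
/-- The derivative of curves. -/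
def deriv : Curve A →ₗ[ℂ] Curve A := (exists_deriv A).choose

theorem hasD_deriv (f : Curve A) : HasD 1 f.1 (deriv A f).1 := (exists_deriv A).choose_spec f

theorem deriv_const (a : A) : deriv A (const A a) = 0 :=
  Subtype.ext ((hasD_deriv _).unique (HasD.const 1 a))

theorem deriv_map (φ : A →ₗ[ℂ] B) (f : Curve A) : deriv B (map φ f) = map φ (deriv A f) :=
  Subtype.ext ((hasD_deriv _).unique ((hasD_deriv f).map φ))

theorem exists_integral_apply (r : ℝ) (f : Curve A) :
    ∃ g : Curve A, HasD 1 g.1 f.1 ∧ g.1 r = 0 := by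
  obtain ⟨g, hg, -⟩ := exists_antiderivative (f := fun p : ℝ × ℝ => f.1 p.1)
    (comp_mem_finSums (ψ := Prod.fst) (fun c (hc : ContDiff ℝ ∞ c) =>
      (show ContDiff ℝ ∞ _ from hc.comp contDiff_fst)) f.2)
  have h := (hg.comp (ψ := fun s : ℝ => (s, (0 : ℝ))) (v' := 1) (contDiff_id.prodMk contDiff_const)
      (fun p t => by simp)).sub (HasD.const 1 (g (r, 0)))
  exact ⟨⟨_, h.mem⟩, h.congr_deriv (by ext s; simp), by simp⟩

theorem eq_of_deriv {f g h : Curve A} (hf : HasD 1 f.1 h.1) (hg : HasD 1 g.1 h.1) {r : ℝ}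
    (h0 : f.1 r = g.1 r) : f = g := by
  refine Subtype.ext (funext fun s => ?_)
  have h1 := ((hf.sub hg).congr_deriv (sub_self _)).eq_of_deriv_zero_line r s
  simpa [h0, sub_eq_zero] using h1

variable (A) in
theorem exists_integral (r : ℝ) : ∃ I : Curve A →ₗ[ℂ] Curve A,
    ∀ f, HasD 1 (I f).1 f.1 ∧ (I f).1 r = 0 := by
  choose d hd using fun f : Curve A => exists_integral_apply r f
  refine ⟨⟨⟨d, fun f g => ?_⟩, fun a f => ?_⟩, hd⟩
  · exact eq_of_deriv (h := f + g) (hd _).1 ((hd f).1.add (hd g).1) (r := r)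
      (by simp [(hd _).2])
  · exact eq_of_deriv (h := a • f) (hd _).1 ((hd f).1.const_smul a) (r := r)
      (by simp [(hd _).2])

variable (A) in
/-- The primitive that vanishes at `r`. -/
def integral (r : ℝ) : Curve A →ₗ[ℂ] Curve A := (exists_integral A r).choose

theorem hasD_integral (r : ℝ) (f : Curve A) : HasD 1 (integral A r f).1 f.1 :=
  ((exists_integral A r).choose_spec f).1

@[simp]
theorem integral_apply_self (r : ℝ) (f : Curve A) : (integral A r f).1 r = 0 :=
  ((exists_integral A r).choose_spec f).2

theorem deriv_integral (r : ℝ) (f : Curve A) : deriv A (integral A r f) = f :=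
  Subtype.ext ((hasD_deriv _).unique (hasD_integral r f))

theorem integral_deriv (r : ℝ) (f : Curve A) :
    integral A r (deriv A f) = f - const A (f.1 r) :=
  eq_of_deriv (hasD_integral r _) (((hasD_deriv f).sub (HasD.const 1 _)).congr_deriv
    (by ext s; simp)) (r := r) (by simp)

theorem integral_map (φ : A →ₗ[ℂ] B) (r : ℝ) (f : Curve A) :
    integral B r (map φ f) = map φ (integral A r f) :=
  eq_of_deriv (hasD_integral r _) ((hasD_integral r f).map φ) (r := r) (by simp)

theorem integral_mem {L : Submodule ℂ A} (r : ℝ) {f : Curve A} (hf : ∀ s, f.1 s ∈ L) (s : ℝ) :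
    (integral A r f).1 s ∈ L :=
  (hasD_integral r f).mem_of_mem_line (r := r) (by simp) hf s

variable {G : AddSubmonoid ℝ≥0}

/-- The pointwise application of a family to curves. -/
def fam (m : Fam G A B) : Fam G (Curve A) (Curve B) := fun k β =>
  { toFun := fun x => ⟨fun r => m k β fun i => (x i).1 r,
      multilinear_mem_finSums (fun _ => const_mem_finSums _) fun i => (x i).2⟩
    map_update_add' := fun x i f g => by
      ext r
      have h := (m k β).map_update_add (fun i => (x i).1 r) i (f.1 r) (g.1 r)
      have hu : ∀ y : Curve A, (fun j => (Function.update x i y j).1 r) =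
          Function.update (fun j => (x j).1 r) i (y.1 r) := fun y => by
        ext j; by_cases hj : j = i
        · subst hj; simp
        · simp [hj]
      simp only [Submodule.coe_add, Pi.add_apply, hu] at h ⊢
      exact h
    map_update_smul' := fun x i a f => by
      ext r
      have h := (m k β).map_update_smul (fun i => (x i).1 r) i a (f.1 r)
      have hu : ∀ y : Curve A, (fun j => (Function.update x i y j).1 r) =
          Function.update (fun j => (x j).1 r) i (y.1 r) := fun y => by
        ext j; by_cases hj : j = i
        · subst hj; simp
        · simp [hj]
      simp only [Submodule.coe_smul, Pi.smul_apply, hu] at h ⊢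
      exact h }

/-- Evaluations separate curves, so identities for `fam m` can be deduced point by point from those
for `m`. -/
theorem eval_comp_toLin_fam (m : Fam G A B) (r : ℝ) :
    eval B r ∘ₗ Bar.toLin (fam m) = Bar.toLin m ∘ₗ Bar.map (eval A r) :=
  Bar.hom_ext_word fun n x β => by
    simp only [LinearMap.comp_apply, Bar.map_word, Bar.toLin_word]
    rfl

end Curve
end Curves

/-! ### The grading of forms on the interval, with the one-form of degree one -/

section IntervalGrading

variable {A : Type*} [AddCommGroup A] [Module ℂ A] (𝒜 : ℤ → Submodule ℂ A)

/-- The grading of the differential forms on the interval with values in `A`. -/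
def intervalGrading (d : ℤ) : Submodule ℂ (Curve A × Curve A) where
  carrier := {x | (∀ r, x.1.1 r ∈ 𝒜 d) ∧ ∀ r, x.2.1 r ∈ 𝒜 (d - 1)}
  add_mem' hx hy := ⟨fun r => add_mem (hx.1 r) (hy.1 r), fun r => add_mem (hx.2 r) (hy.2 r)⟩
  zero_mem' := ⟨fun _ => zero_mem _, fun _ => zero_mem _⟩
  smul_mem' a _ hx := ⟨fun r => Submodule.smul_mem _ a (hx.1 r),
    fun r => Submodule.smul_mem _ a (hx.2 r)⟩

variable [DirectSum.Decomposition 𝒜]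

/-- The operator on differential forms that turns out to be multiplication by powers of `a`. -/
def intervalScale (a : ℂˣ) : Module.End ℂ (Curve A × Curve A) :=
  (Curve.map (scale 𝒜 a)).prodMap ((a : ℂ) • Curve.map (scale 𝒜 a))

theorem intervalScale_of_mem (a : ℂˣ) {d : ℤ} {x : Curve A × Curve A}
    (hx : x ∈ intervalGrading 𝒜 d) : intervalScale 𝒜 a x = ((a ^ (d - 1) : ℂˣ) : ℂ) • x := by
  refine Prod.ext (Subtype.ext (funext fun r => ?_)) (Subtype.ext (funext fun r => ?_))
  · exact scale_of_mem 𝒜 a (hx.1 r)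
  · refine (congr_arg ((a : ℂ) • ·) (scale_of_mem 𝒜 a (hx.2 r))).trans ?_
    rw [smul_smul, ← Units.val_mul, ← zpow_one_add]
    congr 3; ring

/-- The graded pieces lie in eigenspaces of one operator with pairwise distinct eigenvalues `2 ^ (d
- 1)`. -/
theorem iSupIndep_intervalGrading : iSupIndep (intervalGrading 𝒜) := by
  have h := (Module.End.eigenspaces_iSupIndep
    (intervalScale 𝒜 (Units.mk0 2 two_ne_zero))).comp (f := fun d : ℤ => (2 : ℂ) ^ (d - 1))
    (fun d e hde => by
      have h6 := congr_arg norm hde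
      simpa using h6)
  refine h.mono fun d x hx => ?_
  rw [Function.comp_apply, Module.End.mem_eigenspace_iff, intervalScale_of_mem 𝒜 _ hx]
  simp

theorem Curve.eq_top_of_homogeneous (S : Submodule ℂ (Curve A))
    (h : ∀ (c : ℝ → ℂ) (hc : c ∈ smoothFun ℝ) (d : ℤ) (y : A), y ∈ 𝒜 d →
      (⟨fun r => c r • y, smul_const_mem_finSums hc y⟩ : Curve A) ∈ S) : S = ⊤ := by
  classical
  rw [eq_top_iff]
  rintro ⟨f, hf⟩ -
  induction hf using Submodule.span_induction with
  | mem f hf =>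
    obtain ⟨c, hc, w, rfl⟩ := hf
    induction w using DirectSum.Decomposition.inductionOn 𝒜 with
    | zero =>
      convert zero_mem S
      ext
      simp
    | add y z hy hz =>
      convert add_mem hy hz
      ext
      simp
    | homogeneous y => exact h c hc _ y y.2
  | zero => exact zero_mem S
  | add f g hf hg h1 h2 => exact add_mem h1 h2
  | smul a f hf h1 => exact S.smul_mem a h1

theorem iSup_intervalGrading : ⨆ d, intervalGrading 𝒜 d = ⊤ := by
  have h1 := Curve.eq_top_of_homogeneous 𝒜
    ((⨆ d, intervalGrading 𝒜 d).comap (LinearMap.inl ℂ (Curve A) (Curve A)))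
    fun c hc d y hy => Submodule.mem_iSup_of_mem (p := intervalGrading 𝒜) d
      ⟨fun r => Submodule.smul_mem _ _ hy, fun r => zero_mem _⟩
  have h2 := Curve.eq_top_of_homogeneous 𝒜
    ((⨆ d, intervalGrading 𝒜 d).comap (LinearMap.inr ℂ (Curve A) (Curve A)))
    fun c hc d y hy => Submodule.mem_iSup_of_mem (p := intervalGrading 𝒜) (d + 1)
      ⟨fun r => zero_mem _, fun r => Submodule.smul_mem _ _ (by rwa [add_sub_cancel_right])⟩
  rw [eq_top_iff]
  rintro ⟨f, g⟩ -
  have h3 : ((f, 0) : Curve A × Curve A) ∈ ⨆ d, intervalGrading 𝒜 d := h1.ge Submodule.mem_top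
  have h4 : ((0, g) : Curve A × Curve A) ∈ ⨆ d, intervalGrading 𝒜 d := h2.ge Submodule.mem_top
  simpa using add_mem h3 h4

instance : DirectSum.Decomposition (intervalGrading 𝒜) :=
  (DirectSum.isInternal_submodule_of_iSupIndep_of_iSup_eq_top (iSupIndep_intervalGrading 𝒜)
    (iSup_intervalGrading 𝒜)).chooseDecomposition

theorem scale_intervalGrading (a : ℂˣ) : scale (intervalGrading 𝒜) a = intervalScale 𝒜 a :=
  hom_ext_homogeneous (intervalGrading 𝒜) fun d x hx => by
    rw [scale_of_mem _ a hx, intervalScale_of_mem 𝒜 a hx]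

end IntervalGrading

/-! ### Families and coderivations with only a linear component -/

section Fam

variable {G : AddSubmonoid ℝ≥0} {A B C : Type*} [AddCommGroup A] [Module ℂ A] [AddCommGroup B]
  [Module ℂ B] [AddCommGroup C] [Module ℂ C] [HasAntidiagonal G]

theorem ofLin_comp_ofLin (φ : B →ₗ[ℂ] C) (ψ : A →ₗ[ℂ] B) :
    (ofLin G φ).comp (ofLin G ψ) = ofLin G (φ ∘ₗ ψ) := by
  rw [ofLin_eq ψ, (Bar.isCoalgMap_map ψ).comp_eq (by simp), toLin_ofLin, LinearMap.comp_assoc,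
    Bar.proj_map, ofLin, LinearMap.comp_assoc]

variable (φ ψ : A →ₗ[ℂ] B)

@[simp]
theorem Bar.head_proj_e (p : A →ₗ[ℂ] B) (β : G) : head ψ (p ∘ₗ proj) (e β) = 0 := by
  have h : TensorProduct.lift ((cons ∘ₗ p ∘ₗ proj (G := G)).compl₂ (map ψ)) =
      TensorProduct.lift ((cons ∘ₗ p).compl₂ (map (G := G) ψ)) ∘ₗ proj.rTensor (Bar G A) :=
    TensorProduct.ext' fun c d => rfl
  rw [head, h, LinearMap.comp_apply, LinearMap.comp_apply, rTensor_proj_comul_e, _root_.map_zero]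

/-- A linear component acts on exactly one letter: either on the first one or further to the right.
-/
theorem Bar.ins_proj_cons (p : A →ₗ[ℂ] B) (x : A) (c : Bar G A) :
    ins φ ψ (p ∘ₗ proj) (cons x c) =
      cons (φ x) (ins φ ψ (p ∘ₗ proj) c) + cons (p x) (map ψ c) := by
  have h : TensorProduct.lift ((cons ∘ₗ p ∘ₗ proj (G := G)).compl₂ (map ψ)) =
      TensorProduct.lift ((cons ∘ₗ p).compl₂ (map (G := G) ψ)) ∘ₗ proj.rTensor (Bar G A) :=
    TensorProduct.ext' fun c d => rfl
  rw [ins_cons, head, h, LinearMap.comp_apply, LinearMap.comp_apply, rTensor_proj_comul_cons]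
  rfl

end Fam

/-! ### The A∞ relation and the Leibniz rule on curves -/

section Curves

variable {G : AddSubmonoid ℝ≥0} {A : Type*} [AddCommGroup A] [Module ℂ A]
  (𝒜 : ℤ → Submodule ℂ A) [DirectSum.Decomposition 𝒜]

namespace Curve

theorem hom_ext_eval {E : Type*} [AddCommGroup E] [Module ℂ E] {f g : E →ₗ[ℂ] Curve A}
    (h : ∀ r, eval A r ∘ₗ f = eval A r ∘ₗ g) : f = g :=
  LinearMap.ext fun c => ext_eval fun r => LinearMap.congr_fun (h r) c

theorem eval_comp_map {B : Type*} [AddCommGroup B] [Module ℂ B] (φ : A →ₗ[ℂ] B) (r : ℝ) :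
    eval B r ∘ₗ map φ = φ ∘ₗ eval A r := rfl

theorem map_scale_comp_toLin_fam {m : Fam G A A} {e : ℤ} (h : ∀ k β, HasDegree 𝒜 𝒜 e (m k β))
    (a : ℂˣ) : map (scale 𝒜 a) ∘ₗ Bar.toLin (fam m) =
      ((a ^ e : ℂˣ) : ℂ) • Bar.toLin (fam m) ∘ₗ Bar.map (map (scale 𝒜 a)) := by
  refine hom_ext_eval fun r => ?_
  rw [LinearMap.comp_smul, ← LinearMap.comp_assoc, ← LinearMap.comp_assoc, eval_comp_map,
    LinearMap.comp_assoc, eval_comp_toLin_fam, ← LinearMap.comp_assoc,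
    Bar.scale_comp_toLin 𝒜 𝒜 h, LinearMap.comp_assoc, ← Bar.map_comp, LinearMap.comp_assoc,
    ← Bar.map_comp, eval_comp_map, LinearMap.smul_comp]

variable [HasAntidiagonal G]

theorem toLin_fam_comp_ins {m : Fam G A A} (h : Bar.toLin m ∘ₗ oddCoder 𝒜 m = 0) :
    Bar.toLin (fam m) ∘ₗ Bar.ins (map (koszul 𝒜)) LinearMap.id (Bar.toLin (fam m)) = 0 := by
  refine hom_ext_eval fun r => ?_
  rw [← LinearMap.comp_assoc, eval_comp_toLin_fam, LinearMap.comp_assoc,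
    Bar.map_ins (ψ' := LinearMap.id) _ _ _ (eval A r) (eval A r) (eval_comp_map _ r) rfl
      (eval_comp_toLin_fam m r),
    ← LinearMap.comp_assoc]
  rw [oddCoder] at h
  rw [h, LinearMap.zero_comp, LinearMap.comp_zero]

/-- The product rule: differentiating a word of curves differentiates one letter at a time. -/
theorem hasD_map_eval (c : Bar G (Curve A)) : HasD (1 : ℝ) (fun r => Bar.map (eval A r) c)
    fun r => Bar.map (eval A r)
      (Bar.ins LinearMap.id LinearMap.id (deriv A ∘ₗ Bar.proj) c) := by
  induction c using Bar.induction with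
  | zero => simpa using HasD.const (1 : ℝ) (0 : Bar G A)
  | add c d hc hd => simp only [_root_.map_add]; exact hc.add hd
  | smul a c hc => simp only [_root_.map_smul]; exact hc.const_smul a
  | empty β => simpa using HasD.const (1 : ℝ) (Bar.e β : Bar G A)
  | cons x c hc =>
    have h := HasD.apply (X := fun r => Bar.cons (eval A r x))
      (X' := fun r => Bar.cons (eval A r (deriv A x)))
      (fun w => (hasD_deriv x).map (Bar.cons.flip w)) hc
    simp only [Bar.ins_proj_cons, Bar.map_cons, _root_.map_add, Bar.map_id, LinearMap.id_apply]
    exact h.congr_deriv (funext fun r => add_comm _ _)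

/-- The structure maps do not depend on the parameter, so only their arguments are differentiated.
-/
theorem deriv_comp_toLin_fam (m : Fam G A A) :
    deriv A ∘ₗ Bar.toLin (fam m) = Bar.toLin (fam m) ∘ₗ
      Bar.ins LinearMap.id LinearMap.id (deriv A ∘ₗ Bar.proj) := by
  ext c : 1
  refine Subtype.ext ((hasD_deriv _).unique ?_)
  have h : ∀ (c : Bar G (Curve A)) (r : ℝ),
      (Bar.toLin (fam m) c).1 r = Bar.toLin m (Bar.map (eval A r) c) :=
    fun c r => LinearMap.congr_fun (eval_comp_toLin_fam m r) c
  refine (((hasD_map_eval c).map (Bar.toLin m)).congr ?_).congr_deriv ?_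
  · exact funext fun r => (h c r).symm
  · exact funext fun r => (h _ r).symm

end Curve
end Curves

/-! ### The A∞ structure on forms on the interval -/

section IntervalModel

variable {G : AddSubmonoid ℝ≥0} {A : Type*} [AddCommGroup A] [Module ℂ A] [HasAntidiagonal G]

variable (A) in
/-- The functions among the differential forms on the interval. -/
abbrev formFst : (Curve A × Curve A) →ₗ[ℂ] Curve A := LinearMap.fst ℂ _ _

variable (A) in
/-- The coefficients of the differential forms on the interval. -/
abbrev formSnd : (Curve A × Curve A) →ₗ[ℂ] Curve A := LinearMap.snd ℂ _ _

variable (𝒜 : ℤ → Submodule ℂ A) [DirectSum.Decomposition 𝒜]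

/-- The sum over all ways to take the coefficient of `dt` of a letter. -/
def formCoeff : Bar G (Curve A × Curve A) →ₗ[ℂ] Bar G (Curve A) :=
  Bar.ins (Curve.map (koszul 𝒜) ∘ₗ formFst A) (formFst A) (formSnd A ∘ₗ Bar.proj)

/-- The structure maps on the differential forms on the interval. -/
def intervalOp (m : Fam G A A) : Bar G (Curve A × Curve A) →ₗ[ℂ] Curve A × Curve A :=
  LinearMap.prod (Bar.toLin (Curve.fam m) ∘ₗ Bar.map (formFst A))
    (Curve.deriv A ∘ₗ formFst A ∘ₗ Bar.proj - Bar.toLin (Curve.fam m) ∘ₗ formCoeff 𝒜)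

theorem fst_comp_intervalOp (m : Fam G A A) : formFst A ∘ₗ intervalOp 𝒜 m =
    Bar.toLin (Curve.fam m) ∘ₗ Bar.map (formFst A) := LinearMap.fst_prod _ _

theorem snd_comp_intervalOp (m : Fam G A A) : formSnd A ∘ₗ intervalOp 𝒜 m =
    Curve.deriv A ∘ₗ formFst A ∘ₗ Bar.proj - Bar.toLin (Curve.fam m) ∘ₗ formCoeff 𝒜 :=
  LinearMap.snd_prod _ _

/-- The coefficient of the one-form has degree one less than the form, hence the factor `a`. -/
theorem formCoeff_comp_map_scale (a : ℂˣ) :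
    formCoeff (G := G) 𝒜 ∘ₗ Bar.map (scale (intervalGrading 𝒜) a) =
      (a : ℂ) • Bar.map (Curve.map (scale 𝒜 a)) ∘ₗ formCoeff 𝒜 := by
  have h := Bar.map_ins (G := G) (φ' := Curve.map (koszul 𝒜) ∘ₗ formFst A) (ψ' := formFst A)
    (g' := formSnd A ∘ₗ Bar.proj)
    (Curve.map (koszul 𝒜) ∘ₗ formFst A) (formFst A) ((a : ℂ) • (formSnd A ∘ₗ Bar.proj))
    (scale (intervalGrading 𝒜) a) (Curve.map (scale 𝒜 a)) ?_ ?_ ?_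
  · rw [formCoeff, ← h, Bar.ins_smul, LinearMap.comp_smul]
  · rw [scale_intervalGrading, koszul_eq_scale]
    refine LinearMap.ext fun x => Curve.ext_eval fun r => ?_
    exact LinearMap.congr_fun (scale_comm 𝒜 a (-1)) (x.1.1 r)
  · rw [scale_intervalGrading]; rfl
  · rw [LinearMap.comp_assoc, Bar.proj_map, ← LinearMap.comp_assoc, scale_intervalGrading]
    refine LinearMap.ext fun x => Curve.ext_eval fun r => ?_
    simp [intervalScale]

theorem scale_comp_intervalOp {m : Fam G A A} (h : ∀ k β, HasDegree 𝒜 𝒜 1 (m k β)) (a : ℂˣ) :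
    scale (intervalGrading 𝒜) a ∘ₗ intervalOp 𝒜 m =
      ((a : ℂ) • intervalOp 𝒜 m) ∘ₗ Bar.map (scale (intervalGrading 𝒜) a) := by
  have h1 := Curve.map_scale_comp_toLin_fam 𝒜 h a
  rw [zpow_one] at h1
  have h2 := formCoeff_comp_map_scale (G := G) 𝒜 a
  refine LinearMap.ext fun c => Prod.ext ?_ ?_
  · have h3 := LinearMap.congr_fun h1 (Bar.map (formFst A) c)
    have h4 : Bar.map (Curve.map (scale 𝒜 a)) (Bar.map (formFst A) c) =
        Bar.map (formFst A) (Bar.map (scale (intervalGrading 𝒜) a) c) := by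
      rw [← LinearMap.comp_apply, ← LinearMap.comp_apply, ← Bar.map_comp, ← Bar.map_comp,
        scale_intervalGrading]
      rfl
    simp only [LinearMap.comp_apply, LinearMap.smul_apply, h4] at h3
    simpa [scale_intervalGrading 𝒜 a, intervalScale, intervalOp] using h3
  · have h3 := LinearMap.congr_fun h1 (formCoeff 𝒜 c)
    have h4 := LinearMap.congr_fun h2 c
    have h5 := LinearMap.congr_fun (Bar.proj_map (G := G) (scale (intervalGrading 𝒜) a)) c
    simp only [LinearMap.comp_apply, LinearMap.smul_apply] at h3 h4 h5
    have h6 : (scale (intervalGrading 𝒜) a (intervalOp 𝒜 m c)).2 =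
      (a : ℂ) • Curve.map (scale 𝒜 a) (intervalOp 𝒜 m c).2 := by
        rw [scale_intervalGrading]; rfl
    have h7 : ∀ c, (intervalOp 𝒜 m c).2 =
        Curve.deriv A (Bar.proj c).1 - Bar.toLin (Curve.fam m) (formCoeff 𝒜 c) := fun _ => rfl
    have h8 : (Bar.proj (Bar.map (scale (intervalGrading 𝒜) a) c)).1 =
        Curve.map (scale 𝒜 a) (Bar.proj c).1 := by
      rw [h5, scale_intervalGrading]; rfl
    simp only [LinearMap.comp_apply, LinearMap.smul_apply, Prod.smul_snd] at h6 ⊢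
    rw [h6, h7, h7, h4, h8, Curve.deriv_map, map_sub, h3, map_smul]

-- The sum of the left side and the term moved over from the right is a coderivation along `P`, the
-- mixed terms cancelling by `hκK` and `hSn`. It remains to compare components, where the two
-- contributions of `m` cancel and only the derivative survives.
set_option maxHeartbeats 1000000 in
theorem formCoeff_comp_ins {m : Fam G A A} (h : ∀ k β, HasDegree 𝒜 𝒜 1 (m k β)) :
    formCoeff 𝒜 ∘ₗ Bar.ins (koszul (intervalGrading 𝒜)) LinearMap.id (intervalOp 𝒜 m) =
      Bar.ins LinearMap.id LinearMap.id (Curve.deriv A ∘ₗ Bar.proj) ∘ₗ Bar.map (formFst A) -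
      Bar.ins (Curve.map (koszul 𝒜)) LinearMap.id (Bar.toLin (Curve.fam m)) ∘ₗ formCoeff 𝒜 := by
  set o := Bar.ins (koszul (intervalGrading 𝒜)) LinearMap.id (intervalOp 𝒜 m) with ho
  set n := Bar.ins (Curve.map (koszul 𝒜)) LinearMap.id (Bar.toLin (Curve.fam m)) with hn
  set κ : Bar G (Curve A × Curve A) →ₗ[ℂ] Bar G (Curve A) := formCoeff 𝒜 with hκ
  set P : Bar G (Curve A × Curve A) →ₗ[ℂ] Bar G (Curve A) := Bar.map (formFst A) with hP
  set S : Bar G (Curve A) →ₗ[ℂ] Bar G (Curve A) := Bar.map (Curve.map (koszul 𝒜)) with hS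
  set K : Bar G (Curve A × Curve A) →ₗ[ℂ] Bar G (Curve A × Curve A) :=
    Bar.map (koszul (intervalGrading 𝒜)) with hK
  have hss : Curve.map (koszul 𝒜) ∘ₗ Curve.map (koszul 𝒜) = LinearMap.id := by
    refine LinearMap.ext fun x => Curve.ext_eval fun r => ?_
    have := LinearMap.congr_fun (scale_mul 𝒜 (-1) (-1)) (x.1 r)
    rw [neg_mul_neg, one_mul, scale_one, ← koszul_eq_scale] at this
    exact this.symm
  have hSS : ∀ c, S (S c) = c := fun c => by
    rw [hS, ← LinearMap.comp_apply, ← Bar.map_comp, hss, Bar.map_id]; rfl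
  have hPK : ∀ c, P (K c) = S (P c) := fun c => by
    rw [hP, hK, hS, ← LinearMap.comp_apply, ← LinearMap.comp_apply, ← Bar.map_comp,
      ← Bar.map_comp, koszul_eq_scale, koszul_eq_scale, scale_intervalGrading]
    rfl
  have hκK : ∀ c, κ (K c) = -S (κ c) := fun c => by
    have := LinearMap.congr_fun (formCoeff_comp_map_scale (G := G) 𝒜 (-1)) c
    simp only [← koszul_eq_scale, LinearMap.comp_apply, LinearMap.smul_apply] at this
    simpa using this
  have hPo : ∀ c, P (o c) = n (P c) := fun c => LinearMap.congr_fun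
    (Bar.map_ins _ _ _ (formFst A) (formFst A) (by
      rw [koszul_eq_scale, koszul_eq_scale, scale_intervalGrading]; rfl) rfl
      (fst_comp_intervalOp 𝒜 m)) c
  have hSn : ∀ c, S (n c) = -n (S c) := fun c => by
    have h1 := Curve.map_scale_comp_toLin_fam 𝒜 h (-1)
    rw [← koszul_eq_scale] at h1
    have := LinearMap.congr_fun (Bar.map_ins (φ' := Curve.map (koszul 𝒜)) (ψ' := LinearMap.id)
      (Curve.map (koszul 𝒜)) LinearMap.id _ (Curve.map (koszul 𝒜)) (Curve.map (koszul 𝒜)) rfl rfl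
      (h1.trans (LinearMap.smul_comp _ _ _).symm)) c
    rw [Bar.ins_smul] at this
    simpa using this
  have hκc : ∀ c, Bar.comul (κ c) = TensorProduct.map κ P (Bar.comul c) +
      TensorProduct.map (S ∘ₗ P) κ (Bar.comul c) := fun c => by
    rw [hκ, formCoeff, Bar.comul_ins, Bar.map_comp]
  have hoc : ∀ c, Bar.comul (o c) = TensorProduct.map o LinearMap.id (Bar.comul c) +
      TensorProduct.map K o (Bar.comul c) := fun c => by
    rw [ho, Bar.comul_ins, Bar.map_id]
  have hnc : ∀ c, Bar.comul (n c) = TensorProduct.map n LinearMap.id (Bar.comul c) +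
      TensorProduct.map S n (Bar.comul c) := fun c => by
    rw [hn, Bar.comul_ins, Bar.map_id]
  have key : κ ∘ₗ o + n ∘ₗ κ =
      Bar.ins LinearMap.id LinearMap.id (Curve.deriv A ∘ₗ Bar.proj) ∘ₗ P := by
    refine Bar.eq_of_coderivation (formFst A) (ψ' := P) (fun c => ?_) (fun c => ?_) (fun c => ?_)
      (fun c => ?_)
    · rw [LinearMap.add_apply, _root_.map_add, LinearMap.comp_apply, LinearMap.comp_apply, hκc,
        hnc, hoc, hκc]
      generalize Bar.comul c = z
      induction z with
      | zero => simp
      | add z w hz hw =>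
        have := congr_arg₂ (· + ·) hz hw
        simp only [_root_.map_add] at this ⊢
        refine Eq.trans ?_ (this.trans ?_) <;> abel
      | tmul c d =>
        simp only [_root_.map_add, TensorProduct.map_tmul, LinearMap.comp_apply, LinearMap.id_apply,
          hPK, hκK, hPo, hSn, hSS, LinearMap.add_apply, TensorProduct.add_tmul,
          TensorProduct.tmul_add, TensorProduct.neg_tmul]
        abel
    · rw [LinearMap.comp_apply, Bar.comul_ins, hP, Bar.comul_map]
      rw [TensorProduct.map_map, TensorProduct.map_map, Bar.map_id, LinearMap.id_comp]
    · simp only [LinearMap.add_apply, LinearMap.comp_apply, _root_.map_add, hκ, hn, formCoeff,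
        Bar.scalar_ins, add_zero]
    · have h1 := LinearMap.congr_fun (snd_comp_intervalOp 𝒜 m) c
      have h2 := LinearMap.congr_fun (Bar.proj_map (G := G) (formFst A)) c
      simp only [LinearMap.comp_apply, LinearMap.sub_apply] at h1 h2
      simp only [LinearMap.add_apply, LinearMap.comp_apply, _root_.map_add, hκ, hn, formCoeff,
        Bar.proj_ins, ho, hP, h2] at h1 ⊢
      rw [h1]
      exact sub_add_cancel _ _
  rw [← key, add_sub_cancel_right]

/-- The function part is the relation for `m` at each point. The one-form part is the same relation
applied after `formCoeff`, plus the difference of `deriv` after `m` and `m` after `deriv`, which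
vanishes by the Leibniz rule. -/
theorem intervalOp_comp_ins {m : Fam G A A} (hd : ∀ k β, HasDegree 𝒜 𝒜 1 (m k β))
    (hr : Bar.toLin m ∘ₗ oddCoder 𝒜 m = 0) :
    intervalOp 𝒜 m ∘ₗ
      Bar.ins (koszul (intervalGrading 𝒜)) LinearMap.id (intervalOp 𝒜 m) = 0 := by
  have h1 : Bar.map (formFst A) ∘ₗ
      Bar.ins (koszul (intervalGrading 𝒜)) LinearMap.id (intervalOp 𝒜 m) =
      Bar.ins (Curve.map (koszul 𝒜)) LinearMap.id (Bar.toLin (Curve.fam m)) ∘ₗ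
        Bar.map (formFst A) :=
    Bar.map_ins _ _ _ (formFst A) (formFst A) (by
      rw [koszul_eq_scale, koszul_eq_scale, scale_intervalGrading]; rfl) rfl
      (fst_comp_intervalOp 𝒜 m)
  have h2 := Curve.toLin_fam_comp_ins 𝒜 hr
  refine LinearMap.ext fun c => Prod.ext ?_ ?_
  · have h3 := LinearMap.congr_fun h1 c
    have h4 := LinearMap.congr_fun h2 (Bar.map (formFst A) c)
    simp only [LinearMap.comp_apply] at h3 h4
    change Bar.toLin (Curve.fam m) (Bar.map (formFst A) (Bar.ins _ _ _ c)) = 0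
    rw [h3, h4]; rfl
  · have h3 := LinearMap.congr_fun (formCoeff_comp_ins 𝒜 hd) c
    have h4 := LinearMap.congr_fun h2 (formCoeff 𝒜 c)
    have h5 := LinearMap.congr_fun (Curve.deriv_comp_toLin_fam m) (Bar.map (formFst A) c)
    have h6 := LinearMap.congr_fun (fst_comp_intervalOp 𝒜 m) c
    simp only [LinearMap.comp_apply, LinearMap.sub_apply, LinearMap.zero_apply] at h3 h4 h5 h6
    change Curve.deriv A (Bar.proj (Bar.ins _ _ (intervalOp 𝒜 m) c)).1 -
      Bar.toLin (Curve.fam m) (formCoeff 𝒜 (Bar.ins _ _ (intervalOp 𝒜 m) c)) = 0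
    rw [h3, Bar.proj_ins, _root_.map_sub, h4, sub_zero, ← h5]
    exact sub_eq_zero.2 (congr_arg _ h6)

theorem isAInfAlgebra_interval {m : Fam G A A} (hm : IsAInfAlgebra 𝒜 m) :
    IsAInfAlgebra (intervalGrading 𝒜) (Bar.toFam (intervalOp 𝒜 m)) where
  degree := Bar.hasDegree_toFam _ _ (by
    rw [zpow_one]; exact scale_comp_intervalOp 𝒜 hm.degree _)
  gapped := by
    ext x : 1
    obtain ⟨y, rfl⟩ := exists_extension x
    rw [Bar.toFam_apply, Bar.word_zero]
    refine Prod.ext (Curve.ext_eval fun r => ?_) (Curve.ext_eval fun r => ?_)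
    · have := LinearMap.congr_fun (Curve.eval_comp_toLin_fam m r) (Bar.e 0)
      simp only [LinearMap.comp_apply, Bar.map_e, Bar.toLin_e, hm.gapped] at this
      simp [intervalOp]
      simpa using this
    · simp [intervalOp, formCoeff]
  relation N β x := by
    have hr : Bar.toLin m ∘ₗ oddCoder 𝒜 m = 0 := Bar.hom_ext_word fun n x β => by
      rw [LinearMap.comp_apply, oddCoder_apply_word, hm.relation]; rfl
    rw [← oddCoder_apply_word, oddCoder, Bar.toLin_toFam]
    exact LinearMap.congr_fun (intervalOp_comp_ins 𝒜 hm.degree hr) _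

end IntervalModel

/-! ### Inclusion, evaluations and homotopy equivalences of the model -/

section IntervalModel

variable {A : Type u} [AddCommGroup A] [Module ℂ A] (𝒜 : ℤ → Submodule ℂ A)

variable (A) in
/-- The inclusion of the constant functions into the differential forms on the interval. -/
def formConst : A →ₗ[ℂ] Curve A × Curve A := LinearMap.inl ℂ _ _ ∘ₗ Curve.const A

variable (A) in
/-- The evaluation of differential forms on the interval at a point. -/
def formEval (r : ℝ) : (Curve A × Curve A) →ₗ[ℂ] A := Curve.eval A r ∘ₗ formFst A

theorem formEval_comp_formConst (r : ℝ) : formEval A r ∘ₗ formConst A = LinearMap.id := rfl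

theorem formConst_mem {d : ℤ} {a : A} (ha : a ∈ 𝒜 d) : formConst A a ∈ intervalGrading 𝒜 d :=
  ⟨fun _ => ha, fun _ => zero_mem _⟩

theorem formEval_mem (r : ℝ) {d : ℤ} {x : Curve A × Curve A} (hx : x ∈ intervalGrading 𝒜 d) :
    formEval A r x ∈ 𝒜 d := hx.1 r

variable {G : AddSubmonoid ℝ≥0} [HasAntidiagonal G] [DirectSum.Decomposition 𝒜]

/-- Constant functions have derivative zero and no one-form part, so only the first summand of the
structure maps survives. -/
theorem intervalOp_comp_formConst (m : Fam G A A) :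
    intervalOp 𝒜 m ∘ₗ Bar.map (formConst A) = formConst A ∘ₗ Bar.toLin m := by
  have h1 : ∀ c, formCoeff (G := G) 𝒜 (Bar.map (formConst A) c) = 0 := fun c => by
    induction c using Bar.induction with
    | zero => simp
    | add c d hc hd => simp [hc, hd]
    | smul a c hc => simp [hc]
    | empty β => simp [formCoeff]
    | cons x c hc =>
      rw [formCoeff] at hc ⊢
      rw [Bar.map_cons, Bar.ins_proj_cons, hc]
      simp [formConst]
  refine LinearMap.ext fun c => Prod.ext (Curve.ext_eval fun r => ?_) ?_
  · have h2 := LinearMap.congr_fun (Curve.eval_comp_toLin_fam m r)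
      (Bar.map (formFst A) (Bar.map (formConst A) c))
    have h3 : ∀ c : Bar G A, Bar.map (Curve.eval A r) (Bar.map (formFst A) (Bar.map (formConst A) c))
        = c := fun c => by
      rw [← LinearMap.comp_apply, ← LinearMap.comp_apply, ← Bar.map_comp, ← Bar.map_comp]
      exact LinearMap.congr_fun Bar.map_id c
    rw [LinearMap.comp_apply, LinearMap.comp_apply, h3] at h2
    exact h2
  · have h2 : (Bar.proj (Bar.map (formConst A) c)).1 = Curve.const A (Bar.proj c) := by
      rw [← LinearMap.comp_apply, Bar.proj_map]; rfl
    change Curve.deriv A (Bar.proj (Bar.map (formConst A) c)).1 -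
      Bar.toLin (Curve.fam m) (formCoeff 𝒜 (Bar.map (formConst A) c)) = 0
    rw [h1, h2, Curve.deriv_const]; simp

theorem toLin_comp_map_formEval (m : Fam G A A) (r : ℝ) :
    Bar.toLin m ∘ₗ Bar.map (formEval A r) = formEval A r ∘ₗ intervalOp 𝒜 m := by
  rw [formEval, Bar.map_comp, ← LinearMap.comp_assoc, ← Curve.eval_comp_toLin_fam,
    LinearMap.comp_assoc, LinearMap.comp_assoc, fst_comp_intervalOp]

theorem lin_intervalOp (m : Fam G A A) (x : Curve A × Curve A) :
    (Bar.toFam (intervalOp 𝒜 m)).lin x =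
      (Curve.map m.lin x.1, Curve.deriv A x.1 - Curve.map m.lin x.2) := by
  have h1 : ∀ (y : Curve A), Bar.toLin (Curve.fam m) (Bar.cons y (Bar.e 0)) = Curve.map m.lin y :=
    fun y => Bar.toLin_word (Curve.fam m) 1 (fun _ => y) 0
  rw [lin_apply]
  refine (Bar.toFam_apply (intervalOp 𝒜 m) 1 0 fun _ => x).trans (Prod.ext ?_ ?_)
  · change Bar.toLin (Curve.fam m) (Bar.map (formFst A) (Bar.cons x (Bar.e 0))) = _
    rw [Bar.map_cons, Bar.map_e, h1]; rfl
  · change Curve.deriv A (Bar.proj (Bar.cons x (Bar.e 0))).1 -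
      Bar.toLin (Curve.fam m) (formCoeff 𝒜 (Bar.cons x (Bar.e 0))) = _
    rw [formCoeff, Bar.ins_proj_cons, Bar.map_e, Bar.ins_e, Bar.head_proj_e, _root_.map_zero,
      zero_add, h1]
    simp

/-- The Poincaré lemma on the interval: the homotopy sends f + g dt to minus the primitive of g that
vanishes at `r`. That primitive commutes with the linear structure map. -/
theorem exists_homotopy (m : Fam G A A) (r : ℝ) :
    ∃ L : (Curve A × Curve A) →ₗ[ℂ] Curve A × Curve A,
      (∀ d, ∀ b ∈ intervalGrading 𝒜 d, L b ∈ intervalGrading 𝒜 (d - 1)) ∧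
      formConst A ∘ₗ formEval A r - LinearMap.id =
        (Bar.toFam (intervalOp 𝒜 m)).lin ∘ₗ L + L ∘ₗ (Bar.toFam (intervalOp 𝒜 m)).lin := by
  refine ⟨LinearMap.inl ℂ _ _ ∘ₗ (-(Curve.integral A r ∘ₗ formSnd A)), fun d b hb =>
    ⟨fun s => neg_mem (Curve.integral_mem r hb.2 s), fun s => zero_mem _⟩, ?_⟩
  refine LinearMap.ext fun x => ?_
  simp only [LinearMap.sub_apply, LinearMap.add_apply, LinearMap.comp_apply, lin_intervalOp,
    LinearMap.neg_apply, LinearMap.inl_apply, LinearMap.snd_apply, LinearMap.id_apply, formConst,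
    formEval, LinearMap.fst_apply, _root_.map_neg, _root_.map_sub, Curve.deriv_integral,
    Curve.integral_deriv, Curve.integral_map, _root_.map_zero, sub_zero]
  refine Prod.ext ?_ ?_
  · simp [Curve.eval_apply]
    abel
  · simp

theorem isCochainHomotopyEquiv_formConst (m : Fam G A A) :
    IsCochainHomotopyEquiv 𝒜 m.lin (intervalGrading 𝒜) (Bar.toFam (intervalOp 𝒜 m)).lin
      (formConst A) := by
  obtain ⟨L, hL, hL'⟩ := exists_homotopy 𝒜 m 0
  refine ⟨fun d a ha => formConst_mem 𝒜 ha, ?_, formEval A 0, 0, L,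
    fun d b hb => formEval_mem 𝒜 0 hb, ?_, fun d a _ => zero_mem _, hL, ?_, hL'⟩
  · refine LinearMap.ext fun a => ?_
    simp only [LinearMap.comp_apply, lin_intervalOp, formConst, LinearMap.inl_apply,
      Curve.deriv_const, _root_.map_zero, sub_zero]
    rfl
  · refine LinearMap.ext fun a => ?_
    simp only [LinearMap.comp_apply, lin_intervalOp, formEval, LinearMap.fst_apply]
    rfl
  · rw [formEval_comp_formConst]; simp

theorem isCochainHomotopyEquiv_formEval (m : Fam G A A) (r : ℝ) :
    IsCochainHomotopyEquiv (intervalGrading 𝒜) (Bar.toFam (intervalOp 𝒜 m)).lin 𝒜 m.lin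
      (formEval A r) := by
  obtain ⟨L, hL, hL'⟩ := exists_homotopy 𝒜 m r
  refine ⟨fun d b hb => formEval_mem 𝒜 r hb, ?_, formConst A, L, 0,
    fun d a ha => formConst_mem 𝒜 ha, ?_, hL, fun d a _ => zero_mem _, hL', ?_⟩
  · refine LinearMap.ext fun a => ?_
    simp only [LinearMap.comp_apply, lin_intervalOp, formEval, LinearMap.fst_apply]
    rfl
  · refine LinearMap.ext fun a => ?_
    simp only [LinearMap.comp_apply, lin_intervalOp, formConst, LinearMap.inl_apply,
      Curve.deriv_const, _root_.map_zero, sub_zero]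
    rfl
  · rw [formEval_comp_formConst]; simp

/-- The differential forms on the interval as a model of the product with the interval. -/
def intervalModel {m : Fam G A A} (hm : IsAInfAlgebra 𝒜 m) : IntervalModel 𝒜 m where
  carrier := Curve A × Curve A
  grading := intervalGrading 𝒜
  op := Bar.toFam (intervalOp 𝒜 m)
  isAInfAlgebra := isAInfAlgebra_interval 𝒜 hm
  incl := ofLin G (formConst A)
  eval₀ := ofLin G (formEval A 0)
  eval₁ := ofLin G (formEval A 1)
  incl_hom := isAInfHom_ofLin 𝒜 (intervalGrading 𝒜) (fun d a ha => formConst_mem 𝒜 ha) (by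
    rw [Bar.toLin_toFam, intervalOp_comp_formConst])
  eval₀_hom := isAInfHom_ofLin (intervalGrading 𝒜) 𝒜 (fun d a ha => formEval_mem 𝒜 0 ha) (by
    rw [Bar.toLin_toFam, toLin_comp_map_formEval 𝒜])
  eval₁_hom := isAInfHom_ofLin (intervalGrading 𝒜) 𝒜 (fun d a ha => formEval_mem 𝒜 1 ha) (by
    rw [Bar.toLin_toFam, toLin_comp_map_formEval 𝒜])
  incl_linear k hk β := ofLin_of_ne _ hk β
  eval₀_linear k hk β := ofLin_of_ne _ hk β
  eval₁_linear k hk β := ofLin_of_ne _ hk β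
  eval₀_incl := by rw [ofLin_comp_ofLin, formEval_comp_formConst, ofLin_id]
  eval₁_incl := by rw [ofLin_comp_ofLin, formEval_comp_formConst, ofLin_id]
  incl_equiv := by rw [lin_ofLin]; exact isCochainHomotopyEquiv_formConst 𝒜 m
  eval₀_equiv := by rw [lin_ofLin]; exact isCochainHomotopyEquiv_formEval 𝒜 m 0
  eval₁_equiv := by rw [lin_ofLin]; exact isCochainHomotopyEquiv_formEval 𝒜 m 1
  eval_surjective b b' := by
    have h1 : ContDiff ℝ ∞ fun r : ℝ => (r : ℂ) := Complex.ofRealCLM.contDiff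
    refine ⟨(⟨fun r => (1 - (r : ℂ)) • b + (r : ℂ) • b', add_mem
      (smul_const_mem_finSums (contDiff_const.sub h1) b) (smul_const_mem_finSums h1 b')⟩, 0), ?_, ?_⟩
    · rw [lin_ofLin]; simp [formEval]
    · rw [lin_ofLin]; simp [formEval]

end IntervalModel

/-! ### From a homotopy of coalgebra maps to a homomorphism into the model -/

section Homotopy

namespace Bar

variable {G : AddSubmonoid ℝ≥0} {A B C : Type*} [AddCommGroup A] [Module ℂ A] [AddCommGroup B]
  [Module ℂ B] [AddCommGroup C] [Module ℂ C]

/-- The word obtained by applying a family to consecutive blocks of letters. -/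
def blockWord (E : Fam G A B) : List (ℕ × G) → (ℕ → A) → G → Bar G B
  | [], _, o => e o
  | b :: l, x, o => cons (E b.1 b.2 fun a => x a) (blockWord E l (fun a => x (b.1 + a)) o)

theorem toLin_blockWord (E : Fam G A B) (F : Fam G B C) (l : List (ℕ × G)) (x : ℕ → A) (o : G) :
    toLin F (blockWord E l x o) = evalBlocks E F l x o := by
  induction l generalizing F x with
  | nil => simp [blockWord, evalBlocks]
  | cons b l ih => rw [blockWord, toLin_cons, ih, evalBlocks]

theorem map_blockWord (φ : B →ₗ[ℂ] C) {E : Fam G A B} {E' : Fam G A C}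
    (h : ∀ k β x, φ (E k β x) = E' k β x) (l : List (ℕ × G)) (x : ℕ → A) (o : G) :
    map φ (blockWord E l x o) = blockWord E' l x o := by
  induction l generalizing x with
  | nil => simp [blockWord]
  | cons b l ih => rw [blockWord, map_cons, ih, blockWord, h]

theorem toFam_zero {Y : Bar G A →ₗ[ℂ] B}
    (hY : Y (e 0) = 0) : toFam Y 0 0 = 0 := by
  ext x
  obtain ⟨y, rfl⟩ := exists_extension x
  rw [toFam_apply, word_zero, hY]; rfl

variable [HasAntidiagonal G]

/-- Applying `p` to one letter, `φ` to the letters before it and `ψ` to those after it is the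
expansion of a coderivation along two maps into blocks, as in `toLin_coderivation_word`. -/
theorem toLin_ins_blockWord {B' : Type*} [AddCommGroup B'] [Module ℂ B'] (φ ψ p : B →ₗ[ℂ] B')
    {H : Fam G A B} {W' L W : Fam G A B'} (hW' : ∀ k β x, φ (H k β x) = W' k β x)
    (hL : ∀ k β x, p (H k β x) = L k β x) (hW : ∀ k β x, ψ (H k β x) = W k β x)
    (F : Fam G B' C) (l : List (ℕ × G)) (x : ℕ → A) (o : G) :
    toLin F (ins φ ψ (p ∘ₗ proj) (blockWord H l x o)) = evalBlocksCoder W' L W F l x o := by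
  induction l generalizing F x with
  | nil => simp [blockWord, evalBlocksCoder]
  | cons b l ih =>
    rw [blockWord, ins_proj_cons, _root_.map_add, toLin_cons, toLin_cons, ih, hW', hL,
      map_blockWord ψ hW, toLin_blockWord, evalBlocksCoder]

/-- The sum of all words obtained by applying a family to blocks of letters. -/
def totalWord (E : Fam G A B) (N : ℕ) (β : G) (x : ℕ → A) : Bar G B :=
  ∑ q ∈ antidiagonal β, ∑ l ∈ (blockLists_finite N q.2).toFinset, blockWord E l x q.1

theorem toLin_totalWord {E : Fam G A B} (hE : E 0 0 = 0) (F : Fam G B C) (N : ℕ) (β : G)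
    (x : ℕ → A) : toLin F (totalWord E N β x) = F.comp E N β fun a => x a := by
  rw [Fam.comp_word hE, totalWord]
  simp only [_root_.map_sum, toLin_blockWord]

theorem map_totalWord (φ : B →ₗ[ℂ] C) {E : Fam G A B} {E' : Fam G A C}
    (h : ∀ k β x, φ (E k β x) = E' k β x) (N : ℕ) (β : G) (x : ℕ → A) :
    map φ (totalWord E N β x) = totalWord E' N β x := by
  rw [totalWord, totalWord]
  simp only [_root_.map_sum, map_blockWord φ h]

end Bar

variable {G : AddSubmonoid ℝ≥0} {A : Type u} [AddCommGroup A] [Module ℂ A] [HasAntidiagonal G]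
  {𝒜 : ℤ → Submodule ℂ A} [DirectSum.Decomposition 𝒜] {m₀ m₁ : Fam G A A}
  {W L : ℝ → Module.End ℂ (Bar G A)}

namespace IsCoalgHomotopy

/-- The linear map to the differential forms on the interval given by a homotopy. -/
def formLin (h : IsCoalgHomotopy 𝒜 m₀ m₁ W L) : Bar G A →ₗ[ℂ] Curve A × Curve A where
  toFun c := (⟨fun s => Bar.proj (W s c), ((h.deriv c).map Bar.proj).mem⟩,
    ⟨fun s => Bar.proj (L s c), map_mem_finSums _ (h.smooth c)⟩)
  map_add' c d := Prod.ext (Subtype.ext (funext fun s => by simp))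
    (Subtype.ext (funext fun s => by simp))
  map_smul' a c := Prod.ext (Subtype.ext (funext fun s => by simp))
    (Subtype.ext (funext fun s => by simp))

theorem formLin_e_zero (h : IsCoalgHomotopy 𝒜 m₀ m₁ W L) : h.formLin (Bar.e 0) = 0 :=
  Prod.ext (Subtype.ext (funext fun s => by
      change Bar.proj (W s (Bar.e 0)) = 0; rw [h.apply_e_zero, Bar.proj_e]))
    (Subtype.ext (funext fun s => by
      change Bar.proj (L s (Bar.e 0)) = 0; rw [h.apply_e_zero', _root_.map_zero]))

theorem scale_comp_formLin (h : IsCoalgHomotopy 𝒜 m₀ m₁ W L) (a : ℂˣ) :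
    scale (intervalGrading 𝒜) a ∘ₗ h.formLin = h.formLin ∘ₗ Bar.map (scale 𝒜 a) := by
  have h1 : ∀ c : Bar G A, Bar.proj (Bar.map (scale 𝒜 a) c) = scale 𝒜 a (Bar.proj c) :=
    LinearMap.congr_fun (Bar.proj_map _)
  rw [scale_intervalGrading]
  refine LinearMap.ext fun c => Prod.ext (Curve.ext_eval fun r => ?_) (Curve.ext_eval fun r => ?_)
  · have := congr_arg Bar.proj (LinearMap.congr_fun (h.map_scale a r) c)
    rw [LinearMap.comp_apply, h1] at this
    exact this
  · have := congr_arg Bar.proj (LinearMap.congr_fun (h.map_scale' a r) c)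
    rw [LinearMap.comp_apply, h1, LinearMap.smul_apply, _root_.map_smul] at this
    refine (congr_arg ((a : ℂ) • ·) this).trans ?_
    rw [smul_smul, ← Units.val_mul, zpow_neg_one, mul_inv_cancel, Units.val_one, one_smul]
    rfl

/-- `totalWord` is the image of a word under the coalgebra map with components `formLin`; its
function part at time `r` is the image under `W r`. -/
theorem toLin_map_totalWord (h : IsCoalgHomotopy 𝒜 m₀ m₁ W L) (F : Fam G A A) (r : ℝ) (N : ℕ)
    (β : G) (x : ℕ → A) :
    Bar.toLin F (Bar.map (formEval A r) (Bar.totalWord (Bar.toFam h.formLin) N β x)) =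
      Bar.toLin F (W r (Bar.word N x β)) := by
  have h0 : Bar.toFam (Bar.proj ∘ₗ W r) 0 0 = 0 := Bar.toFam_zero (by
    rw [LinearMap.comp_apply, h.apply_e_zero, Bar.proj_e])
  rw [Bar.map_totalWord (formEval A r) (E' := Bar.toFam (Bar.proj ∘ₗ W r)) (fun k β x => rfl),
    Bar.toLin_totalWord h0, (h.isCoalgMap r).toLin_word (E := Bar.toFam (Bar.proj ∘ₗ W r))
      (fun c => by simp) h0]

theorem proj_totalWord (h : IsCoalgHomotopy 𝒜 m₀ m₁ W L) (r : ℝ) (N : ℕ) (β : G) (x : ℕ → A) :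
    formEval A r (Bar.proj (Bar.totalWord (Bar.toFam h.formLin) N β x)) =
      Bar.proj (W r (Bar.word N x β)) := by
  have h1 := h.toLin_map_totalWord (ofLin G LinearMap.id) r N β x
  rw [toLin_ofLin, LinearMap.id_comp] at h1
  rw [← h1, ← LinearMap.comp_apply, ← LinearMap.comp_apply, Bar.proj_map]

/-- The one-form part of the same image is `L r` of the word: both expand into blocks with one `L`,
preceded by sign-twisted `W` and followed by `W`. -/
theorem toLin_formCoeff_totalWord (h : IsCoalgHomotopy 𝒜 m₀ m₁ W L) (F : Fam G A A) (r : ℝ) (N : ℕ)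
    (β : G) (x : ℕ → A) :
    Bar.toLin F (Bar.map (Curve.eval A r)
        (formCoeff 𝒜 (Bar.totalWord (Bar.toFam h.formLin) N β x))) =
      Bar.toLin F (L r (Bar.word N x β)) := by
  have hp : ∀ c : Bar G A, Bar.proj (Bar.map (koszul 𝒜) c) = koszul 𝒜 (Bar.proj c) :=
    LinearMap.congr_fun (Bar.proj_map _)
  have h1 : Bar.map (Curve.eval A r) ∘ₗ formCoeff (G := G) 𝒜 =
      Bar.ins (koszul 𝒜 ∘ₗ formEval A r) (formEval A r)
        ((Curve.eval A r ∘ₗ formSnd A) ∘ₗ Bar.proj) := by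
    have := Bar.map_ins (G := G) (φ' := koszul 𝒜 ∘ₗ formEval A r) (ψ' := formEval A r)
      (g' := (Curve.eval A r ∘ₗ formSnd A) ∘ₗ Bar.proj)
      (Curve.map (koszul 𝒜) ∘ₗ formFst A) (formFst A) (formSnd A ∘ₗ Bar.proj)
      LinearMap.id (Curve.eval A r) rfl rfl (by rw [Bar.map_id]; rfl)
    rw [Bar.map_id, LinearMap.comp_id] at this
    exact this
  rw [Bar.toLin_coderivation_word (h.isCoalgMap r) (h.comul_eq r) (h.scalar_eq r)
    (W := Bar.toFam (Bar.proj ∘ₗ W r)) (W' := Bar.toFam (koszul 𝒜 ∘ₗ Bar.proj ∘ₗ W r))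
    (L := Bar.toFam (Bar.proj ∘ₗ L r)) (fun c => by simp) (fun c => by simp [hp]) (fun c => by simp)
    (Bar.toFam_zero (by simp [h.apply_e_zero])) (Bar.toFam_zero (by simp [h.apply_e_zero]))
    (Bar.toFam_zero (by simp [h.apply_e_zero']))]
  have h2 := LinearMap.congr_fun h1 (Bar.totalWord (Bar.toFam h.formLin) N β x)
  rw [LinearMap.comp_apply] at h2
  rw [h2, Bar.totalWord]
  simp only [_root_.map_sum]
  refine sum_congr rfl fun q _ => sum_congr rfl fun l _ => ?_
  exact Bar.toLin_ins_blockWord _ _ _ (fun k β x => rfl) (fun k β x => rfl) (fun k β x => rfl) _ _ _ _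

/-- The function part says that `W r` commutes with the differentials. The one-form part is ∂ₛW − b
L = L b, which is the homotopy equation. -/
theorem intervalOp_totalWord (h : IsCoalgHomotopy 𝒜 m₀ m₁ W L) (N : ℕ) (β : G) (x : ℕ → A) :
    intervalOp 𝒜 m₁ (Bar.totalWord (Bar.toFam h.formLin) N β x) =
      h.formLin (oddCoder 𝒜 m₀ (Bar.word N x β)) := by
  have hm : ∀ c, Bar.toLin m₁ c = Bar.proj (oddCoder 𝒜 m₁ c) := fun c => (Bar.proj_ins _ _ _ c).symm
  refine Prod.ext (Curve.ext_eval fun r => ?_) (Curve.ext_eval fun r => ?_)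
  · have h1 := LinearMap.congr_fun (toLin_comp_map_formEval 𝒜 m₁ r)
      (Bar.totalWord (Bar.toFam h.formLin) N β x)
    rw [LinearMap.comp_apply, h.toLin_map_totalWord, hm] at h1
    refine h1.symm.trans (congr_arg Bar.proj ?_)
    exact LinearMap.congr_fun (h.comm r) (Bar.word N x β)
  · have h1 := LinearMap.congr_fun (Curve.eval_comp_toLin_fam m₁ r)
      (formCoeff 𝒜 (Bar.totalWord (Bar.toFam h.formLin) N β x))
    rw [LinearMap.comp_apply, LinearMap.comp_apply, h.toLin_formCoeff_totalWord, hm] at h1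
    have h2 : HasD (1 : ℝ) (Bar.proj (Bar.totalWord (Bar.toFam h.formLin) N β x)).1.1
        fun s => Bar.proj (oddCoder 𝒜 m₁ (L s (Bar.word N x β)) +
          L s (oddCoder 𝒜 m₀ (Bar.word N x β))) :=
      ((h.deriv (Bar.word N x β)).map Bar.proj).congr
        (funext fun s => (h.proj_totalWord s N β x).symm)
    have h3 := congr_fun ((Curve.hasD_deriv _).unique h2) r
    change (Curve.deriv A (Bar.proj (Bar.totalWord (Bar.toFam h.formLin) N β x)).1).1 r -
      Curve.eval A r (Bar.toLin (Curve.fam m₁) (formCoeff 𝒜 _)) = Bar.proj (L r _)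
    rw [h3, h1, _root_.map_add, add_sub_cancel_left]

theorem isAInfHom_formLin (h : IsCoalgHomotopy 𝒜 m₀ m₁ W L) :
    IsAInfHom 𝒜 m₀ (intervalGrading 𝒜) (Bar.toFam (intervalOp 𝒜 m₁)) (Bar.toFam h.formLin) where
  degree := Bar.hasDegree_toFam _ _ (by rw [zpow_zero, one_smul, h.scale_comp_formLin])
  gapped := Bar.toFam_zero h.formLin_e_zero
  equation N β x := by
    rw [← Bar.toLin_totalWord (Bar.toFam_zero h.formLin_e_zero), Bar.toLin_toFam,
      h.intervalOp_totalWord, ← oddCoder_apply_word, Bar.toLin_toFam]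

theorem eval_comp (h : IsCoalgHomotopy 𝒜 m₀ m₁ W L) (r : ℝ) :
    (ofLin G (formEval A r)).comp (Bar.toFam h.formLin) = Bar.toFam (Bar.proj ∘ₗ W r) := by
  funext N β
  ext x
  obtain ⟨y, rfl⟩ := exists_extension x
  rw [← Bar.toLin_totalWord (Bar.toFam_zero h.formLin_e_zero), toLin_ofLin, LinearMap.comp_apply,
    h.proj_totalWord, Bar.toFam_apply, LinearMap.comp_apply]

theorem isAInfHom (h : IsCoalgHomotopy 𝒜 m₀ m₁ W L) (r : ℝ) :
    IsAInfHom 𝒜 m₀ 𝒜 m₁ (Bar.toFam (Bar.proj ∘ₗ W r)) :=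
  (h.isCoalgMap r).isAInfHom 𝒜 𝒜 (by rw [h.apply_e_zero, Bar.proj_e]) (h.map_scale _ r) (h.comm r)

theorem areHomotopic (h : IsCoalgHomotopy 𝒜 m₀ m₁ W L) (hm : IsAInfAlgebra 𝒜 m₁) :
    AreHomotopic 𝒜 m₀ 𝒜 m₁ (Bar.toFam (Bar.proj ∘ₗ W 0)) (Bar.toFam (Bar.proj ∘ₗ W 1)) :=
  ⟨h.isAInfHom 0, h.isAInfHom 1, intervalModel 𝒜 hm, Bar.toFam h.formLin, h.isAInfHom_formLin,
    h.eval_comp 0, h.eval_comp 1⟩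

end IsCoalgHomotopy
end Homotopy

/-! ### Integrals of vector-valued functions tested against functionals -/

section VectorIntegrals

open MeasureTheory

variable {X : Type*} [MeasurableSpace X] {μ : Measure X} {E F : Type*} [AddCommGroup E] [Module ℂ E]
  [AddCommGroup F] [Module ℂ F]

/-- The vector `I` is the integral of `f`, tested against linear functionals. -/
def HasIntegral (μ : Measure X) (f : X → E) (I : E) : Prop :=
  ∀ l : Module.Dual ℂ E, Integrable (fun τ => l (f τ)) μ ∧ ∫ τ, l (f τ) ∂μ = l I

namespace HasIntegral

theorem unique {f : X → E} {I J : E} (hI : HasIntegral μ f I) (hJ : HasIntegral μ f J) : I = J :=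
  eq_of_forall_dual fun l => (hI l).2.symm.trans (hJ l).2

theorem zero : HasIntegral μ (0 : X → E) 0 := fun l => by simp

theorem add {f g : X → E} {I J : E} (hf : HasIntegral μ f I) (hg : HasIntegral μ g J) :
    HasIntegral μ (f + g) (I + J) := fun l => by
  simp only [Pi.add_apply, map_add]
  exact ⟨(hf l).1.add (hg l).1, by rw [integral_add (hf l).1 (hg l).1, (hf l).2, (hg l).2]⟩

theorem const_smul {f : X → E} {I : E} (a : ℂ) (hf : HasIntegral μ f I) :
    HasIntegral μ (a • f) (a • I) := fun l => by
  simp only [Pi.smul_apply, map_smul]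
  exact ⟨(hf l).1.smul a, by rw [integral_smul, (hf l).2]⟩

theorem smul_const {c : X → ℂ} (hc : Integrable c μ) (w : E) :
    HasIntegral μ (fun x => c x • w) ((∫ x, c x ∂μ) • w) := fun l => by
  simp only [map_smul, smul_eq_mul]
  exact ⟨hc.mul_const _, integral_mul_const _ _⟩

theorem sum {ι : Type*} (s : Finset ι) {f : ι → X → E} {I : ι → E}
    (h : ∀ i ∈ s, HasIntegral μ (f i) (I i)) :
    HasIntegral μ (fun x => ∑ i ∈ s, f i x) (∑ i ∈ s, I i) := fun l => by
  simp only [map_sum]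
  exact ⟨integrable_finsetSum _ fun i hi => (h i hi l).1, by
    rw [integral_finsetSum _ fun i hi => (h i hi l).1]
    exact sum_congr rfl fun i hi => (h i hi l).2⟩

theorem congr_ae {f g : X → E} {I : E} (hf : HasIntegral μ f I) (h : f =ᵐ[μ] g) :
    HasIntegral μ g I := fun l => by
  have h' : (fun τ => l (f τ)) =ᵐ[μ] fun τ => l (g τ) := h.mono fun x hx => congr_arg l hx
  exact ⟨(hf l).1.congr h', by rw [← integral_congr_ae h', (hf l).2]⟩

theorem exists_of_mem {𝒞 : Subalgebra ℂ (X → ℂ)} (h𝒞 : ∀ c ∈ 𝒞, Integrable c μ) {f : X → E}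
    (hf : f ∈ finSums 𝒞 E) : ∃ I, HasIntegral μ f I := by
  induction hf using Submodule.span_induction with
  | mem f hf =>
    obtain ⟨c, hc, w, rfl⟩ := hf
    exact ⟨_, smul_const (h𝒞 c hc) w⟩
  | zero => exact ⟨0, zero⟩
  | add f g _ _ hf hg =>
    obtain ⟨I, hI⟩ := hf
    obtain ⟨J, hJ⟩ := hg
    exact ⟨_, hI.add hJ⟩
  | smul a f _ hf =>
    obtain ⟨I, hI⟩ := hf
    exact ⟨_, hI.const_smul a⟩

end HasIntegral

theorem exists_sum_of_mem_finSums {P : Type*} {𝒞 : Subalgebra ℂ (P → ℂ)} {f : P → E}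
    (hf : f ∈ finSums 𝒞 E) : ∃ (n : ℕ) (c : Fin n → P → ℂ) (w : Fin n → E),
      (∀ j, c j ∈ 𝒞) ∧ f = fun p => ∑ j, c j p • w j := by
  induction hf using Submodule.span_induction with
  | mem f hf =>
    obtain ⟨c, hc, w, rfl⟩ := hf
    exact ⟨1, fun _ => c, fun _ => w, fun _ => hc, by simp⟩
  | zero => exact ⟨0, Fin.elim0, Fin.elim0, fun j => j.elim0, by ext; simp⟩
  | add f g _ _ hf hg =>
    obtain ⟨n, c, w, hc, rfl⟩ := hf
    obtain ⟨m, d, v, hd, rfl⟩ := hg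
    refine ⟨n + m, Fin.append c d, Fin.append w v, fun j => ?_, ?_⟩
    · refine Fin.addCases (fun j => ?_) (fun j => ?_) j
      · simpa using hc j
      · simpa using hd j
    · ext p
      simp [Fin.sum_univ_add]
  | smul a f _ hf =>
    obtain ⟨n, c, w, hc, rfl⟩ := hf
    refine ⟨n, c, fun j => a • w j, hc, ?_⟩
    ext p
    simp only [Pi.smul_apply, smul_sum]
    exact sum_congr rfl fun j _ => smul_comm _ _ _

/-- Expanding each `f i` as a finite sum of scalars times vectors leaves integrals of products of
functions of separate variables, which factor. -/
theorem HasIntegral.multilinear {n : ℕ} {Y : Fin n → Type*} [∀ i, MeasurableSpace (Y i)]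
    {ν : ∀ i, Measure (Y i)} [∀ i, SigmaFinite (ν i)] {𝒞 : ∀ i, Subalgebra ℂ (Y i → ℂ)}
    (h𝒞 : ∀ i, ∀ c ∈ 𝒞 i, Integrable c (ν i)) {f : ∀ i, Y i → E}
    (hf : ∀ i, f i ∈ finSums (𝒞 i) E) {I : Fin n → E} (hI : ∀ i, HasIntegral (ν i) (f i) (I i))
    (M : MultilinearMap ℂ (fun _ : Fin n => E) F) :
    HasIntegral (Measure.pi ν) (fun y => M fun i => f i (y i)) (M I) := by
  choose k c w hc hw using fun i => exists_sum_of_mem_finSums (hf i)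
  have hI' : I = fun i => ∑ j, (∫ y, c i j y ∂ν i) • w i j := funext fun i =>
    (hI i).unique (by
      rw [hw i]
      exact HasIntegral.sum _ fun j _ => HasIntegral.smul_const (h𝒞 i _ (hc i j)) _)
  have hM : (fun y : ∀ i, Y i => M fun i => f i (y i)) = fun y =>
      ∑ r : ∀ i, Fin (k i), (∏ i, c i (r i) (y i)) • M fun i => w i (r i) := by
    ext y
    simp only [hw]
    rw [M.map_sum]
    simp only [M.map_smul_univ]
  rw [hM, hI', M.map_sum]
  simp only [M.map_smul_univ]
  refine HasIntegral.sum _ fun r _ => ?_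
  rw [← integral_fintype_prod_eq_prod]
  exact HasIntegral.smul_const (Integrable.fintype_prod_dep fun i => h𝒞 i _ (hc i _)) _

/-- Integrals are unique, so integrals chosen for each argument assemble to a multilinear map and
the default value in the definition does not occur. -/
theorem hasIntegral_integralMultilinear {k : ℕ}
    {f : X → MultilinearMap ℂ (fun _ : Fin k => E) E}
    (h : ∀ x, ∃ I, HasIntegral μ (fun τ => f τ x) I) (x : Fin k → E) :
    HasIntegral μ (fun τ => f τ x) (integralMultilinear μ f x) := by
  choose I hI using h
  have H : ∃ I : MultilinearMap ℂ (fun _ : Fin k => E) E, ∀ (x : Fin k → E) (l : Module.Dual ℂ E),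
      Integrable (fun τ => l (f τ x)) μ ∧ ∫ τ, l (f τ x) ∂μ = l (I x) := by
    refine ⟨⟨I, fun {_} x i y z => ?_, fun {_} x i a y => ?_⟩, fun x l => hI x l⟩
    · refine (hI _).unique ?_
      convert (hI (Function.update x i y)).add (hI (Function.update x i z)) using 1
      · ext τ
        convert (f τ).map_update_add x i y z
        rfl
    · refine (hI _).unique ?_
      convert (hI (Function.update x i y)).const_smul a using 1
      · ext τ
        convert (f τ).map_update_smul x i a y
        rfl
  rw [integralMultilinear, dif_pos H]
  exact H.choose_spec x

end VectorIntegrals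

/-! ### The space of time orderings of a tree with a root vertex -/

section Trees

open MeasureTheory

/-- The time parameters of a vertex and of the vertices of the subtrees at this vertex. -/
def optionSigmaEquiv {n : ℕ} (κ : Fin n → Type) :
    (ℝ × ∀ i, κ i → ℝ) ≃ᵐ (Option (Σ i, κ i) → ℝ) where
  toFun p v := v.elim p.1 fun w => p.2 w.1 w.2
  invFun τ := (τ none, fun i v => τ (some ⟨i, v⟩))
  left_inv p := rfl
  right_inv τ := by ext v; cases v <;> rfl
  measurable_toFun := by
    refine measurable_pi_lambda _ fun v => ?_
    cases v with
    | none => exact measurable_fst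
    | some w =>
      exact (measurable_pi_apply w.2).comp ((measurable_pi_apply w.1).comp measurable_snd)
  measurable_invFun := by
    refine Measurable.prodMk (measurable_pi_apply _) (measurable_pi_lambda _ fun i =>
      measurable_pi_lambda _ fun v => measurable_pi_apply _)

theorem measurePreserving_optionSigmaEquiv {n : ℕ} (κ : Fin n → Type) [∀ i, Fintype (κ i)] :
    MeasurePreserving (optionSigmaEquiv κ) volume volume := by
  refine ⟨(optionSigmaEquiv κ).measurable, (Measure.pi_eq fun s _ => ?_).symm⟩
  rw [(optionSigmaEquiv κ).measurableEmbedding.map_apply]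
  have h : optionSigmaEquiv κ ⁻¹' Set.univ.pi s =
      s none ×ˢ Set.univ.pi fun i => Set.univ.pi fun v => s (some ⟨i, v⟩) := by
    ext p
    simp only [Set.mem_preimage, Set.mem_pi, Set.mem_univ, true_imp_iff, Set.mem_prod]
    exact ⟨fun h => ⟨h none, fun i v => h (some ⟨i, v⟩)⟩, fun h v => by
      cases v with
      | none => exact h.1
      | some w => exact h.2 w.1 w.2⟩
  rw [h, Measure.volume_eq_prod, Measure.prod_prod, volume_pi, Measure.pi_pi, Fintype.prod_option,
    Fintype.prod_sigma]
  congr 1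
  refine prod_congr rfl fun i _ => ?_
  rw [volume_pi, Measure.pi_pi]

namespace DecTree

variable {Γ : Type} {n : ℕ} {β : Γ} {c : Fin n → DecTree Γ}

theorem le_none (v : (node n β c).Vert) : (node n β c).le v none := by
  rcases v with - | v <;> simp [le]

theorem not_none_le_some (w : Σ i, (c i).Vert) : ¬(node n β c).le none (some w) := by
  simp [le]

theorem some_le_some {i j : Fin n} {v : (c i).Vert} {w : (c j).Vert} :
    (node n β c).le (some ⟨i, v⟩) (some ⟨j, w⟩) ↔ ∃ h : i = j, (c j).le (h ▸ v) w := by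
  simp [le]

/-- Different branches are constrained only through the root, whose time is the upper bound for each
of them. -/
theorem mem_timeOrderings_node {t s : ℝ} {τ : ∀ i, (c i).Vert → ℝ} :
    optionSigmaEquiv (fun i => (c i).Vert) (s, τ) ∈ (node n β c).timeOrderings t ↔
      s ∈ Set.Icc 0 t ∧ ∀ i, τ i ∈ (c i).timeOrderings s := by
  constructor
  · rintro ⟨h1, h2⟩
    refine ⟨h1 none, fun i => ⟨fun v => ⟨(h1 (some ⟨i, v⟩)).1, h2 (some ⟨i, v⟩) none (le_none _)⟩,
      fun v w hvw => h2 (some ⟨i, v⟩) (some ⟨i, w⟩) (some_le_some.2 ⟨rfl, hvw⟩)⟩⟩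
  · rintro ⟨h1, h2⟩
    refine ⟨fun v => ?_, fun v w hvw => ?_⟩
    · rcases v with - | ⟨i, v⟩
      · exact h1
      · exact ⟨((h2 i).1 v).1, ((h2 i).1 v).2.trans h1.2⟩
    · rcases w with - | ⟨j, w⟩
      · rcases v with - | ⟨i, v⟩
        · exact le_rfl
        · exact ((h2 i).1 v).2
      · rcases v with - | ⟨i, v⟩
        · exact (not_none_le_some _ hvw).elim
        · obtain ⟨rfl, h⟩ := some_le_some.1 hvw
          exact (h2 i).2 v w h

theorem isCompact_timeOrderings (T : DecTree Γ) (t : ℝ) : IsCompact (T.timeOrderings t) := by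
  refine IsCompact.of_isClosed_subset (isCompact_univ_pi fun _ => isCompact_Icc (a := 0) (b := t)) ?_
    fun τ hτ v _ => hτ.1 v
  simp only [timeOrderings, Set.ofPred_and, Set.ofPred_forall]
  refine IsClosed.inter (isClosed_iInter fun v => ?_) (isClosed_iInter fun v =>
    isClosed_iInter fun w => isClosed_iInter fun _ => ?_)
  · exact isClosed_Icc.preimage (continuous_apply v)
  · exact isClosed_le (continuous_apply v) (continuous_apply w)

end DecTree
end Trees

/-! ### The recursion for tree integrals -/

section TreeIntegrals

open MeasureTheory

/-- The algebra of continuous functions. -/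
def contFun (P : Type*) [TopologicalSpace P] : Subalgebra ℂ (P → ℂ) where
  carrier := {c | Continuous c}
  mul_mem' {c d} (hc : Continuous c) (hd : Continuous d) := show Continuous _ from hc.mul hd
  add_mem' {c d} (hc : Continuous c) (hd : Continuous d) := show Continuous _ from hc.add hd
  algebraMap_mem' a := show Continuous fun _ => a from continuous_const

theorem integrable_of_mem_contFun {P : Type*} [TopologicalSpace P] [MeasurableSpace P]
    [OpensMeasurableSpace P] [T2Space P] {μ : Measure P} [IsFiniteMeasureOnCompacts μ] {K : Set P}
    (hK : IsCompact K) {c : P → ℂ} (hc : c ∈ contFun P) : Integrable c (μ.restrict K) :=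
  ContinuousOn.integrableOn_compact hK (Continuous.continuousOn hc)

/-- The integral of a function over `[0, t]` is a continuous function of `t`. -/
theorem continuous_setIntegral_Icc {c : ℝ → ℂ} (hc : Continuous c) :
    Continuous fun t => ∫ s in Set.Icc 0 t, c s := by
  have h : (fun t => ∫ s in Set.Icc 0 t, c s) = fun t => ∫ s in (0)..(max t 0), c s := by
    ext t
    rcases le_total 0 t with ht | ht
    · rw [max_eq_left ht, integral_Icc_eq_integral_Ioc, intervalIntegral.integral_of_le ht]
    · rw [max_eq_right ht, intervalIntegral.integral_same]
      refine setIntegral_measure_zero _ (measure_mono_null (t := {0}) ?_ (by simp))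
      exact fun s hs => le_antisymm (hs.2.trans ht) hs.1
  rw [h]
  exact (intervalIntegral.continuous_primitive (fun a b => hc.intervalIntegrable a b) 0).comp
    (continuous_id.max continuous_const)

theorem hasDerivWithinAt_setIntegral_Icc {c : ℝ → ℂ} (hc : Continuous c) {t : ℝ} (ht : 0 ≤ t) :
    HasDerivWithinAt (fun t => ∫ s in Set.Icc 0 t, c s) (c t) (Set.Ici 0) t := by
  have h : ∀ t ∈ Set.Ici (0 : ℝ), ∫ s in Set.Icc 0 t, c s = ∫ s in (0)..t, c s := fun t ht => by
    rw [integral_Icc_eq_integral_Ioc, intervalIntegral.integral_of_le ht]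
  exact (intervalIntegral.integral_hasDerivAt_right (hc.intervalIntegrable 0 t)
    (hc.stronglyMeasurableAtFilter _ _) hc.continuousAt).hasDerivWithinAt.congr h (h t ht)

variable {G : AddSubmonoid ℝ≥0} {A : Type*} [AddCommGroup A] [Module ℂ A]

namespace DecTree

instance : IsEmpty (leaf : DecTree G).Vert := inferInstanceAs (IsEmpty Empty)

theorem operadic_leaf (h : ℝ → Fam G A A) (τ : (leaf : DecTree G).Vert → ℝ)
    (x : Fin (leaf : DecTree G).leaves → A) : operadic h leaf τ x = x (0 : Fin 1) := by
  simp [operadic]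
  rfl

theorem operadic_node (h : ℝ → Fam G A A) {n : ℕ} (β : G) (c : Fin n → DecTree G)
    (τ : (node n β c).Vert → ℝ) (x : Fin (node n β c).leaves → A) :
    operadic h (node n β c) τ x = h (τ none) n β fun i =>
      operadic h (c i) (fun v => τ (some ⟨i, v⟩)) fun b =>
        x (finSigmaFinEquiv (n := fun i => (c i).leaves) ⟨i, b⟩) := by
  rw [operadic]
  rfl

/-- The integral of the operadic composition over the time orderings bounded by `t`. -/
def treeIntegral (h : ℝ → Fam G A A) (T : DecTree G) (t : ℝ) :
    MultilinearMap ℂ (fun _ : Fin T.leaves => A) A :=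
  integralMultilinear (volume.restrict (T.timeOrderings t)) (operadic h T)

variable {h : ℝ → Fam G A A}

/-- Without interior vertices the space of time orderings is one point of mass one. -/
theorem treeIntegral_leaf (t : ℝ) (x : Fin (leaf : DecTree G).leaves → A) :
    treeIntegral h leaf t x = x (0 : Fin 1) := by
  have hs : (leaf : DecTree G).timeOrderings t = Set.univ :=
    Set.eq_univ_of_forall fun τ => ⟨isEmptyElim, isEmptyElim⟩
  have h1 : ∀ x : Fin (leaf : DecTree G).leaves → A,
      HasIntegral (volume.restrict ((leaf : DecTree G).timeOrderings t))
        (fun τ => operadic h leaf τ x) (x (0 : Fin 1)) := fun x => by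
    have h2 : (volume : Measure ((leaf : DecTree G).Vert → ℝ)) = Measure.dirac isEmptyElim :=
      Measure.pi_of_empty _
    simp only [operadic_leaf]
    intro l
    rw [hs, Measure.restrict_univ, h2]
    exact ⟨integrable_const _, by simp⟩
  exact (hasIntegral_integralMultilinear (fun x => ⟨_, h1 x⟩) x).unique (h1 x)

section Continuous

variable (hc : ∀ k β x, (fun s => h s k β x) ∈ finSums (contFun ℝ) A)
include hc

theorem operadic_mem (T : DecTree G) (x : Fin T.leaves → A) :
    (fun τ => operadic h T τ x) ∈ finSums (contFun (T.Vert → ℝ)) A := by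
  induction T with
  | leaf =>
    simp only [operadic_leaf]
    exact const_mem_finSums _
  | node n β c ih =>
    simp only [operadic_node]
    refine multilinear_mem_finSums (fun x => ?_) fun i => ?_
    · exact comp_mem_finSums (ψ := fun τ : (node n β c).Vert → ℝ => τ none)
        (fun d (hd : Continuous d) => (show Continuous _ from hd.comp (continuous_apply _)))
        (hc n β x)
    · exact comp_mem_finSums (ψ := fun (τ : (node n β c).Vert → ℝ) (v : (c i).Vert) =>
          τ (some ⟨i, v⟩))
        (fun d (hd : Continuous d) => (show Continuous _ from hd.comp
          (continuous_pi fun v => continuous_apply _))) (ih i _)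

theorem hasIntegral_treeIntegral (T : DecTree G) (t : ℝ) (x : Fin T.leaves → A) :
    HasIntegral (volume.restrict (T.timeOrderings t)) (fun τ => operadic h T τ x)
      (treeIntegral h T t x) :=
  hasIntegral_integralMultilinear (fun x => HasIntegral.exists_of_mem
    (fun _ => integrable_of_mem_contFun (T.isCompact_timeOrderings t)) (operadic_mem hc T x)) x

/-- Fubini with the time `s` of the root outermost: for fixed `s` the branches are independent and
are integrated over their time orderings bounded by `s`. -/
theorem hasIntegral_treeIntegral_node {n : ℕ} (β : G) (c : Fin n → DecTree G) (t : ℝ)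
    (x : Fin (node n β c).leaves → A) :
    HasIntegral (volume.restrict (Set.Icc 0 t)) (fun s => h s n β fun i =>
      treeIntegral h (c i) s fun b => x (finSigmaFinEquiv (n := fun i => (c i).leaves) ⟨i, b⟩))
      (treeIntegral h (node n β c) t x) := by
  intro l
  obtain ⟨h1, h2⟩ := hasIntegral_treeIntegral hc (node n β c) t x l
  obtain ⟨e, hm, hmem, heval⟩ : ∃ e : (ℝ × ∀ i, (c i).Vert → ℝ) ≃ᵐ ((node n β c).Vert → ℝ),
      MeasurePreserving e volume volume ∧
      (∀ s τ, e (s, τ) ∈ (node n β c).timeOrderings t ↔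
        s ∈ Set.Icc 0 t ∧ ∀ i, τ i ∈ (c i).timeOrderings s) ∧
      ∀ s τ, operadic h (node n β c) (e (s, τ)) x = h s n β fun i =>
        operadic h (c i) (τ i) fun b =>
          x (finSigmaFinEquiv (n := fun i => (c i).leaves) ⟨i, b⟩) :=
    ⟨optionSigmaEquiv fun i => (c i).Vert, measurePreserving_optionSigmaEquiv _,
      fun s τ => mem_timeOrderings_node, fun s τ => operadic_node h β c _ x⟩
  set S := (node n β c).timeOrderings t with hS
  have hSm : MeasurableSet (e ⁻¹' S) :=
    e.measurable ((node n β c).isCompact_timeOrderings t).measurableSet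
  set φ : ((node n β c).Vert → ℝ) → ℂ := fun τ => l (operadic h (node n β c) τ x) with hφ
  have h3 : Integrable ((e ⁻¹' S).indicator (φ ∘ e)) (volume.prod volume) :=
    (integrable_indicator_iff hSm).2 ((hm.integrableOn_comp_preimage e.measurableEmbedding).2 h1)
  have h4 : ∀ s, ∫ τ, (e ⁻¹' S).indicator (φ ∘ e) (s, τ) =
      (Set.Icc 0 t).indicator (fun s => l (h s n β fun i => treeIntegral h (c i) s fun b =>
        x (finSigmaFinEquiv (n := fun i => (c i).leaves) ⟨i, b⟩))) s := by
    intro s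
    by_cases hs : s ∈ Set.Icc 0 t
    · have h5 : (fun τ => (e ⁻¹' S).indicator (φ ∘ e) (s, τ)) =
          (Set.univ.pi fun i => (c i).timeOrderings s).indicator fun τ => l (h s n β fun i =>
            operadic h (c i) (τ i) fun b =>
              x (finSigmaFinEquiv (n := fun i => (c i).leaves) ⟨i, b⟩)) := by
        ext τ
        by_cases hτ : ∀ i, τ i ∈ (c i).timeOrderings s
        · exact (Set.indicator_of_mem (s := e ⁻¹' S) ((hmem s τ).2 ⟨hs, hτ⟩) _).trans
            ((congr_arg l (heval s τ)).trans (Set.indicator_of_mem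
              (s := Set.univ.pi fun i => (c i).timeOrderings s) (fun i _ => hτ i)
              fun τ => l (h s n β fun i => operadic h (c i) (τ i) fun b =>
                x (finSigmaFinEquiv (n := fun i => (c i).leaves) ⟨i, b⟩))).symm)
        · exact (Set.indicator_of_notMem (s := e ⁻¹' S)
            (fun hm => hτ ((hmem s τ).1 hm).2) _).trans (Set.indicator_of_notMem
              (s := Set.univ.pi fun i => (c i).timeOrderings s)
              (fun hm => hτ fun i => hm i trivial) _).symm
      rw [h5, Set.indicator_of_mem hs, integral_indicator (MeasurableSet.univ_pi fun i =>
        ((c i).isCompact_timeOrderings s).measurableSet), volume_pi, Measure.restrict_pi_pi]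
      exact (HasIntegral.multilinear
        (fun i _ => integrable_of_mem_contFun ((c i).isCompact_timeOrderings s))
        (fun i => operadic_mem hc (c i) _) (fun i => hasIntegral_treeIntegral hc (c i) s _)
        (h s n β) l).2
    · rw [Set.indicator_of_notMem hs]
      refine (integral_congr_ae (Filter.Eventually.of_forall fun τ => ?_)).trans
        (integral_zero _ ℂ)
      exact Set.indicator_of_notMem (fun hm => hs ((hmem s τ).1 hm).1) _
  have h6 := h3.integral_prod_left
  have h7 := integral_prod _ h3
  simp only [h4] at h6 h7
  refine ⟨(integrable_indicator_iff measurableSet_Icc).1 h6, ?_⟩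
  rw [← h2, ← integral_indicator measurableSet_Icc, ← h7, ← Measure.volume_eq_prod,
    integral_indicator hSm]
  exact hm.setIntegral_preimage_emb e.measurableEmbedding φ S

theorem treeIntegral_mem (T : DecTree G) (x : Fin T.leaves → A) :
    (fun t => treeIntegral h T t x) ∈ finSums (contFun ℝ) A := by
  induction T with
  | leaf =>
    simp only [treeIntegral_leaf]
    exact const_mem_finSums _
  | node n β c ih =>
    have h1 : (fun s => h s n β fun i => treeIntegral h (c i) s fun b =>
        x (finSigmaFinEquiv (n := fun i => (c i).leaves) ⟨i, b⟩)) ∈ finSums (contFun ℝ) A :=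
      multilinear_mem_finSums (hc n β) fun i => ih i _
    obtain ⟨k, d, w, hd, hw⟩ := exists_sum_of_mem_finSums h1
    have h2 : (fun t => treeIntegral h (node n β c) t x) =
        ∑ j, fun t => (∫ s in Set.Icc 0 t, d j s) • w j := by
      ext t
      rw [Finset.sum_apply]
      refine (hasIntegral_treeIntegral_node hc β c t x).unique ?_
      rw [hw]
      exact HasIntegral.sum _ fun j _ => HasIntegral.smul_const
        (integrable_of_mem_contFun isCompact_Icc (hd j)) _
    rw [h2]
    exact sum_mem fun j _ => smul_const_mem_finSums (continuous_setIntegral_Icc (hd j)) _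

/-- The fundamental theorem of calculus applied to the time of the root. It is one-sided at 0, since
there are no time orderings for negative bounds. -/
theorem hasDerivWithinAt_treeIntegral_node {n : ℕ} (β : G) (c : Fin n → DecTree G)
    (x : Fin (node n β c).leaves → A) (l : Module.Dual ℂ A) {t : ℝ} (ht : 0 ≤ t) :
    HasDerivWithinAt (fun t => l (treeIntegral h (node n β c) t x))
      (l (h t n β fun i => treeIntegral h (c i) t fun b =>
        x (finSigmaFinEquiv (n := fun i => (c i).leaves) ⟨i, b⟩))) (Set.Ici 0) t := by
  have h1 : Continuous fun s => l (h s n β fun i => treeIntegral h (c i) s fun b =>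
      x (finSigmaFinEquiv (n := fun i => (c i).leaves) ⟨i, b⟩)) :=
    dual_mem_of_mem_finSums (multilinear_mem_finSums (hc n β) fun i => treeIntegral_mem hc _ _) l
  have h2 : (fun t => l (treeIntegral h (node n β c) t x)) = fun t => ∫ s in Set.Icc 0 t,
      l (h s n β fun i => treeIntegral h (c i) s fun b =>
        x (finSigmaFinEquiv (n := fun i => (c i).leaves) ⟨i, b⟩)) :=
    funext fun t => (hasIntegral_treeIntegral_node hc β c t x l).2.symm
  rw [h2]
  exact hasDerivWithinAt_setIntegral_Icc h1 ht

theorem treeIntegral_node_zero {n : ℕ} (β : G) (c : Fin n → DecTree G)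
    (x : Fin (node n β c).leaves → A) : treeIntegral h (node n β c) 0 x = 0 :=
  eq_of_forall_dual fun l => by
    rw [← (hasIntegral_treeIntegral_node hc β c 0 x l).2, _root_.map_zero]
    simp

end Continuous
end DecTree
end TreeIntegrals

/-! ### Sums over trees all of whose vertices have nonzero energy -/

section PositiveTrees

variable {G : AddSubmonoid ℝ≥0}

namespace DecTree

/-- All decorations are different from zero. -/
def Positive {Γ : Type} [Zero Γ] : DecTree Γ → Prop
  | leaf => True
  | node _ β c => β ≠ 0 ∧ ∀ i, (c i).Positive

theorem Positive.stable {T : DecTree G} (h : T.Positive) : T.Stable := by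
  induction T with
  | leaf => trivial
  | node n β c ih => exact ⟨fun h0 => (h.1 h0).elim, fun i => ih i (h.2 i)⟩

theorem add_ne_zero_left {a b : G} (h : a ≠ 0) : a + b ≠ 0 := fun hab => h <| by
  have h1 : (a : ℝ≥0) + (b : ℝ≥0) = 0 := congrArg Subtype.val hab
  exact Subtype.ext (add_eq_zero.1 h1).1

theorem Positive.ne_zero {T : DecTree G} (h : T.Positive) : (T.leaves, T.energy) ≠ 0 := by
  cases T with
  | leaf => simp [leaves]
  | node n β c =>
    intro h0
    exact add_ne_zero_left h.1 (congr_arg Prod.snd h0)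

variable (G) in
/-- The positive trees with given number of leaves and energy. -/
def posTrees (N : ℕ) (β : G) : Set (DecTree G) :=
  {T | T.Positive ∧ T.leaves = N ∧ T.energy = β}

theorem node_mem_posTrees {N : ℕ} {β : G} {d : BlockSplit G N β} (hd : d.outer ≠ 0)
    {c : Fin d.j → DecTree G} (hc : ∀ a, c a ∈ posTrees G (d.size a) (d.inner a)) :
    node d.j d.outer c ∈ posTrees G N β := by
  exact ⟨⟨hd, fun i => (hc i).1⟩, (sum_congr rfl fun i _ => (hc i).2.1).trans d.size_sum,
    (congr_arg (d.outer + ·) (sum_congr rfl fun i _ => (hc i).2.2)).trans d.energy_sum⟩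

end DecTree

section TreeValues

open MeasureTheory

variable {A : Type*} [AddCommGroup A] [Module ℂ A] {h : ℝ → Fam G A A}

/-- The position of the first letter of a block. -/
def blockStart {n : ℕ} (size : Fin n → ℕ) (i : Fin n) : ℕ :=
  ∑ j : Fin i, size (Fin.castLE i.2.le j)

namespace DecTree

/-- The tree integrals as functions of sequences. -/
def treeVal (h : ℝ → Fam G A A) (T : DecTree G) (t : ℝ) (x : ℕ → A) : A :=
  treeIntegral h T t fun a => x a

theorem treeVal_leaf (t : ℝ) (x : ℕ → A) : treeVal h leaf t x = x 0 := treeIntegral_leaf t _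

theorem hasDerivWithinAt_treeVal_node
    (hc : ∀ k β x, (fun s => h s k β x) ∈ finSums (contFun ℝ) A) {n : ℕ} (β : G)
    {c : Fin n → DecTree G} {size : Fin n → ℕ} (hs : ∀ i, (c i).leaves = size i) (x : ℕ → A)
    (l : Module.Dual ℂ A) {t : ℝ} (ht : 0 ≤ t) :
    HasDerivWithinAt (fun t => l (treeVal h (node n β c) t x))
      (l (h t n β fun i => treeVal h (c i) t fun b => x (blockStart size i + b)))
      (Set.Ici 0) t := by
  obtain rfl : (fun i => (c i).leaves) = size := funext hs
  have h1 := hasDerivWithinAt_treeIntegral_node hc β c (fun a => x a) l ht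
  have h2 : ∀ i, treeVal h (c i) t (fun b => x (blockStart (fun i => (c i).leaves) i + b)) =
      treeIntegral h (c i) t fun b =>
        x (finSigmaFinEquiv (n := fun i => (c i).leaves) ⟨i, b⟩) := fun i =>
    congr_arg (treeIntegral h (c i) t) (funext fun b => congr_arg x (by
      rw [finSigmaFinEquiv_apply]; rfl))
  simp only [h2]
  exact h1

/-- Some vertex carries energy zero, and the map placed there vanishes. -/
theorem operadic_eq_zero (hp : ∀ s k, h s k 0 = 0) {T : DecTree G} (hT : ¬T.Positive)
    (τ : T.Vert → ℝ) (x : Fin T.leaves → A) : operadic h T τ x = 0 := by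
  induction T with
  | leaf => exact (hT trivial).elim
  | node n β c ih =>
    rw [operadic_node]
    by_cases hβ : β = 0
    · rw [hβ, hp]; rfl
    · obtain ⟨i, hi⟩ : ∃ i, ¬(c i).Positive := by
        by_contra! hcon
        exact hT ⟨hβ, hcon⟩
      exact (h (τ none) n β).map_coord_zero i (ih i hi _ _)

theorem operadic_congr {h' : ℝ → Fam G A A} {T : DecTree G} {τ : T.Vert → ℝ}
    (hτ : ∀ v, h (τ v) = h' (τ v)) (x : Fin T.leaves → A) :
    operadic h T τ x = operadic h' T τ x := by
  induction T with
  | leaf => rw [operadic_leaf, operadic_leaf]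
  | node n β c ih =>
    rw [operadic_node, operadic_node, hτ none]
    congr 1
    ext i
    exact ih i (fun v => hτ (some ⟨i, v⟩)) _

theorem treeIntegral_eq_zero (hc : ∀ k β x, (fun s => h s k β x) ∈ finSums (contFun ℝ) A)
    (hp : ∀ s k, h s k 0 = 0) {T : DecTree G} (hT : ¬T.Positive) (t : ℝ) :
    treeIntegral h T t = 0 := by
  ext x
  refine (hasIntegral_treeIntegral hc T t x).unique ?_
  simp only [operadic_eq_zero hp hT]
  exact HasIntegral.zero

/-- Only times in [0, t] enter, so the family may be replaced outside that interval. -/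
theorem treeIntegral_congr {h' : ℝ → Fam G A A}
    (hc : ∀ k β x, (fun s => h s k β x) ∈ finSums (contFun ℝ) A) {t : ℝ}
    (hh : ∀ s ∈ Set.Icc 0 t, h s = h' s) (T : DecTree G) :
    treeIntegral h' T t = treeIntegral h T t := by
  have h1 : ∀ x, HasIntegral (volume.restrict (T.timeOrderings t)) (fun τ => operadic h' T τ x)
      (treeIntegral h T t x) := fun x => (hasIntegral_treeIntegral hc T t x).congr_ae <| by
    filter_upwards [ae_restrict_mem (T.isCompact_timeOrderings t).measurableSet] with τ hτ
    exact operadic_congr (fun v => hh _ (hτ.1 v)) x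
  ext x
  exact (hasIntegral_integralMultilinear (fun x => ⟨_, h1 x⟩) x).unique (h1 x)

end DecTree

end TreeValues

variable [HasAntidiagonal G]

/-- The splittings into blocks for which neither the outer map nor a block is empty of energy
zero. -/
def BlockSplit.nodes (N : ℕ) (β : G) : Finset (BlockSplit G N β) := by
  classical
  exact (BlockSplit.reduced_finite N β).toFinset.filter fun d => d.outer ≠ 0

theorem BlockSplit.mem_nodes {N : ℕ} {β : G} {d : BlockSplit G N β} :
    d ∈ nodes N β ↔ d ∈ reduced N β ∧ d.outer ≠ 0 := by
  simp [nodes]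

/-- The root consumes nonzero energy, so every branch has smaller rank; inductions on trees can
therefore run over the rank. -/
theorem BlockSplit.energyRank_inner_lt {N : ℕ} {β : G} {d : BlockSplit G N β} (h : d.outer ≠ 0)
    (a : Fin d.j) : Bar.energyRank (d.inner a) < Bar.energyRank β := by
  classical
  have h1 : β = d.outer + ∑ b ∈ univ.erase a, d.inner b + d.inner a := by
    rw [add_assoc, sum_erase_add _ _ (mem_univ a), d.energy_sum]
  conv_rhs => rw [h1]
  exact Bar.energyRank_lt (DecTree.add_ne_zero_left h)

namespace DecTree

theorem exists_of_node_mem {N : ℕ} {β : G} {n : ℕ} {o : G} {c : Fin n → DecTree G}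
    (h : node n o c ∈ posTrees G N β) : ∃ d ∈ BlockSplit.nodes N β,
      ∃ c' : Fin d.j → DecTree G, (∀ a, c' a ∈ posTrees G (d.size a) (d.inner a)) ∧
        node d.j d.outer c' = node n o c := by
  obtain ⟨h1, h2, h3⟩ := h
  refine ⟨⟨n, fun i => (c i).leaves, o, fun i => (c i).energy, h2, h3⟩,
    BlockSplit.mem_nodes.2 ⟨fun a => (h1.2 a).ne_zero, h1.1⟩, c, fun a => ⟨h1.2 a, rfl, rfl⟩, rfl⟩

theorem posTrees_finite (N : ℕ) (β : G) : (posTrees G N β).Finite := by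
  obtain ⟨r, hr⟩ : ∃ r, Bar.energyRank β < r := ⟨_, Nat.lt_succ_self _⟩
  induction r generalizing N β with
  | zero => omega
  | succ r ih =>
    refine Set.Finite.subset ((Set.finite_singleton (leaf : DecTree G)).union
      (Set.Finite.biUnion (finite_toSet (BlockSplit.nodes N β)) (t := fun d =>
        (node d.j d.outer) '' Set.univ.pi fun a => posTrees G (d.size a) (d.inner a))
        fun d hd => Set.Finite.image _ (Set.Finite.pi fun a => ih _ _ ?_))) fun T hT => ?_
    · have := BlockSplit.energyRank_inner_lt (BlockSplit.mem_nodes.1 hd).2 a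
      omega
    · cases T with
      | leaf => exact Or.inl rfl
      | node n o c =>
        obtain ⟨d, hd, c', hc', h⟩ := exists_of_node_mem hT
        exact Or.inr (Set.mem_biUnion hd ⟨c', fun a _ => hc' a, h⟩)

/-- A tree is a leaf, or a root together with a splitting of leaves and energy among its branches
and a choice of branches. No branch is empty of energy zero, so these splittings are those of
`Fam.comp_apply` with nonzero outer energy. -/
theorem sum_posTrees {M : Type*} [AddCommMonoid M] (N : ℕ) (β : G) (g : DecTree G → M) :
    ∑ T ∈ (posTrees_finite N β).toFinset, g T = (if N = 1 ∧ β = 0 then g leaf else 0) +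
      ∑ d ∈ BlockSplit.nodes N β, ∑ c ∈ Fintype.piFinset fun a =>
        (posTrees_finite (d.size a) (d.inner a)).toFinset, g (node d.j d.outer c) := by
  classical
  have hnode : ∀ (d : BlockSplit G N β) (c : Fin d.j → DecTree G),
      (⟨d, c⟩ : Σ d : BlockSplit G N β, (Fin d.j → DecTree G)) ∈ (BlockSplit.nodes N β).sigma
        (fun d => Fintype.piFinset fun a => (posTrees_finite (d.size a) (d.inner a)).toFinset) ↔
      d ∈ BlockSplit.nodes N β ∧ ∀ a, c a ∈ posTrees G (d.size a) (d.inner a) := fun d c => by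
    simp [Fintype.mem_piFinset]
  rw [← sum_filter_add_sum_filter_not _ (fun T => T = leaf), sum_sigma']
  congr 1
  · rw [sum_filter, sum_ite_eq' _ leaf]
    refine if_congr ?_ rfl rfl
    rw [Set.Finite.mem_toFinset]
    exact ⟨fun h => ⟨h.2.1.symm, h.2.2.symm⟩, fun h => ⟨trivial, h.1.symm, h.2.symm⟩⟩
  · symm
    refine sum_bij (fun d _ => node d.1.j d.1.outer d.2) ?_ ?_ ?_ fun _ _ => rfl
    · rintro ⟨d, c⟩ h
      rw [hnode] at h
      rw [mem_filter, Set.Finite.mem_toFinset]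
      exact ⟨node_mem_posTrees (BlockSplit.mem_nodes.1 h.1).2 h.2, nofun⟩
    · rintro ⟨⟨n, s, o, i, h1, h2⟩, c⟩ h ⟨⟨n', s', o', i', h1', h2'⟩, c'⟩ h' heq
      rw [hnode] at h h'
      simp only [node.injEq] at heq
      obtain ⟨rfl, rfl, hc⟩ := heq
      obtain rfl := eq_of_heq hc
      obtain rfl : s = s' := funext fun a => (h.2 a).2.1.symm.trans (h'.2 a).2.1
      obtain rfl : i = i' := funext fun a => (h.2 a).2.2.symm.trans (h'.2 a).2.2
      rfl
    · intro T hT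
      rw [mem_filter, Set.Finite.mem_toFinset] at hT
      cases T with
      | leaf => exact (hT.2 rfl).elim
      | node n o c =>
        obtain ⟨d, hd, c', hc', h⟩ := exists_of_node_mem hT.1
        exact ⟨⟨d, c'⟩, (hnode _ _).2 ⟨hd, hc'⟩, h⟩

end DecTree

section TreeSums

open MeasureTheory

variable {A : Type*} [AddCommGroup A] [Module ℂ A] {h : ℝ → Fam G A A}

open DecTree

/-- Stable trees with a vertex of energy zero contribute nothing, and positive trees are
automatically stable. -/
theorem IntervalForm.hom_apply {γ : IntervalForm G A}
    (hc : ∀ k β x, (fun s => h s k β x) ∈ finSums (contFun ℝ) A) (hp : ∀ s k, h s k 0 = 0)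
    (hh : ∀ s ∈ Set.Icc 0 1, h s = γ.h s) (N : ℕ) (β : G) (x : ℕ → A) :
    (γ.hom N β fun a => x a) = ∑ T ∈ (posTrees_finite N β).toFinset, treeVal h T 1 x := by
  have hT : ∀ T, integralMultilinear (volume.restrict (T.timeOrderings 1)) (operadic γ.h T) =
      treeIntegral h T 1 := fun T => treeIntegral_congr hc hh T
  rw [IntervalForm.hom]
  simp only [hT]
  have hfin : {T : {T : DecTree G // T.Stable ∧ T.leaves = N ∧ T.energy = β} | T.1.Positive}.Finite :=
    ((posTrees_finite N β).preimage Subtype.val_injective.injOn).subset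
      fun T hT => ⟨hT, T.2.2.1, T.2.2.2⟩
  rw [finsum_eq_sum_of_support_subset (s := hfin.toFinset), _root_.sum_apply]
  · refine sum_bij (fun T _ => T.1) ?_ ?_ ?_ ?_
    · intro T hT
      rw [Set.Finite.mem_toFinset] at hT ⊢
      exact ⟨hT, T.2.2.1, T.2.2.2⟩
    · exact fun T _ T' _ hTT => Subtype.ext hTT
    · intro T hT
      rw [Set.Finite.mem_toFinset] at hT
      exact ⟨⟨T, hT.1.stable, hT.2⟩, (Set.Finite.mem_toFinset _).2 hT.1, rfl⟩
    · intro T _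
      rfl
  · intro T hT'
    rw [Set.Finite.coe_toFinset]
    by_contra hpos
    apply hT'
    change (treeIntegral h T.1 1).domDomCongr _ = 0
    rw [treeIntegral_eq_zero hc hp hpos]
    rfl

/-- Both sides start from the identity family, where on the tree side only the leaf contributes at
time 0, and both have derivative `u.comp V`. The derivative involves only smaller energies because
`h` has no component of energy zero, so induction on the rank applies. -/
theorem eq_sum_posTrees (hc : ∀ k β x, (fun s => h s k β x) ∈ finSums (contFun ℝ) A)
    (hp : ∀ s k, h s k 0 = 0) {σ σ' : ℝ → ℝ} (hσ : ∀ t, HasDerivAt σ (σ' t) t)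
    (hσ0 : σ 0 = 0) (hσ1 : ∀ t, 0 ≤ σ t) {u V : ℝ → Fam G A A}
    (hu : ∀ t, u t = (σ' t : ℂ) • h (σ t)) (hV : ∀ t, V t 0 0 = 0)
    (hV0 : ∀ N β x, (V 0 N β fun a => x a) = Bar.proj (Bar.word N x β))
    (hVd : ∀ N β (x : ℕ → A) (l : Module.Dual ℂ A) t, HasDerivAt (fun t => l (V t N β fun a => x a))
      (l ((u t).comp (V t) N β fun a => x a)) t)
    (N : ℕ) (β : G) (x : ℕ → A) (t : ℝ) :
    (V t N β fun a => x a) = ∑ T ∈ (posTrees_finite N β).toFinset, treeVal h T (σ t) x := by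
  obtain ⟨r, hr⟩ : ∃ r, Bar.energyRank β < r := ⟨_, Nat.lt_succ_self _⟩
  induction r generalizing N β x t with
  | zero => omega
  | succ r ih =>
    classical
    refine eq_of_forall_dual fun l => ?_
    have h1 : ∀ t, HasDerivAt
        (fun t => l (∑ T ∈ (posTrees_finite N β).toFinset, treeVal h T (σ t) x))
        (l ((u t).comp (V t) N β fun a => x a)) t := by
      intro t
      simp only [sum_posTrees, treeVal_leaf, map_add, map_sum]
      have h2 : l ((u t).comp (V t) N β fun a => x a) =
          ∑ d ∈ BlockSplit.nodes N β, ∑ c ∈ Fintype.piFinset fun a =>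
            (posTrees_finite (d.size a) (d.inner a)).toFinset, σ' t • l (h (σ t) d.j d.outer
              fun a => treeVal h (c a) (σ t) fun b => x (blockStart d.size a + b)) := by
        rw [Fam.comp_apply (hV t), map_sum, BlockSplit.nodes, sum_filter]
        refine sum_congr rfl fun d hd => ?_
        split_ifs with ho
        · have h3 : ∀ a, (V t (d.size a) (d.inner a) fun i =>
              x (Fin.cast d.size_sum (finSigmaFinEquiv ⟨a, i⟩))) =
              ∑ T ∈ (posTrees_finite (d.size a) (d.inner a)).toFinset,
                treeVal h T (σ t) fun b => x (blockStart d.size a + b) := fun a => by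
            have := BlockSplit.energyRank_inner_lt ho a
            rw [← ih (d.size a) (d.inner a) (fun b => x (blockStart d.size a + b)) t (by omega)]
            refine congr_arg (V t _ _) (funext fun i => congr_arg x ?_)
            rw [Fin.val_cast, finSigmaFinEquiv_apply]
            rfl
          simp only [h3]
          rw [MultilinearMap.map_sum_finset, map_sum]
          refine sum_congr rfl fun c _ => ?_
          rw [hu]
          exact map_smul l (σ' t : ℂ) _
        · rw [not_not] at ho
          rw [hu]
          change l ((σ' t : ℂ) • h (σ t) d.j d.outer _) = 0
          rw [ho, hp]
          simp
      rw [h2]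
      refine (HasDerivAt.fun_sum fun d hd => HasDerivAt.fun_sum fun c hcc => ?_).const_add _
      rw [Fintype.mem_piFinset] at hcc
      -- The tree integral has only a derivative within [0, ∞) at 0; the chain rule still applies as
      -- `σ` takes nonnegative values.
      exact (hasDerivWithinAt_treeVal_node hc d.outer (fun i => ((Set.Finite.mem_toFinset _).1
        (hcc i)).2.1) x l (hσ1 t)).scomp_hasDerivAt t (hσ t) hσ1
    have h4 : ∀ t, HasDerivAt (fun t => l (V t N β fun a => x a) -
        l (∑ T ∈ (posTrees_finite N β).toFinset, treeVal h T (σ t) x)) 0 t := fun t =>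
      ((hVd N β x l t).fun_sub (h1 t)).congr_deriv (sub_self _)
    have h5 := is_const_of_deriv_eq_zero (fun t => (h4 t).differentiableAt) (fun t => (h4 t).deriv) t 0
    have h6 : (V 0 N β fun a => x a) =
        ∑ T ∈ (posTrees_finite N β).toFinset, treeVal h T (σ 0) x := by
      rw [hV0, sum_posTrees, hσ0, treeVal_leaf, sum_eq_zero fun d _ => sum_eq_zero fun c _ =>
        treeIntegral_node_zero hc d.outer c _, add_zero]
      by_cases hN : N = 1
      · subst hN
        rw [proj_word_one]
        simp
      · rw [proj_word_of_ne hN, if_neg fun h => hN h.1]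
    simp only [h6, sub_self] at h5
    exact sub_eq_zero.1 h5

end TreeSums
end PositiveTrees

/-! ### Identification of the flows with F -/

section FlowTrees

variable {G : AddSubmonoid ℝ≥0} {A : Type*}

/-- The summands of `β` lie in `G ∩ [0, β]`, which is finite. -/
theorem nonempty_hasAntidiagonal (hG : ∀ E : ℝ≥0, {β : ℝ≥0 | β ∈ G ∧ β ≤ E}.Finite) :
    Nonempty (HasAntidiagonal G) := by
  have h : ∀ β : G, {p : G × G | p.1 + p.2 = β}.Finite := fun β => by
    have h1 : {a : G | a ≤ β}.Finite :=
      ((hG β).preimage Subtype.val_injective.injOn).subset fun a ha => ⟨a.2, ha⟩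
    refine (h1.prod h1).subset fun p hp => ?_
    rw [Set.mem_ofPred_eq] at hp
    subst hp
    exact ⟨show (p.1 : ℝ≥0) ≤ p.1 + p.2 from le_self_add,
      show (p.2 : ℝ≥0) ≤ p.1 + p.2 from le_add_self⟩
  exact ⟨⟨fun β => (h β).toFinset, by simp⟩⟩

theorem IsTwoPseudoIsotopy.isAInfAlgebra [NonUnitalRing A] [Module ℂ A]
    [IsScalarTower ℂ A A] [SMulCommClass ℂ A A] {𝒜 : ℤ → Submodule ℂ A}
    [DirectSum.Decomposition 𝒜] [SetLike.GradedMul 𝒜] {D : A →ₗ[ℂ] A}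
    (hD : IsDGDifferential 𝒜 D) {α : TriangleForm G A}
    (hα : IsTwoPseudoIsotopy 𝒜 D α) {p : ℝ × ℝ} (hp : p ∈ triangle) :
    IsAInfAlgebra 𝒜 (barDifferential G 𝒜 D + α.m p) where
  degree k β := (hasDegree_barDifferential 𝒜 G hD k β).add (hα.degree_m p hp k β)
  gapped := by
    have := (hα.positive p hp 0).1
    simp [this, barDifferential]
  relation := hα.mc_zero p hp

theorem TriangleForm.pullback_path [NonUnitalRing A] [Module ℂ A] (α : TriangleForm G A)
    {Ψ : ℝ × ℝ → ℝ × ℝ}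
    (hΨ : ContDiff ℝ ∞ Ψ) {s : ℝ} {a v : ℝ × ℝ} {σ : ℝ → ℝ} {σ' t : ℝ} (hσ : HasDerivAt σ σ' t)
    (hs : ∀ t, Ψ (t, s) = a + σ t • v) :
    α.pullback Ψ (1, 0) (t, s) = (σ' : ℂ) •
      ((v.1 : ℂ) • α.h₁ (a + σ t • v) + (v.2 : ℂ) • α.h₂ (a + σ t • v)) := by
  have h1 : HasDerivAt (fun t => Ψ (t, s)) (fderiv ℝ Ψ (t, s) (1, 0)) t :=
    ((hΨ.differentiable (by simp) (t, s)).hasFDerivAt).comp_hasDerivAt t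
      ((hasDerivAt_id t).prodMk (hasDerivAt_const t s))
  simp only [hs] at h1
  have h2 := h1.unique ((hσ.smul_const v).const_add a)
  rw [pullback, h2, hs, smul_add, smul_smul, smul_smul]
  simp

variable [HasAntidiagonal G]

/-- Projecting the flow equation to length one turns it into the equation ∂V = u ∘ V for the
components, which the tree sums also satisfy. The reparametrisation `σ` contributes its derivative
to `u` and does not change the result. -/
theorem IsFlow.toFam_eq_hom [AddCommGroup A] [Module ℂ A] {𝒜 : ℤ → Submodule ℂ A}
    [DirectSum.Decomposition 𝒜] {b u : ℝ × ℝ → Fam G A A} {Q : ℝ × ℝ → Module.End ℂ (Bar G A)}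
    (hQ : IsFlow u Q) (hu : IsIsotopy 𝒜 b u) (s : ℝ) {h : ℝ → Fam G A A}
    (hc : ∀ k β x, (fun s => h s k β x) ∈ finSums (contFun ℝ) A) (hp : ∀ s k, h s k 0 = 0)
    {σ σ' : ℝ → ℝ} (hσ : ∀ t, HasDerivAt σ (σ' t) t) (hσ0 : σ 0 = 0) (hσ1 : σ 1 = 1)
    (hσn : ∀ t, 0 ≤ σ t) (huh : ∀ t, u (t, s) = (σ' t : ℂ) • h (σ t)) {γ : IntervalForm G A}
    (hh : ∀ s ∈ Set.Icc 0 1, h s = γ.h s) :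
    Bar.toFam (Bar.proj ∘ₗ Q (1, s)) = γ.hom := by
  have h0 : ∀ p, Bar.proj (Q p (Bar.e 0)) = 0 := fun p => by
    rw [hQ.apply_e_zero hu, Bar.proj_e]
  funext N β
  ext x
  obtain ⟨y, rfl⟩ := exists_extension x
  rw [IntervalForm.hom_apply hc hp hh]
  refine (eq_sum_posTrees hc hp hσ hσ0 hσn (u := fun t => u (t, s))
    (V := fun t => Bar.toFam (Bar.proj ∘ₗ Q (t, s))) huh
    (fun t => Bar.toFam_zero (h0 _)) ?_ ?_ N β y 1).trans (by rw [hσ1])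
  · intro N β x
    rw [Bar.toFam_apply, LinearMap.comp_apply, hQ.init]; rfl
  · intro N β x l t
    have h1 := ((hQ.deriv (Bar.word N x β)).map Bar.proj).hasDerivAt l t s
    simp only [evenCoder, Bar.proj_ins] at h1
    rw [(hQ.isCoalgMap hu (t, s)).comp_eq (h0 _)]
    simp only [Bar.toFam_apply]
    exact h1

variable [NonUnitalRing A] [Module ℂ A] [IsScalarTower ℂ A A] [SMulCommClass ℂ A A]

variable {𝒜 : ℤ → Submodule ℂ A} [DirectSum.Decomposition 𝒜] [SetLike.GradedMul 𝒜]
  {D : A →ₗ[ℂ] A}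

theorem IsTwoPseudoIsotopy.toFam_eq_hom (hD : IsDGDifferential 𝒜 D) {α : TriangleForm G A}
    (hα : IsTwoPseudoIsotopy 𝒜 D α) {Ψ : ℝ × ℝ → ℝ × ℝ} (hΨ : ContDiff ℝ ∞ Ψ)
    (hT : ∀ p, Ψ p ∈ triangle) {Q : ℝ × ℝ → Module.End ℂ (Bar G A)}
    (hQ : IsFlow (α.pullback Ψ (1, 0)) Q) {s : ℝ} (a v : ℝ × ℝ)
    (hs : ∀ t, Ψ (t, s) = a + Real.smoothTransition t • v) {γ : IntervalForm G A}
    (hγ : ∀ t, γ.h t = (v.1 : ℂ) • α.h₁ (a + t • v) + (v.2 : ℂ) • α.h₂ (a + t • v)) :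
    Bar.toFam (Bar.proj ∘ₗ Q (1, s)) = γ.hom := by
  have hmem : ∀ t ∈ Set.Icc (0 : ℝ) 1, a + t • v ∈ triangle := fun t ht => by
    -- Every point of the segment is reached by `Ψ`, because `smoothTransition` maps [0,1] onto
    -- [0,1].
    obtain ⟨r, -, rfl⟩ := intermediate_value_Icc zero_le_one
      Real.smoothTransition.continuous.continuousOn (by simpa using ht)
    rw [← hs]
    exact hT _
  have hmem' : ∀ t, a + (Set.projIcc (0 : ℝ) 1 zero_le_one t : ℝ) • v ∈ triangle :=
    fun t => hmem _ (Set.projIcc _ _ _ t).2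
  have hpath : Continuous fun t : ℝ => a + (Set.projIcc (0 : ℝ) 1 zero_le_one t : ℝ) • v :=
    continuous_const.add ((continuous_subtype_val.comp continuous_projIcc).smul continuous_const)
  have hfin : ∀ {f : ℝ × ℝ → A}, IsSmooth f →
      (fun t : ℝ => f (a + (Set.projIcc (0 : ℝ) 1 zero_le_one t : ℝ) • v)) ∈
        finSums (contFun ℝ) A := fun ⟨n, c, w, hc, hf⟩ => by
    simp only [fun t => hf _ (hmem' t)]
    rw [show (fun t : ℝ => ∑ i, c i (a + (Set.projIcc (0 : ℝ) 1 zero_le_one t : ℝ) • v) • w i) =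
      ∑ i, fun t : ℝ => c i (a + (Set.projIcc (0 : ℝ) 1 zero_le_one t : ℝ) • v) • w i by
        ext t; rw [Finset.sum_apply]]
    exact Submodule.sum_mem _ fun i _ => smul_const_mem_finSums (show Continuous _ from
      (hc i).continuousOn.comp_continuous hpath hmem') _
  have hσ : ∀ t, HasDerivAt Real.smoothTransition (deriv Real.smoothTransition t) t := fun t =>
    ((Real.smoothTransition.contDiff (n := 1)).differentiable (by simp) t).hasDerivAt
  -- The form is controlled only on the triangle, so it is extended beyond [0,1] by clamping the
  -- time; the extension is merely continuous, which is enough for tree integrals.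
  refine hQ.toFam_eq_hom (hα.isFlatSquare hD hΨ hT).toIsIsotopy s
    (h := fun t => γ.h (Set.projIcc (0 : ℝ) 1 zero_le_one t)) ?_ ?_ hσ Real.smoothTransition.zero
    Real.smoothTransition.one Real.smoothTransition.nonneg ?_ ?_
  · intro k β x
    simp only [hγ]
    exact add_mem (Submodule.smul_mem _ _ (hfin (hα.smooth k β x).2.1))
      (Submodule.smul_mem _ _ (hfin (hα.smooth k β x).2.2.1))
  · intro t k
    have := hα.positive _ (hmem' t) k
    simp [hγ, this]
  · intro t
    rw [α.pullback_path hΨ (hσ t) hs, hγ, Set.projIcc_of_mem zero_le_one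
      ⟨Real.smoothTransition.nonneg t, Real.smoothTransition.le_one t⟩]
  · intro t ht
    simp only [Set.projIcc_of_mem zero_le_one ht]

theorem IsTwoPseudoIsotopy.isAInfHom (hD : IsDGDifferential 𝒜 D) {α : TriangleForm G A}
    (hα : IsTwoPseudoIsotopy 𝒜 D α) {Ψ : ℝ × ℝ → ℝ × ℝ} (hΨ : ContDiff ℝ ∞ Ψ)
    (hT : ∀ p, Ψ p ∈ triangle) {Q : ℝ × ℝ → Module.End ℂ (Bar G A)}
    (hQ : IsFlow (α.pullback Ψ (1, 0)) Q) (s : ℝ) :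
    IsAInfHom 𝒜 (barDifferential G 𝒜 D + α.m (Ψ (0, s)))
      𝒜 (barDifferential G 𝒜 D + α.m (Ψ (1, s))) (Bar.toFam (Bar.proj ∘ₗ Q (1, s))) := by
  have h := (hα.isFlatSquare hD hΨ hT).toIsIsotopy
  exact (hQ.isCoalgMap h _).isAInfHom 𝒜 𝒜 (by rw [hQ.apply_e_zero h, Bar.proj_e])
    (hQ.map_scale_comp h _ _) (hQ.coder_comp h (1, s))

end FlowTrees

end AInf

end

/-! ### Conclusion -/

theorem mainTheorem2 {A : Type u} [NonUnitalRing A] [Module ℂ A] [IsScalarTower ℂ A A]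
    [SMulCommClass ℂ A A] (𝒜 : ℤ → Submodule ℂ A) [DirectSum.Decomposition 𝒜]
    [SetLike.GradedMul 𝒜] (D : A →ₗ[ℂ] A) (hD : AInf.IsDGDifferential 𝒜 D)
    (G : AddSubmonoid ℝ≥0) (hG : ∀ E : ℝ≥0, {β : ℝ≥0 | β ∈ G ∧ β ≤ E}.Finite)
    (α : AInf.TriangleForm G A) (hα : AInf.IsTwoPseudoIsotopy 𝒜 D α) :
    AInf.IsAInfHom 𝒜 (AInf.barDifferential G 𝒜 D + α.m (AInf.vertex 0))
      𝒜 (AInf.barDifferential G 𝒜 D + α.m (AInf.vertex 1)) (α.face 2).hom ∧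
    AInf.IsAInfHom 𝒜 (AInf.barDifferential G 𝒜 D + α.m (AInf.vertex 1))
      𝒜 (AInf.barDifferential G 𝒜 D + α.m (AInf.vertex 2)) (α.face 0).hom ∧
    AInf.AreHomotopic 𝒜 (AInf.barDifferential G 𝒜 D + α.m (AInf.vertex 0))
      𝒜 (AInf.barDifferential G 𝒜 D + α.m (AInf.vertex 2))
      (α.face 1).hom ((α.face 0).hom.comp (α.face 2).hom) := by
  classical
  have := AInf.nonempty_hasAntidiagonal hG
  obtain ⟨_⟩ := this
  have h := hα.isFlatSquare hD AInf.contDiff_squareMap AInf.squareMap_mem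
  have h' := (hα.isFlatSquare hD AInf.contDiff_edgeMap AInf.edgeMap_mem).toIsIsotopy
  obtain ⟨Q, hQ⟩ := h.toIsIsotopy.exists_flow
  obtain ⟨K, hK⟩ := h.exists_secondFlow hQ
  obtain ⟨R, hR⟩ := h'.exists_flow
  -- For `s = 1` the segment starts at the vertex 1 with direction `(-1, 1)`, for `s = 0` at the
  -- vertex 0 with direction `(0, 1)`; these are the faces opposite to 0 and 1.
  have h0 : AInf.Bar.toFam (AInf.Bar.proj ∘ₗ Q (1, 1)) = (α.face 0).hom :=
    hα.toFam_eq_hom hD AInf.contDiff_squareMap AInf.squareMap_mem hQ (1, 0) (-1, 1)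
      (fun t => by ext <;> simp [AInf.squareMap, sub_eq_add_neg])
      (fun t => by simp [AInf.TriangleForm.face, sub_eq_add_neg, add_comm])
  have h1 : AInf.Bar.toFam (AInf.Bar.proj ∘ₗ Q (1, 0)) = (α.face 1).hom :=
    hα.toFam_eq_hom hD AInf.contDiff_squareMap AInf.squareMap_mem hQ (0, 0) (0, 1)
      (fun t => by ext <;> simp [AInf.squareMap])
      (fun t => by simp [AInf.TriangleForm.face])
  have h2 : AInf.Bar.toFam (AInf.Bar.proj ∘ₗ R (1, 0)) = (α.face 2).hom :=
    hα.toFam_eq_hom hD AInf.contDiff_edgeMap AInf.edgeMap_mem hR (0, 0) (1, 0)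
      (fun t => by ext <;> simp [AInf.edgeMap])
      (fun t => by simp [AInf.TriangleForm.face])
  have hH := (hα.isCoalgHomotopy hD hQ hK hR).areHomotopic
    (hα.isAInfAlgebra hD (by simp [AInf.vertex, AInf.triangle]))
  have hF2 := hα.isAInfHom hD AInf.contDiff_edgeMap AInf.edgeMap_mem hR 0
  have hF0 := hα.isAInfHom hD AInf.contDiff_squareMap AInf.squareMap_mem hQ 1
  have hv : AInf.squareMap (0, 1) = AInf.vertex 1 ∧ AInf.squareMap (1, 1) = AInf.vertex 2 ∧
      AInf.edgeMap (0, 0) = AInf.vertex 0 ∧ AInf.edgeMap (1, 0) = AInf.vertex 1 := by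
    simp [AInf.squareMap, AInf.edgeMap, AInf.vertex]
  rw [hv.2.2.1, hv.2.2.2, h2] at hF2
  rw [hv.1, hv.2.1, h0] at hF0
  refine ⟨hF2, hF0, ?_⟩
  -- At `s = 0` the transport along the edge is trivial; at `s = 1` it is complete, and the
  -- composite of coalgebra maps becomes the composite of families.
  rw [hR.init, LinearMap.comp_id, h1, ← LinearMap.comp_assoc,
    ← AInf.Bar.toLin_toFam (AInf.Bar.proj ∘ₗ Q (1, 1)), h0,
    ← (hR.isCoalgMap h' (1, 0)).comp_eq (by rw [hR.apply_e_zero h', AInf.Bar.proj_e]), h2] at hH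
  exact hH
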